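/- Let $p\in(0,1)$ be fixed and let $m=m(n)$, $K=K(n)$ be integers with $m,K=\Theta(\sqrt n)$. Let $V$ and $V'$ be two copies of $[n]$. The planted bipartite graph is obtained by joining each pair $(u,v)\in V\times V'$ independently with probability $p$, choosing uniformly random sets $\mathcal A_0\subset V$, $\mathcal B_0\subset V'$ of size $K$, independently of each other and of the edges, and adding all edges of $\mathcal A_0\times\mathcal B_0$. Let $\xi_{uv}$ be the indicator that $(u,v)$ is an edge of the resulting graph. For $i\in V$ let $$W(i)=\frac{1}{\binom{n-1}{m-1}\binom nm}\sum_{\substack{\mathcal A\subset V,\ |\mathcal A|=m\\ i\in\mathcal A}}\ \sum_{\substack{\mathcal B\subset V'\\ |\mathcal B|=m}}Y(\mathcal A,\mathcal B)^2,\qquad Y(\mathcal A,\mathcal B)=\frac1{p^m m!}\sum_{\sigma\in\mathrm{Bij}(\mathcal A,\mathcal B)}\ \prod_{u\in\mathcal A}\xi_{u\sigma(u)} .$$ Condition on the left planted set $\mathcal A_0=A$, where $A\subset V$ is any set with $|A|=K$ (by symmetry one may take $A=\{1,\dots,K\}$), let $\mathbb E$ denote the conditional expectation, and put $Z(i)=W(i)-\mathbb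 E[W(i)]$. Then, for every fixed $\ell$, $$\mathbb E\Big[\prod_{j=1}^{\ell}\sqrt n\,Z(i(j))\Big]=o(1)+\sum_{\mu\in P_\ell^2}\ \prod_{\{j,j'\}\in\mu}C_{i(j),i(j')},\qquad C_{i,i'}=4(p^{-1}-1)e^{2(p^{-1}-1)}\Big[\mathbb 1_{i=i'}+\frac{m^2}{n}\Big],$$ as $n\to\infty$, where $P_\ell^2$ is the set of partitions of $\{1,\dots,\ell\}$ into subsets of size $2$. The $o(1)$ is uniform over all $A$ and over all choices of (not necessarily distinct) vertices $i(1),\dots,i(\ell)\in V$, each of which may be planted (in $A$) or non-planted (not in $A$). -/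

import Mathlib

open MeasureTheory ProbabilityTheory

noncomputable section

namespace PlantedBiclique

/-- An outcome `(A₀, B₀, g)` of the planted bipartite random graph on `V ∪ V'`, where `V` and `V'`
are two copies of `Fin n`: the planted vertex sets `A₀ ⊆ V` and `B₀ ⊆ V'`, and the edges `g` of the
underlying Erdős–Rényi graph (`g (u, v) = true` if `(u, v) ∈ V × V'` is an edge of it). -/
abbrev Outcome (n : ℕ) : Type :=
  Finset (Fin n) × Finset (Fin n) × (Fin n × Fin n → Bool)

/-- The law `ER(n, n, p, K, K)`: `A₀`, `B₀` are uniformly random sets of size `K`, the `n²` potential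
edges are independent and present with probability `p`, and these three choices are independent. -/
def law (n K : ℕ) (p : unitInterval) : Measure (Outcome n) :=
  (uniformOn {A : Finset (Fin n) | A.card = K}).prod
    ((uniformOn {B : Finset (Fin n) | B.card = K}).prod
      (Measure.pi fun _ : Fin n × Fin n => bernoulliMeasure true false p))

/-- The law of the model conditioned on its left planted set `A₀` being equal to `A`. -/
def lawGiven (n K : ℕ) (p : unitInterval) (A : Finset (Fin n)) : Measure (Outcome n) :=
  ProbabilityTheory.cond (law n K p) {ω | ω.1 = A}

/-- The indicator `ξ_{uv}` of the edge `(u, v)` in the planted graph: all pairs in `A₀ × B₀` are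
edges, the other ones are edges if they are so in the underlying Erdős–Rényi graph. -/
def edge {n : ℕ} (ω : Outcome n) (u v : Fin n) : ℝ :=
  if (u ∈ ω.1 ∧ v ∈ ω.2.1) ∨ ω.2.2 (u, v) = true then 1 else 0

/-- `Y(A, B)`, the normalized number of perfect matchings of the subgraph induced by `A ∪ B`, for
`A ⊆ V` and `B ⊆ V'` of size `m`. -/
def matchingCount {n : ℕ} (m : ℕ) (p : ℝ) (ω : Outcome n) (A B : Finset (Fin n)) : ℝ :=
  1 / (p ^ m * (m.factorial : ℝ)) * ∑ σ : A ≃ B, ∏ u : A, edge ω u (σ u)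

/-- The weight `W(i)` of the vertex `i ∈ V`. -/
def weight {n : ℕ} (m : ℕ) (p : ℝ) (i : Fin n) (ω : Outcome n) : ℝ :=
  1 / (((n - 1).choose (m - 1) : ℝ) * (n.choose m : ℝ)) *
    ∑ A ∈ (Finset.powersetCard m (Finset.univ : Finset (Fin n))).filter (fun A => i ∈ A),
      ∑ B ∈ Finset.powersetCard m (Finset.univ : Finset (Fin n)), matchingCount m p ω A B ^ 2

/-- The centered weight `Z(i) = W(i) - 𝔼 W(i)` in the model with left planted set `A`. -/
def centeredWeight {n : ℕ} (K m : ℕ) (p : unitInterval) (A : Finset (Fin n)) (i : Fin n)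
    (ω : Outcome n) : ℝ :=
  weight m p i ω - ∫ ω', weight m p i ω' ∂(lawGiven n K p A)

/-- The scaled joint moment `𝔼 ∏ⱼ √n Z(i(j))` in the model with left planted set `A`. -/
def jointMoment {n : ℕ} (K m : ℕ) (p : unitInterval) (A : Finset (Fin n)) {l : ℕ} (i : Fin l → Fin n) : ℝ :=
  ∫ ω, ∏ j, (√(n : ℝ) * centeredWeight K m p A (i j) ω) ∂(lawGiven n K p A)

/-- The limiting covariance `C_{i,i'}`. -/
def covar {n : ℕ} (m : ℕ) (p : ℝ) (i i' : Fin n) : ℝ :=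
  4 * (p⁻¹ - 1) * Real.exp (2 * (p⁻¹ - 1)) *
    ((if i = i' then 1 else 0) + (m : ℝ) ^ 2 / (n : ℝ))

/-- The partitions of `{1, …, l}` into subsets of size `2`. -/
def pairPartitions (l : ℕ) : Finset (Finpartition (Finset.univ : Finset (Fin l))) :=
  Finset.univ.filter fun P => ∀ s ∈ P.parts, s.card = 2

/-- Wick's sum `∑_μ ∏_{{j,j'} ∈ μ} C_{i(j),i(j')}` over the pair partitions `μ` of `{1, …, l}`. A
pair `s = {j, j'}` contributes the one factor that belongs to its enumeration with `j < j'`. -/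
def wickSum {n : ℕ} (m : ℕ) (p : ℝ) {l : ℕ} (i : Fin l → Fin n) : ℝ :=
  ∑ P ∈ pairPartitions l, ∏ s ∈ P.parts,
    ∏ q ∈ (s ×ˢ s).filter (fun q => q.1 < q.2), covar m p (i q.1) (i q.2)

end PlantedBiclique

end

noncomputable section

namespace PlantedBiclique

open scoped BigOperators

/-! Fix both planted sets, let `P` be the planted rectangle `A ×ˢ B` and put `a = p⁻¹ - 1`. The
weight of `i` is an average over random configurations: a uniform row set of size `m` containing
`i`, and two uniform matchings of these rows with a common image. Off `P` a normalized edge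
indicator is `1 + η` with independent centred bits `η` of variance `a`; on `P` it is the constant
`p⁻¹`. Hence the weight is a multilinear polynomial in the bits (`weight_eq_sum_monomial`), whose
coefficient at an edge set `T` is the mean of `(1 + a) ^ excess` over the configurations whose edges
outside `P` contain `T`. Its constant term depends on the right planted set only through its size
(`av_coefTerm_empty_eq`), so the centring is the same for every such set.

The degree-one part carries the fluctuations. Given the first matching, its overlap with the second
is the number of fixed points of a uniform permutation of `m` points, whose exponential moment is a
truncated series for `exp a`, independent of the first matching. So the main linear coefficient at
an edge `e` outside `P` is `2 * expSum a m * rowProb m i e.1 / n` (`av_linTerm_singleton`). After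
scaling by `√n` these coefficients are `O(n ^ (-1/2))`, and their covariances tend to `covar`: the
sum of `rowProb m i r * rowProb m i' r` over rows is close to the indicator of `i = i'` plus `m ^ 2
/ n`, and deleting `P` loses only a proportion `O(K / n)`.

Everything else is negligible. The square of an averaged coefficient is an average over two
independent configurations, and a remainder term survives only if one of them has a coincidence
relative to the other or to `P`. Such coincidences have expected number `O(n ^ (-3/2))`, while all
exponential weights have bounded moments, so the weighted squared coefficients, even times `n`, tend
to zero (`exists_sum_sq_av_remTerm_le`). Hypercontractivity (`bitExp_pow_le`) turns this `ℓ²` bound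
into bounds on all moments, and `abs_bitExp_prod_add_sub_le` discards the remainder from the joint
moment.

For the linear forms left over, approximate Gaussian integration by parts
(`exists_abs_moment_insert_sub_le`) reproduces the recursion of the sum over pairings
(`pairSum_insert`), which gives Wick's formula (`exists_abs_moment_sub_pairSum_le`). All bounds are
uniform in the right planted set and are finally averaged over it. -/

/-! ### Expectations over independent Bernoulli bits -/

/-- The weight of a bit under the Bernoulli law of parameter `q`. -/
def bitWeight (q : ℝ) (b : Bool) : ℝ := if b then q else 1 - q

/-- The centred and normalized bit `b / q - 1`. -/
def bit (q : ℝ) (b : Bool) : ℝ := if b then q⁻¹ - 1 else -1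

/-- The expectation of a function of independent Bernoulli bits. -/
def bitExp {ι : Type} [Fintype ι] [DecidableEq ι] (q : ℝ) (F : (ι → Bool) → ℝ) : ℝ :=
  ∑ g : ι → Bool, (∏ e, bitWeight q (g e)) * F g

lemma sum_bitWeight (q : ℝ) : ∑ b, bitWeight q b = 1 := by simp [bitWeight]

lemma bitWeight_nonneg {q : ℝ} (h0 : 0 < q) (h1 : q < 1) (b : Bool) : 0 ≤ bitWeight q b := by
  unfold bitWeight; split_ifs <;> linarith

lemma sum_bitWeight_mul_bit {q : ℝ} (h0 : 0 < q) : ∑ b, bitWeight q b * bit q b = 0 := by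
  simp [bitWeight, bit]; field_simp; ring

lemma sum_bitWeight_mul_bit_sq {q : ℝ} (h0 : 0 < q) :
    ∑ b, bitWeight q b * bit q b ^ 2 = q⁻¹ - 1 := by
  simp [bitWeight, bit]; field_simp; ring

lemma abs_bit_le {q : ℝ} (h0 : 0 < q) (h1 : q < 1) (b : Bool) : |bit q b| ≤ q⁻¹ := by
  have h2 : 1 ≤ q⁻¹ := (one_le_inv₀ h0).2 h1.le
  unfold bit; split_ifs
  · rw [abs_of_nonneg (by linarith)]; linarith
  · simpa using h2

section bitExp
variable {ι : Type} [Fintype ι] [DecidableEq ι] (q : ℝ)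

lemma bitExp_add (F G : (ι → Bool) → ℝ) :
    bitExp q (fun g => F g + G g) = bitExp q F + bitExp q G := by
  simp [bitExp, mul_add, Finset.sum_add_distrib]

lemma bitExp_sub (F G : (ι → Bool) → ℝ) :
    bitExp q (fun g => F g - G g) = bitExp q F - bitExp q G := by
  simp [bitExp, mul_sub, Finset.sum_sub_distrib]

lemma bitExp_const_mul (c : ℝ) (F : (ι → Bool) → ℝ) :
    bitExp q (fun g => c * F g) = c * bitExp q F := by
  simp only [bitExp, Finset.mul_sum]
  exact Finset.sum_congr rfl fun _ _ => by ring

lemma bitExp_sum {κ : Type*} (s : Finset κ) (F : κ → (ι → Bool) → ℝ) :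
    bitExp q (fun g => ∑ a ∈ s, F a g) = ∑ a ∈ s, bitExp q (F a) := by
  simp only [bitExp, Finset.mul_sum]
  exact Finset.sum_comm

lemma sum_prod_bitWeight : ∑ g : ι → Bool, ∏ e, bitWeight q (g e) = 1 := by
  have := Finset.prod_univ_sum (fun _ : ι => (Finset.univ : Finset Bool))
    (fun _ b => bitWeight q b)
  simp only [sum_bitWeight, Finset.prod_const_one] at this
  rw [this, Fintype.piFinset_univ]

lemma bitExp_const (c : ℝ) : bitExp (ι := ι) q (fun _ => c) = c := by
  simp only [bitExp, ← Finset.sum_mul, sum_prod_bitWeight, one_mul]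

/-- Integrating out the coordinate `e` first. -/
lemma bitExp_resample (e : ι) (F : (ι → Bool) → ℝ) :
    bitExp q F = bitExp q (fun g => ∑ b, bitWeight q b * F (Function.update g e b)) := by
  have key : ∑ x : (ι → Bool) × Bool,
      (∏ j, bitWeight q (x.1 j)) * (bitWeight q x.2 * F (Function.update x.1 e x.2)) =
      ∑ x : (ι → Bool) × Bool, (∏ j, bitWeight q (x.1 j)) * (bitWeight q x.2 * F x.1) := by
    -- Exchanging the coordinate `g e` with the fresh bit is an involution that preserves the total
    -- weight.
    refine Finset.sum_nbij' (fun x => (Function.update x.1 e x.2, x.1 e))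
      (fun x => (Function.update x.1 e x.2, x.1 e)) (by simp) (by simp) (by simp) (by simp) ?_
    rintro ⟨g, b⟩ -
    have h : (∏ j, bitWeight q (Function.update g e b j)) * bitWeight q (g e) =
        (∏ j, bitWeight q (g j)) * bitWeight q b := by
      rw [Fintype.prod_eq_mul_prod_compl e, Fintype.prod_eq_mul_prod_compl e]
      have : ∏ i ∈ ({e} : Finset ι)ᶜ, bitWeight q (Function.update g e b i) =
          ∏ i ∈ ({e} : Finset ι)ᶜ, bitWeight q (g i) :=
        Finset.prod_congr rfl fun i hi => by
          rw [Function.update_of_ne (by simpa using hi)]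
      rw [this]; simp; ring
    simp only
    rw [← mul_assoc, ← h]; ring
  rw [Fintype.sum_prod_type, Fintype.sum_prod_type] at key
  unfold bitExp
  simp only [Finset.mul_sum]
  rw [key]
  refine Finset.sum_congr rfl fun g _ => ?_
  simp only
  rw [← Finset.mul_sum, ← Finset.sum_mul, sum_bitWeight, one_mul]

variable {q}

lemma bitExp_mono (h0 : 0 < q) (h1 : q < 1) {F G : (ι → Bool) → ℝ} (h : ∀ g, F g ≤ G g) :
    bitExp q F ≤ bitExp q G :=
  Finset.sum_le_sum fun g _ => mul_le_mul_of_nonneg_left (h g)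
    (Finset.prod_nonneg fun _ _ => bitWeight_nonneg h0 h1 _)

lemma abs_bitExp_le (h0 : 0 < q) (h1 : q < 1) (F : (ι → Bool) → ℝ) :
    |bitExp q F| ≤ bitExp q (fun g => |F g|) := by
  refine (Finset.abs_sum_le_sum_abs _ _).trans (Finset.sum_le_sum fun g _ => ?_)
  rw [abs_mul, abs_of_nonneg (Finset.prod_nonneg fun _ _ => bitWeight_nonneg h0 h1 _)]

/-- A function of the bit `e` is independent of a function which does not depend on that bit. -/
lemma bitExp_mul_of_update (e : ι) (φ : Bool → ℝ) (F : (ι → Bool) → ℝ)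
    (hF : ∀ g b, F (Function.update g e b) = F g) :
    bitExp q (fun g => φ (g e) * F g) = (∑ b, bitWeight q b * φ b) * bitExp q F := by
  rw [bitExp_resample q e, ← bitExp_const_mul]
  congr 1; ext g
  simp only [Function.update_self, hF, Finset.sum_mul]
  exact Finset.sum_congr rfl fun _ _ => by ring

end bitExp

/-! ### Hypercontractivity for multilinear polynomials in the bits -/

/-- A second-order Taylor bound with a constant chosen to make the induction close: multiplying by
`y = u + (y - u)` requires only `(k + 2) + (k + 2) ^ 2 ≤ (k + 3) ^ 2`. -/
lemma pow_le_taylor {y u W : ℝ} (hy : 0 ≤ y) (hu : 0 ≤ u) (hyW : y ≤ W) (huW : u ≤ W) (k : ℕ) :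
    y ^ (k + 2) ≤ u ^ (k + 2) + (k + 2) * u ^ (k + 1) * (y - u) +
      ((k : ℝ) + 2) ^ 2 * W ^ k * (y - u) ^ 2 := by
  have hW : 0 ≤ W := hy.trans hyW
  induction k with
  | zero => norm_num; nlinarith [sq_nonneg (y - u)]
  | succ k ih =>
    have h1 := mul_le_mul_of_nonneg_left ih hy
    have h2 : u ^ (k + 1) ≤ W ^ (k + 1) := pow_le_pow_left₀ hu huW _
    have h3 : y * W ^ k ≤ W ^ (k + 1) := by
      rw [pow_succ']; exact mul_le_mul_of_nonneg_right hyW (by positivity)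
    have e1 : y ^ (k + 1 + 2) = y * y ^ (k + 2) := by ring
    rw [e1]
    refine h1.trans ?_
    have e2 : y * (u ^ (k + 2) + (k + 2) * u ^ (k + 1) * (y - u) +
        ((k : ℝ) + 2) ^ 2 * W ^ k * (y - u) ^ 2) =
        u ^ (k + 3) + (k + 3) * u ^ (k + 2) * (y - u) + ((k + 2) * u ^ (k + 1) +
          ((k : ℝ) + 2) ^ 2 * (y * W ^ k)) * (y - u) ^ 2 := by ring
    rw [e2]
    push_cast
    have h4 : (k + 2) * u ^ (k + 1) + ((k : ℝ) + 2) ^ 2 * (y * W ^ k) ≤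
        ((k : ℝ) + 1 + 2) ^ 2 * W ^ (k + 1) := by
      have : 0 ≤ W ^ (k + 1) := by positivity
      nlinarith [mul_le_mul_of_nonneg_left h2 (by positivity : (0 : ℝ) ≤ k + 2),
        mul_le_mul_of_nonneg_left h3 (by positivity : (0 : ℝ) ≤ ((k : ℝ) + 2) ^ 2)]
    have h5 := mul_le_mul_of_nonneg_right h4 (sq_nonneg (y - u))
    have e3 : (k + 1 + 2 : ℝ) = k + 3 := by ring
    rw [e3] at *
    linarith

/-- The constant of the hypercontractive inequality. -/
def hyperConst (M : ℝ) (k : ℕ) : ℝ :=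
  M ^ 2 * (1 + (k + 2) + 8 * ((k : ℝ) + 2) ^ 2 * 2 ^ k)

lemma hyperConst_nonneg (M : ℝ) (k : ℕ) : 0 ≤ hyperConst M k := by
  unfold hyperConst; positivity

/-- This is the one-bit step of hypercontractivity. In a Taylor expansion about `u` the term linear
in `x` averages to zero, and `c ^ 2 ≤ u * v` both keeps the quadratic form nonnegative and makes the
squared deviation of order `v`. What remains is absorbed by enlarging the multiple of `v`. -/
lemma two_point_le {w x : Bool → ℝ} {M u v c : ℝ} (hw : ∀ b, 0 ≤ w b) (hw1 : ∑ b, w b = 1)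
    (hx : ∑ b, w b * x b = 0) (hM : ∀ b, |x b| ≤ M) (hu : 0 ≤ u) (hv : 0 ≤ v)
    (hc : c ^ 2 ≤ u * v) (k : ℕ) :
    ∑ b, w b * (u + 2 * x b * c + x b ^ 2 * v) ^ (k + 2) ≤ (u + hyperConst M k * v) ^ (k + 2) := by
  have hM0 : 0 ≤ M := (abs_nonneg _).trans (hM true)
  have hx2 : ∀ b, x b ^ 2 ≤ M ^ 2 := fun b => by
    rw [← sq_abs]; exact pow_le_pow_left₀ (abs_nonneg _) (hM b) 2
  set z := u + M ^ 2 * v with hz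
  have hz0 : 0 ≤ z := by positivity
  have huz : u ≤ z := by rw [hz]; nlinarith [mul_nonneg (sq_nonneg M) hv]
  have hterm : ∀ b, (u + 2 * x b * c + x b ^ 2 * v) ^ (k + 2) ≤
      u ^ (k + 2) + (k + 2) * u ^ (k + 1) * (2 * x b * c + M ^ 2 * v) +
        ((k : ℝ) + 2) ^ 2 * (2 * z) ^ k * (8 * M ^ 2 * v * z) := by
    intro b
    have hxc : (x b * c) ^ 2 ≤ (x b ^ 2 * v) * u := by
      rw [mul_pow]; nlinarith [mul_le_mul_of_nonneg_left hc (sq_nonneg (x b))]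
    have hs0 : 0 ≤ x b ^ 2 * v := by positivity
    have hsM : x b ^ 2 * v ≤ M ^ 2 * v := mul_le_mul_of_nonneg_right (hx2 b) hv
    have habs : |2 * (x b * c)| ≤ u + x b ^ 2 * v := by
      apply abs_le_of_sq_le_sq _ (by positivity)
      nlinarith [sq_nonneg (u - x b ^ 2 * v)]
    obtain ⟨hl, hr⟩ := abs_le.1 habs
    have hy0 : 0 ≤ u + 2 * x b * c + x b ^ 2 * v := by linarith
    have hyW : u + 2 * x b * c + x b ^ 2 * v ≤ 2 * z := by rw [hz]; linarith
    have ht := pow_le_taylor hy0 hu hyW (by linarith) k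
    have e1 : u + 2 * x b * c + x b ^ 2 * v - u = 2 * (x b * c) + x b ^ 2 * v := by ring
    rw [e1] at ht
    refine ht.trans ?_
    have hsq : (2 * (x b * c) + x b ^ 2 * v) ^ 2 ≤ 8 * M ^ 2 * v * z := by
      have : (2 * (x b * c) + x b ^ 2 * v) ^ 2 ≤ 8 * (x b * c) ^ 2 + 2 * (x b ^ 2 * v) ^ 2 := by
        nlinarith [sq_nonneg (2 * (x b * c) - x b ^ 2 * v)]
      have h2 : (x b ^ 2 * v) * u ≤ (M ^ 2 * v) * u := mul_le_mul_of_nonneg_right hsM hu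
      have h3 : (x b ^ 2 * v) ^ 2 ≤ (M ^ 2 * v) ^ 2 := pow_le_pow_left₀ hs0 hsM 2
      have h4 : 0 ≤ (M ^ 2 * v) ^ 2 := sq_nonneg _
      have : 8 * M ^ 2 * v * z = 8 * ((M ^ 2 * v) * u) + 8 * (M ^ 2 * v) ^ 2 := by rw [hz]; ring
      linarith
    have := mul_le_mul_of_nonneg_left hsq
      (by positivity : 0 ≤ ((k : ℝ) + 2) ^ 2 * (2 * z) ^ k)
    have h5 : ((k : ℝ) + 2) * u ^ (k + 1) * (2 * (x b * c) + x b ^ 2 * v) ≤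
        (k + 2) * u ^ (k + 1) * (2 * x b * c + M ^ 2 * v) :=
      mul_le_mul_of_nonneg_left (by linarith) (by positivity)
    linarith
  have hsum : ∑ b, w b * (u + 2 * x b * c + x b ^ 2 * v) ^ (k + 2) ≤
      u ^ (k + 2) + (k + 2) * u ^ (k + 1) * (M ^ 2 * v) +
        ((k : ℝ) + 2) ^ 2 * (2 * z) ^ k * (8 * M ^ 2 * v * z) := by
    refine (Finset.sum_le_sum fun b _ => mul_le_mul_of_nonneg_left (hterm b) (hw b)).trans
      (le_of_eq ?_)
    simp only [Fintype.sum_bool] at hw1 hx ⊢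
    linear_combination (u ^ (k + 2) + (k + 2) * u ^ (k + 1) * (M ^ 2 * v) +
        ((k : ℝ) + 2) ^ 2 * (2 * z) ^ k * (8 * M ^ 2 * v * z)) * hw1 +
        ((k + 2) * u ^ (k + 1) * 2 * c) * hx
  refine hsum.trans ?_
  -- With this `d`, the term `d * v * z ^ (k + 1)` is exactly the sum of the first- and second-order
  -- Taylor corrections once `u` is replaced by `z`.
  set d := M ^ 2 * ((k + 2) + 8 * ((k : ℝ) + 2) ^ 2 * 2 ^ k) with hd
  have hd0 : 0 ≤ d := by positivity
  have e : u + hyperConst M k * v = z + d * v := by rw [hz, hd, hyperConst]; ring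
  rw [e]
  have h1 : z ^ (k + 1) ≤ (z + d * v) ^ (k + 1) :=
    pow_le_pow_left₀ hz0 (by nlinarith [mul_nonneg hd0 hv]) _
  have h2 : (z + d * v) * z ^ (k + 1) ≤ (z + d * v) ^ (k + 2) := by
    rw [pow_succ' _ (k + 1)]
    exact mul_le_mul_of_nonneg_left h1 (by positivity)
  refine le_trans ?_ h2
  have h3 : u ^ (k + 1) ≤ z ^ (k + 1) := pow_le_pow_left₀ hu huz _
  have h4 : u ^ (k + 2) ≤ z ^ (k + 2) := pow_le_pow_left₀ hu huz _
  have h5 := mul_le_mul_of_nonneg_left h3 (by positivity : 0 ≤ ((k : ℝ) + 2) * (M ^ 2 * v))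
  have e5 : (z + d * v) * z ^ (k + 1) = z ^ (k + 2) + ((k : ℝ) + 2) * (M ^ 2 * v) * z ^ (k + 1) +
      ((k : ℝ) + 2) ^ 2 * (2 * z) ^ k * (8 * M ^ 2 * v * z) := by
    rw [hd, mul_pow]; ring
  rw [e5]; linarith

/-- The monomial `∏_{e ∈ T} η_e` in the normalized bits. -/
def monomial {ι : Type} (q : ℝ) (T : Finset ι) (g : ι → Bool) : ℝ := ∏ e ∈ T, bit q (g e)

lemma monomial_update_of_notMem {ι : Type} [DecidableEq ι] (q : ℝ) {T : Finset ι} {e : ι}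
    (he : e ∉ T) (g : ι → Bool) (b : Bool) :
    monomial q T (Function.update g e b) = monomial q T g :=
  Finset.prod_congr rfl fun i hi => by
    rw [Function.update_of_ne (ne_of_mem_of_not_mem hi he)]

/-- Hypercontractivity for vectors of multilinear polynomials in independent bits. -/
theorem bitExp_sum_sq_pow_le {q : ℝ} (h0 : 0 < q) (h1 : q < 1) (k : ℕ) {ι : Type} [Fintype ι]
    [DecidableEq ι] (s : Finset ι) : ∀ (κ : Type) [Fintype κ] (c : κ → Finset ι → ℝ),
    bitExp q (fun g => (∑ a, (∑ T ∈ s.powerset, c a T * monomial q T g) ^ 2) ^ (k + 2)) ≤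
      (∑ a, ∑ T ∈ s.powerset, hyperConst q⁻¹ k ^ T.card * c a T ^ 2) ^ (k + 2) := by
  induction s using Finset.induction_on with
  | empty =>
    intro κ _ c
    simp [monomial, bitExp_const]
  | insert e s he ih =>
    intro κ _ c
    set D := hyperConst q⁻¹ k with hD
    have hD0 : 0 ≤ D := hyperConst_nonneg _ _
    -- Splitting off the bit `e` writes each polynomial as `H + η G`. Integrating `η` out replaces
    -- it by the two entries `H` and `√D * G`, so the vector doubles in length; this is why the
    -- induction has to range over all index types `κ`.
    let c' : κ ⊕ κ → Finset ι → ℝ := Sum.elim c fun a T => √D * c a (insert e T)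
    have hih := ih (κ ⊕ κ) c'
    let H : κ → (ι → Bool) → ℝ := fun a g => ∑ T ∈ s.powerset, c a T * monomial q T g
    let G : κ → (ι → Bool) → ℝ := fun a g => ∑ T ∈ s.powerset, c a (insert e T) * monomial q T g
    have hnot : ∀ T ∈ s.powerset, e ∉ T := fun T hT h => he (Finset.mem_powerset.1 hT h)
    have hH : ∀ a g b, H a (Function.update g e b) = H a g := fun a g b =>
      Finset.sum_congr rfl fun T hT => by rw [monomial_update_of_notMem q (hnot T hT)]
    have hG : ∀ a g b, G a (Function.update g e b) = G a g := fun a g b =>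
      Finset.sum_congr rfl fun T hT => by rw [monomial_update_of_notMem q (hnot T hT)]
    have hsplit : ∀ a g, ∑ T ∈ (insert e s).powerset, c a T * monomial q T g =
        H a g + bit q (g e) * G a g := by
      intro a g
      rw [Finset.sum_powerset_insert he, Finset.mul_sum]
      congr 1
      refine Finset.sum_congr rfl fun T hT => ?_
      rw [monomial, Finset.prod_insert (hnot T hT), monomial]; ring
    have hL : bitExp q (fun g => (∑ a, (∑ T ∈ (insert e s).powerset,
        c a T * monomial q T g) ^ 2) ^ (k + 2)) ≤
        bitExp q (fun g => (∑ a, (∑ T ∈ s.powerset, c' a T * monomial q T g) ^ 2) ^ (k + 2)) := by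
      -- Only the bit `e` is integrated, the others being frozen. The two-point inequality applies
      -- pointwise, with Cauchy–Schwarz providing its hypothesis on `c`.
      rw [bitExp_resample q e]
      refine bitExp_mono h0 h1 fun g => ?_
      simp only [hsplit, hH, hG, Function.update_self]
      have h2 : ∑ a, (∑ T ∈ s.powerset, c' a T * monomial q T g) ^ 2 =
          ∑ a, H a g ^ 2 + D * ∑ a, G a g ^ 2 := by
        rw [Fintype.sum_sum_type, Finset.mul_sum]
        congr 1
        refine Finset.sum_congr rfl fun a _ => ?_
        simp only [c', Sum.elim_inr, mul_assoc, ← Finset.mul_sum]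
        rw [mul_pow, Real.sq_sqrt hD0]
      rw [h2]
      have h3 := two_point_le (w := bitWeight q) (x := bit q) (M := q⁻¹) (u := ∑ a, H a g ^ 2)
        (v := ∑ a, G a g ^ 2) (c := ∑ a, H a g * G a g) (bitWeight_nonneg h0 h1)
        (sum_bitWeight q) (sum_bitWeight_mul_bit h0) (abs_bit_le h0 h1)
        (Finset.sum_nonneg fun _ _ => sq_nonneg _) (Finset.sum_nonneg fun _ _ => sq_nonneg _)
        (Finset.sum_mul_sq_le_sq_mul_sq _ _ _) k
      refine le_trans (le_of_eq ?_) h3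
      refine Finset.sum_congr rfl fun b _ => ?_
      congr 2
      simp only [Finset.mul_sum, ← Finset.sum_add_distrib]
      exact Finset.sum_congr rfl fun a _ => by ring
    refine hL.trans (hih.trans (le_of_eq ?_))
    congr 1
    rw [Fintype.sum_sum_type, ← Finset.sum_add_distrib]
    refine Finset.sum_congr rfl fun a _ => ?_
    rw [Finset.sum_powerset_insert he]
    congr 1
    refine Finset.sum_congr rfl fun T hT => ?_
    simp only [c', Sum.elim_inr]
    rw [Finset.card_insert_of_notMem (hnot T hT), mul_pow, Real.sq_sqrt hD0]; ring

/-- Hypercontractivity for one multilinear polynomial in independent bits. -/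
theorem bitExp_pow_le {q : ℝ} (h0 : 0 < q) (h1 : q < 1) (k : ℕ) {ι : Type} [Fintype ι]
    [DecidableEq ι] (c : Finset ι → ℝ) :
    bitExp q (fun g => (∑ T, c T * monomial q T g) ^ (2 * (k + 2))) ≤
      (∑ T, hyperConst q⁻¹ k ^ T.card * c T ^ 2) ^ (k + 2) := by
  have := bitExp_sum_sq_pow_le h0 h1 k (Finset.univ : Finset ι) Unit (fun _ => c)
  simpa [pow_mul] using this

/-! ### Linear forms: moment bounds and approximate integration by parts -/

/-- The linear form `∑ₑ xₑ ηₑ` in the normalized bits. -/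
def linForm {ι : Type} [Fintype ι] (q : ℝ) (x : ι → ℝ) (g : ι → Bool) : ℝ :=
  ∑ e, x e * bit q (g e)

lemma sum_powersetCard_one {ι : Type*} (s : Finset ι) (f : Finset ι → ℝ) :
    ∑ T ∈ s.powerset with T.card = 1, f T = ∑ e ∈ s, f {e} := by
  rw [← Finset.powersetCard_eq_filter, Finset.powersetCard_one, Finset.sum_map]
  rfl

lemma sum_card_eq_one {ι : Type*} [Fintype ι] (f : Finset ι → ℝ) :
    ∑ T : Finset ι, (if T.card = 1 then f T else 0) = ∑ e, f {e} := by
  rw [← sum_powersetCard_one, Finset.powerset_univ, Finset.sum_filter]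

/-- Either every factor is at most one, or the largest exceeds one and its power of exponent `2 * k`
dominates the whole product. -/
lemma prod_abs_le_one_add {J : Type*} (t : Finset J) (y : J → ℝ) {k : ℕ} (ht : t.card ≤ 2 * k) :
    ∏ j ∈ t, |y j| ≤ 1 + ∑ j ∈ t, y j ^ (2 * k) := by
  have hnn : ∀ j, 0 ≤ y j ^ (2 * k) := fun j => (even_two_mul k).pow_nonneg _
  by_cases h : ∀ j ∈ t, |y j| ≤ 1
  · have := Finset.prod_le_one (fun j _ => abs_nonneg (y j)) h
    linarith [Finset.sum_nonneg fun j (_ : j ∈ t) => hnn j]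
  · push Not at h
    obtain ⟨j1, hj1, h1⟩ := h
    obtain ⟨j0, hj0, hmax⟩ := Finset.exists_max_image t (fun j => |y j|) ⟨j1, hj1⟩
    have h2 : 1 ≤ |y j0| := h1.le.trans (hmax j1 hj1)
    calc ∏ j ∈ t, |y j| ≤ ∏ j ∈ t, |y j0| :=
          Finset.prod_le_prod (fun j _ => abs_nonneg _) hmax
      _ = |y j0| ^ t.card := by simp
      _ ≤ |y j0| ^ (2 * k) := pow_le_pow_right₀ h2 ht
      _ = y j0 ^ (2 * k) := (even_two_mul k).pow_abs _
      _ ≤ ∑ j ∈ t, y j ^ (2 * k) := Finset.single_le_sum (fun j _ => hnn j) hj0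
      _ ≤ _ := by linarith

lemma sum_abs_mul_abs_le {ι : Type*} [Fintype ι] {S : ℝ} {x y : ι → ℝ} (hx : ∑ e, x e ^ 2 ≤ S) (hy : ∑ e, y e ^ 2 ≤ S) :
    ∑ e, |x e| * |y e| ≤ S := by
  have : ∑ e, |x e| * |y e| ≤ ∑ e, (x e ^ 2 + y e ^ 2) / 2 :=
    Finset.sum_le_sum fun e _ => by
      nlinarith [sq_nonneg (|x e| - |y e|), sq_abs (x e), sq_abs (y e)]
  rw [← Finset.sum_div, Finset.sum_add_distrib] at this
  linarith

section
variable {q : ℝ} {ι : Type} [Fintype ι] [DecidableEq ι]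

lemma bitExp_linForm_pow_le (h0 : 0 < q) (h1 : q < 1) (k : ℕ) (x : ι → ℝ) :
    bitExp q (fun g => linForm q x g ^ (2 * (k + 2))) ≤
      (hyperConst q⁻¹ k * ∑ e, x e ^ 2) ^ (k + 2) := by
  -- The inner sum over `T` merely reads off the coefficient of the unique element of a singleton.
  have h := bitExp_pow_le h0 h1 k (fun T : Finset ι => if T.card = 1 then ∑ e ∈ T, x e else 0)
  have e1 : ∀ g : ι → Bool, ∑ T : Finset ι, (if T.card = 1 then ∑ e ∈ T, x e else 0) *
      monomial q T g = linForm q x g := by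
    intro g
    simp only [ite_mul, zero_mul]
    rw [sum_card_eq_one (fun T => (∑ e ∈ T, x e) * monomial q T g)]
    simp [monomial, linForm]
  have e2 : ∑ T : Finset ι, hyperConst q⁻¹ k ^ T.card *
      (if T.card = 1 then ∑ e ∈ T, x e else 0) ^ 2 = hyperConst q⁻¹ k * ∑ e, x e ^ 2 := by
    have : ∀ T : Finset ι, hyperConst q⁻¹ k ^ T.card *
      (if T.card = 1 then ∑ e ∈ T, x e else 0) ^ 2 =
        if T.card = 1 then hyperConst q⁻¹ k ^ T.card * (∑ e ∈ T, x e) ^ 2 else 0 := by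
      intro T; split_ifs <;> simp
    simp only [this]
    rw [sum_card_eq_one (fun T => hyperConst q⁻¹ k ^ T.card * (∑ e ∈ T, x e) ^ 2)]
    simp [Finset.mul_sum]
  simp only [e1, e2] at h
  exact h

/-- A bound for the absolute joint moments of at most `l` linear forms. -/
lemma bitExp_prod_abs_linForm_le (h0 : 0 < q) (h1 : q < 1) {J : Type*} {l : ℕ} {S : ℝ}
    (hS0 : 0 ≤ S) (x : J → ι → ℝ) (hS : ∀ j, ∑ e, x j e ^ 2 ≤ S) (t : Finset J) (ht : t.card ≤ l) :
    bitExp q (fun g => ∏ j ∈ t, |linForm q (x j) g|) ≤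
      1 + l * (hyperConst q⁻¹ l * S) ^ (l + 2) := by
  have hD := hyperConst_nonneg q⁻¹ l
  refine (bitExp_mono h0 h1 fun g => prod_abs_le_one_add (k := l + 2) t _ (by omega)).trans ?_
  rw [bitExp_add, bitExp_const, bitExp_sum]
  gcongr
  have hb : ∀ j ∈ t, bitExp q (fun g => linForm q (x j) g ^ (2 * (l + 2))) ≤
      (hyperConst q⁻¹ l * S) ^ (l + 2) := fun j _ =>
    (bitExp_linForm_pow_le h0 h1 l (x j)).trans (pow_le_pow_left₀
      (mul_nonneg hD (Finset.sum_nonneg fun _ _ => sq_nonneg _))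
      (mul_le_mul_of_nonneg_left (hS j) hD) _)
  refine (Finset.sum_le_card_nsmul _ _ _ hb).trans ?_
  rw [nsmul_eq_mul]
  have : (t.card : ℝ) ≤ l := by exact_mod_cast ht
  gcongr

/-- The `k`-th moment of the normalized bit. -/
def bitMoment (q : ℝ) (k : ℕ) : ℝ := ∑ b, bitWeight q b * bit q b ^ k

lemma abs_bitMoment_le (h0 : 0 < q) (h1 : q < 1) (k : ℕ) : |bitMoment q k| ≤ q⁻¹ ^ k := by
  refine (Finset.abs_sum_le_sum_abs _ _).trans ?_
  calc ∑ b, |bitWeight q b * bit q b ^ k| ≤ ∑ b, bitWeight q b * q⁻¹ ^ k := by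
        refine Finset.sum_le_sum fun b _ => ?_
        rw [abs_mul, abs_of_nonneg (bitWeight_nonneg h0 h1 b), abs_pow]
        exact mul_le_mul_of_nonneg_left
          (pow_le_pow_left₀ (abs_nonneg _) (abs_bit_le h0 h1 b) _) (bitWeight_nonneg h0 h1 b)
    _ = q⁻¹ ^ k := by rw [← Finset.sum_mul, sum_bitWeight, one_mul]

lemma linForm_eq_add (x : ι → ℝ) (e : ι) (g : ι → Bool) :
    linForm q x g = x e * bit q (g e) + linForm q (Function.update x e 0) g := by
  simp only [linForm]
  rw [Fintype.sum_eq_add_sum_compl e, Fintype.sum_eq_add_sum_compl e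
    (fun i => Function.update x e 0 i * bit q (g i))]
  simp only [Function.update_self, zero_mul, zero_add]
  congr 1
  refine Finset.sum_congr rfl fun i hi => ?_
  rw [Function.update_of_ne (by simpa using hi)]

lemma linForm_update_zero (x : ι → ℝ) (e : ι) (g : ι → Bool) (b : Bool) :
    linForm q (Function.update x e 0) (Function.update g e b) =
      linForm q (Function.update x e 0) g := by
  refine Finset.sum_congr rfl fun i _ => ?_
  by_cases h : i = e
  · subst h; simp
  · simp [Function.update_of_ne h]

lemma sum_update_zero_sq_le (x : ι → ℝ) (e : ι) :
    ∑ i, Function.update x e 0 i ^ 2 ≤ ∑ i, x i ^ 2 := by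
  refine Finset.sum_le_sum fun i _ => ?_
  by_cases h : i = e
  · subst h; simp [sq_nonneg]
  · simp [Function.update_of_ne h]

/-- Expansion of a mixed moment in powers of one of the bits. -/
lemma bitExp_pow_mul_prod_linForm {J : Type*} [DecidableEq J] (x : J → ι → ℝ) (s : Finset J) (e : ι)
    (k : ℕ) : bitExp q (fun g => bit q (g e) ^ k * ∏ j ∈ s, linForm q (x j) g) =
      ∑ T ∈ s.powerset, bitMoment q (k + T.card) * (∏ j ∈ T, x j e) *
        bitExp q (fun g => ∏ j ∈ s \ T, linForm q (Function.update (x j) e 0) g) := by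
  have h : ∀ g : ι → Bool, bit q (g e) ^ k * ∏ j ∈ s, linForm q (x j) g =
      ∑ T ∈ s.powerset, (∏ j ∈ T, x j e) * (bit q (g e) ^ (k + T.card) *
        ∏ j ∈ s \ T, linForm q (Function.update (x j) e 0) g) := by
    intro g
    rw [Finset.prod_congr rfl fun j _ => linForm_eq_add (x j) e g, Finset.prod_add,
      Finset.mul_sum]
    refine Finset.sum_congr rfl fun T _ => ?_
    rw [Finset.prod_mul_distrib, Finset.prod_const, pow_add]; ring
  simp only [h]
  rw [bitExp_sum]
  refine Finset.sum_congr rfl fun T _ => ?_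
  rw [bitExp_const_mul, bitExp_mul_of_update e (fun b => bit q b ^ (k + T.card)) _ fun g b => by
    simp only [linForm_update_zero]]
  rw [bitMoment]; ring

lemma abs_bitExp_prod_linForm_le (h0 : 0 < q) (h1 : q < 1) {J : Type*} {l : ℕ} {S : ℝ}
    (hS0 : 0 ≤ S) (x : J → ι → ℝ) (hS : ∀ j, ∑ e, x j e ^ 2 ≤ S) (t : Finset J)
    (ht : t.card ≤ l) :
    |bitExp q (fun g => ∏ j ∈ t, linForm q (x j) g)| ≤
      1 + l * (hyperConst q⁻¹ l * S) ^ (l + 2) := by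
  refine (abs_bitExp_le h0 h1 _).trans ?_
  simp only [Finset.abs_prod]
  exact bitExp_prod_abs_linForm_le h0 h1 hS0 x hS t ht

/-- Bound for one term of the expansion of a mixed moment. -/
lemma abs_expansion_term_le (h0 : 0 < q) (h1 : q < 1) {J : Type*} [DecidableEq J] {l : ℕ} {S C : ℝ}
    (hS0 : 0 ≤ S) (hC : C = 1 + l * (hyperConst q⁻¹ l * S) ^ (l + 2))
    (x : J → ι → ℝ) (hS : ∀ j, ∑ e, x j e ^ 2 ≤ S) {s T : Finset J} (hT : T ⊆ s)
    (hs : s.card ≤ l) (e : ι) {k : ℕ} (hk : k ≤ 1) {B : ℝ} (hB : |∏ j ∈ T, x j e| ≤ B) :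
    |bitMoment q (k + T.card) * (∏ j ∈ T, x j e) *
      bitExp q (fun g => ∏ j ∈ s \ T, linForm q (Function.update (x j) e 0) g)| ≤
      q⁻¹ ^ (l + 1) * B * C := by
  have hq : 1 ≤ q⁻¹ := (one_le_inv₀ h0).2 h1.le
  have hTc := Finset.card_le_card hT
  rw [abs_mul, abs_mul]
  have hB0 : 0 ≤ B := (abs_nonneg _).trans hB
  have h2 : |bitMoment q (k + T.card)| ≤ q⁻¹ ^ (l + 1) :=
    (abs_bitMoment_le h0 h1 _).trans (pow_le_pow_right₀ hq (by omega))
  have h3 : |bitExp q (fun g => ∏ j ∈ s \ T, linForm q (Function.update (x j) e 0) g)| ≤ C := by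
    rw [hC]
    exact abs_bitExp_prod_linForm_le h0 h1 hS0 (fun j => Function.update (x j) e 0)
      (fun j => (sum_update_zero_sq_le _ _).trans (hS j)) _
      ((Finset.card_le_card Finset.sdiff_subset).trans hs)
  gcongr

lemma abs_prod_le_of_nonempty {J : Type*} [DecidableEq J] {y : J → ℝ} {δ : ℝ} (hδ1 : δ ≤ 1)
    (hy : ∀ j, |y j| ≤ δ) {T : Finset J} (hT : T.Nonempty) : |∏ j ∈ T, y j| ≤ δ := by
  obtain ⟨j, hj⟩ := hT
  rw [Finset.abs_prod, ← Finset.mul_prod_erase T _ hj]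
  have h2 : ∏ j ∈ T.erase j, |y j| ≤ 1 :=
    Finset.prod_le_one (fun _ _ => abs_nonneg _) fun i _ => (hy i).trans hδ1
  calc |y j| * ∏ j ∈ T.erase j, |y j| ≤ |y j| * 1 :=
        mul_le_mul_of_nonneg_left h2 (abs_nonneg _)
    _ ≤ δ := by simpa using hy j

/-- One factor is spent on the smallness `δ`; a second is kept, so that multiplying by a further
coefficient at the same bit and summing over the bits stays bounded by the `ℓ²` norms. -/
lemma abs_prod_le_mul_sum {J : Type*} [DecidableEq J] {y : J → ℝ} {δ : ℝ} (hδ1 : δ ≤ 1)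
    (hy : ∀ j, |y j| ≤ δ) {s T : Finset J} (hTs : T ⊆ s) (hT : 2 ≤ T.card) :
    |∏ j ∈ T, y j| ≤ δ * ∑ j ∈ s, |y j| := by
  obtain ⟨j, hj⟩ : T.Nonempty := Finset.card_pos.1 (by omega)
  have hne : (T.erase j).Nonempty := Finset.card_pos.1 (by rw [Finset.card_erase_of_mem hj]; omega)
  rw [← Finset.mul_prod_erase T _ hj, abs_mul, mul_comm]
  have hδ0 : 0 ≤ δ := (abs_nonneg _).trans (hy j)
  exact mul_le_mul (abs_prod_le_of_nonempty hδ1 hy hne)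
    (Finset.single_le_sum (f := fun j => |y j|) (fun _ _ => abs_nonneg _) (hTs hj))
    (abs_nonneg _) hδ0

/-- Removing one small coordinate hardly changes a mixed moment. -/
lemma abs_bitExp_prod_linForm_update_sub_le (h0 : 0 < q) (h1 : q < 1) {J : Type*} [DecidableEq J]
    {l : ℕ} {S C δ : ℝ} (hS0 : 0 ≤ S) (hC : C = 1 + l * (hyperConst q⁻¹ l * S) ^ (l + 2))
    (hδ0 : 0 ≤ δ) (hδ1 : δ ≤ 1) (x : J → ι → ℝ) (hS : ∀ j, ∑ e, x j e ^ 2 ≤ S)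
    (hx : ∀ j e, |x j e| ≤ δ) {s : Finset J} (hs : s.card ≤ l) (e : ι) :
    |bitExp q (fun g => ∏ j ∈ s, linForm q (Function.update (x j) e 0) g) -
      bitExp q (fun g => ∏ j ∈ s, linForm q (x j) g)| ≤ 2 ^ l * (q⁻¹ ^ (l + 1) * δ * C) := by
  have hq : 1 ≤ q⁻¹ := (one_le_inv₀ h0).2 h1.le
  have hD := hyperConst_nonneg q⁻¹ l
  have hC0 : 0 ≤ C := by rw [hC]; positivity
  have h := bitExp_pow_mul_prod_linForm (q := q) x s e 0
  -- The term of the empty set is the moment with the coordinate deleted; each other term contains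
  -- at least one small coefficient.
  rw [← Finset.add_sum_erase _ _ (Finset.empty_mem_powerset s)] at h
  simp only [pow_zero, one_mul, zero_add, Finset.card_empty, Finset.prod_empty,
    Finset.sdiff_empty] at h
  have hm : bitMoment q 0 = 1 := by simp [bitMoment, bitWeight]
  rw [hm, one_mul, one_mul] at h
  rw [h, sub_add_cancel_left, abs_neg]
  refine (Finset.abs_sum_le_sum_abs _ _).trans ?_
  have hterm : ∀ T ∈ s.powerset.erase ∅, |bitMoment q T.card * (∏ j ∈ T, x j e) *
      bitExp q (fun g => ∏ j ∈ s \ T, linForm q (Function.update (x j) e 0) g)| ≤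
      q⁻¹ ^ (l + 1) * δ * C := by
    intro T hT
    rw [Finset.mem_erase, Finset.mem_powerset] at hT
    have := abs_expansion_term_le h0 h1 hS0 hC x hS hT.2 hs e (k := 0) (by norm_num)
      (abs_prod_le_of_nonempty (y := fun j => x j e) hδ1 (fun j => hx j e)
        (Finset.nonempty_iff_ne_empty.2 hT.1))
    simpa using this
  refine (Finset.sum_le_card_nsmul _ _ _ hterm).trans ?_
  rw [nsmul_eq_mul]
  have hcard : ((s.powerset.erase ∅).card : ℝ) ≤ 2 ^ l := by
    have h2 : (s.powerset.erase ∅).card ≤ s.powerset.card :=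
      Finset.card_le_card (Finset.erase_subset _ _)
    rw [Finset.card_powerset] at h2
    exact_mod_cast h2.trans (Nat.pow_le_pow_right (by norm_num) hs)
  gcongr

/-- Approximate integration by parts with respect to one bit. -/
lemma abs_bitExp_bit_mul_prod_sub_le (h0 : 0 < q) (h1 : q < 1) {J : Type*} [DecidableEq J]
    {l : ℕ} {S C δ : ℝ} (hS0 : 0 ≤ S) (hC : C = 1 + l * (hyperConst q⁻¹ l * S) ^ (l + 2))
    (hδ0 : 0 ≤ δ) (hδ1 : δ ≤ 1) (x : J → ι → ℝ) (hS : ∀ j, ∑ e, x j e ^ 2 ≤ S)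
    (hx : ∀ j e, |x j e| ≤ δ) {s : Finset J} (hs : s.card ≤ l) (e : ι) :
    |bitExp q (fun g => bit q (g e) * ∏ j ∈ s, linForm q (x j) g) -
      ∑ k ∈ s, (q⁻¹ - 1) * x k e * bitExp q (fun g => ∏ j ∈ s.erase k, linForm q (x j) g)| ≤
      (2 ^ l * q⁻¹ ^ (l + 1) * C + q⁻¹ * (2 ^ l * (q⁻¹ ^ (l + 1) * C))) * δ *
        ∑ j ∈ s, |x j e| := by
  have hq : 1 ≤ q⁻¹ := (one_le_inv₀ h0).2 h1.le
  have hD := hyperConst_nonneg q⁻¹ l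
  have hC0 : 0 ≤ C := by rw [hC]; positivity
  have h := bitExp_pow_mul_prod_linForm (q := q) x s e 1
  simp only [pow_one] at h
  -- The expansion is sorted by the size of `T`. The empty set contributes nothing because the bit
  -- is centred, singletons produce the main terms through the variance `q⁻¹ - 1`, and larger sets
  -- contain two small coefficients.
  rw [h, ← Finset.sum_filter_add_sum_filter_not s.powerset (fun T => T.card = 1),
    sum_powersetCard_one s (fun T => bitMoment q (1 + T.card) * (∏ j ∈ T, x j e) *
        bitExp q (fun g => ∏ j ∈ s \ T, linForm q (Function.update (x j) e 0) g))]
  have hm1 : bitMoment q 1 = 0 := by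
    simpa [bitMoment] using sum_bitWeight_mul_bit h0
  have hm2 : bitMoment q 2 = q⁻¹ - 1 := sum_bitWeight_mul_bit_sq h0
  simp only [Finset.card_singleton, Finset.prod_singleton, Nat.reduceAdd, hm2,
    Finset.sdiff_singleton_eq_erase]
  rw [add_sub_right_comm, ← Finset.sum_sub_distrib]
  refine (abs_add_le _ _).trans ?_
  have hP1 : |∑ k ∈ s, ((q⁻¹ - 1) * x k e *
      bitExp q (fun g => ∏ j ∈ s.erase k, linForm q (Function.update (x j) e 0) g) -
      (q⁻¹ - 1) * x k e * bitExp q (fun g => ∏ j ∈ s.erase k, linForm q (x j) g))| ≤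
      q⁻¹ * (2 ^ l * (q⁻¹ ^ (l + 1) * C)) * δ * ∑ j ∈ s, |x j e| := by
    refine (Finset.abs_sum_le_sum_abs _ _).trans ?_
    rw [Finset.mul_sum]
    refine Finset.sum_le_sum fun k hk => ?_
    rw [← mul_sub, abs_mul, abs_mul, abs_of_nonneg (by linarith : 0 ≤ q⁻¹ - 1)]
    have h3 := abs_bitExp_prod_linForm_update_sub_le h0 h1 hS0 hC hδ0 hδ1 x hS hx
      (s := s.erase k) ((Finset.card_le_card (Finset.erase_subset _ _)).trans hs) e
    calc (q⁻¹ - 1) * |x k e| * _ ≤ q⁻¹ * |x k e| * (2 ^ l * (q⁻¹ ^ (l + 1) * δ * C)) := by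
          gcongr; linarith
      _ = _ := by ring
  have hP2 : |∑ T ∈ s.powerset with ¬ T.card = 1, bitMoment q (1 + T.card) * (∏ j ∈ T, x j e) *
      bitExp q (fun g => ∏ j ∈ s \ T, linForm q (Function.update (x j) e 0) g)| ≤
      2 ^ l * q⁻¹ ^ (l + 1) * C * δ * ∑ j ∈ s, |x j e| := by
    refine (Finset.abs_sum_le_sum_abs _ _).trans ?_
    have hterm : ∀ T ∈ s.powerset.filter (fun T => ¬ T.card = 1),
        |bitMoment q (1 + T.card) * (∏ j ∈ T, x j e) *
        bitExp q (fun g => ∏ j ∈ s \ T, linForm q (Function.update (x j) e 0) g)| ≤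
        q⁻¹ ^ (l + 1) * (δ * ∑ j ∈ s, |x j e|) * C := by
      intro T hT
      rw [Finset.mem_filter, Finset.mem_powerset] at hT
      rcases Nat.eq_zero_or_pos T.card with hz | hz
      · rw [hz, add_zero, hm1]; simp; positivity
      · exact abs_expansion_term_le h0 h1 hS0 hC x hS hT.1 hs e (by norm_num)
          (abs_prod_le_mul_sum (y := fun j => x j e) hδ1 (fun j => hx j e) hT.1
            (by have := hT.2; omega))
    refine (Finset.sum_le_card_nsmul _ _ _ hterm).trans ?_
    rw [nsmul_eq_mul]
    have hcard : ((s.powerset.filter (fun T => ¬ T.card = 1)).card : ℝ) ≤ 2 ^ l := by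
      have h2 : (s.powerset.filter (fun T => ¬ T.card = 1)).card ≤ s.powerset.card :=
        Finset.card_le_card (Finset.filter_subset _ _)
      rw [Finset.card_powerset] at h2
      exact_mod_cast h2.trans (Nat.pow_le_pow_right (by norm_num) hs)
    calc _ ≤ 2 ^ l * (q⁻¹ ^ (l + 1) * (δ * ∑ j ∈ s, |x j e|) * C) := by gcongr
      _ = _ := by ring
  linarith

/-- Approximate Stein recursion for the mixed moments of linear forms with small coefficients. -/
theorem exists_abs_moment_insert_sub_le (h0 : 0 < q) (h1 : q < 1) (l : ℕ) {S : ℝ} (hS0 : 0 ≤ S) :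
    ∃ C, 0 ≤ C ∧ ∀ {ι : Type} [Fintype ι] [DecidableEq ι] {J : Type} [DecidableEq J] {δ : ℝ},
      0 ≤ δ → δ ≤ 1 → ∀ (x : J → ι → ℝ), (∀ j, ∑ e, x j e ^ 2 ≤ S) → (∀ j e, |x j e| ≤ δ) →
      ∀ (V : J → J → ℝ), (∀ j k, |(q⁻¹ - 1) * ∑ e, x j e * x k e - V j k| ≤ δ) →
      ∀ (i : J) (s : Finset J), i ∉ s → s.card ≤ l →
      |bitExp q (fun g => ∏ j ∈ insert i s, linForm q (x j) g) -
        ∑ k ∈ s, V i k * bitExp q (fun g => ∏ j ∈ s.erase k, linForm q (x j) g)| ≤ C * δ := by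
  set C := 1 + l * (hyperConst q⁻¹ l * S) ^ (l + 2) with hC
  set C1 := 2 ^ l * q⁻¹ ^ (l + 1) * C + q⁻¹ * (2 ^ l * (q⁻¹ ^ (l + 1) * C)) with hC1
  have hD := hyperConst_nonneg q⁻¹ l
  have hC0 : 0 ≤ C := by rw [hC]; positivity
  have hC10 : 0 ≤ C1 := by rw [hC1]; positivity
  -- The first summand comes from integrating by parts in every bit of the form `x i`, the second
  -- from replacing its exact covariances by `V`.
  refine ⟨C1 * (l * S) + l * C, by positivity, ?_⟩
  intro ι _ _ J _ δ hδ0 hδ1 x hS hx V hV i s hi hs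
  have hls : (s.card : ℝ) ≤ l := by exact_mod_cast hs
  have e1 : bitExp q (fun g => ∏ j ∈ insert i s, linForm q (x j) g) =
      ∑ e, x i e * bitExp q (fun g => bit q (g e) * ∏ j ∈ s, linForm q (x j) g) := by
    simp only [← bitExp_const_mul, ← bitExp_sum]
    congr 1; ext g
    rw [Finset.prod_insert hi, linForm, Finset.sum_mul]
    exact Finset.sum_congr rfl fun e _ => by ring
  have e2 : ∑ k ∈ s, ((q⁻¹ - 1) * ∑ e, x i e * x k e) *
      bitExp q (fun g => ∏ j ∈ s.erase k, linForm q (x j) g) =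
      ∑ e, x i e * ∑ k ∈ s, (q⁻¹ - 1) * x k e *
        bitExp q (fun g => ∏ j ∈ s.erase k, linForm q (x j) g) := by
    simp only [Finset.mul_sum, Finset.sum_mul]
    rw [Finset.sum_comm]
    exact Finset.sum_congr rfl fun e _ => Finset.sum_congr rfl fun k _ => by ring
  have b1 : |bitExp q (fun g => ∏ j ∈ insert i s, linForm q (x j) g) -
      ∑ k ∈ s, ((q⁻¹ - 1) * ∑ e, x i e * x k e) *
      bitExp q (fun g => ∏ j ∈ s.erase k, linForm q (x j) g)| ≤ C1 * (l * S) * δ := by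
    rw [e1, e2, ← Finset.sum_sub_distrib]
    refine (Finset.abs_sum_le_sum_abs _ _).trans ?_
    calc _ ≤ ∑ e, |x i e| * (C1 * δ * ∑ j ∈ s, |x j e|) := by
          refine Finset.sum_le_sum fun e _ => ?_
          rw [← mul_sub, abs_mul]
          exact mul_le_mul_of_nonneg_left
            (abs_bitExp_bit_mul_prod_sub_le h0 h1 hS0 hC hδ0 hδ1 x hS hx hs e) (abs_nonneg _)
      _ = C1 * δ * ∑ j ∈ s, ∑ e, |x i e| * |x j e| := by
          rw [Finset.sum_comm, Finset.mul_sum]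
          refine Finset.sum_congr rfl fun e _ => ?_
          rw [Finset.mul_sum, Finset.mul_sum, Finset.mul_sum]
          exact Finset.sum_congr rfl fun j _ => by ring
      _ ≤ C1 * δ * ∑ j ∈ s, S := by
          gcongr with j _
          exact sum_abs_mul_abs_le (hS i) (hS j)
      _ = C1 * δ * (s.card * S) := by simp
      _ ≤ C1 * δ * (l * S) := by gcongr
      _ = _ := by ring
  have b2 : |∑ k ∈ s, ((q⁻¹ - 1) * ∑ e, x i e * x k e) *
      bitExp q (fun g => ∏ j ∈ s.erase k, linForm q (x j) g) -
      ∑ k ∈ s, V i k * bitExp q (fun g => ∏ j ∈ s.erase k, linForm q (x j) g)| ≤ l * C * δ := by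
    rw [← Finset.sum_sub_distrib]
    refine (Finset.abs_sum_le_sum_abs _ _).trans ?_
    calc _ ≤ ∑ k ∈ s, δ * C := by
          refine Finset.sum_le_sum fun k _ => ?_
          rw [← sub_mul, abs_mul]
          exact mul_le_mul (hV i k) (abs_bitExp_prod_linForm_le h0 h1 hS0 x hS _
            ((Finset.card_le_card (Finset.erase_subset _ _)).trans hs)) (abs_nonneg _) hδ0
      _ = s.card * (δ * C) := by simp
      _ ≤ l * (δ * C) := by gcongr
      _ = _ := by ring
  have := abs_sub_le (bitExp q (fun g => ∏ j ∈ insert i s, linForm q (x j) g)) _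
    (∑ k ∈ s, V i k * bitExp q (fun g => ∏ j ∈ s.erase k, linForm q (x j) g)) |>.trans
    (add_le_add b1 b2)
  linarith

end

/-! ### Pairings and Wick's formula for linear forms -/

/-- The sets of pairs that partition `s`. -/
def pairings {J : Type} [DecidableEq J] (s : Finset J) : Finset (Finset (Finset J)) :=
  open Classical in
  s.powerset.powerset.filter fun P => (∀ t ∈ P, t.card = 2) ∧ ∀ x ∈ s, ∃! t, t ∈ P ∧ x ∈ t

lemma mem_pairings {J : Type} [DecidableEq J] {s : Finset J} {P : Finset (Finset J)} :
    P ∈ pairings s ↔ (∀ t ∈ P, t ⊆ s ∧ t.card = 2) ∧ ∀ x ∈ s, ∃! t, t ∈ P ∧ x ∈ t := by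
  simp only [pairings, Finset.mem_filter, Finset.mem_powerset, Finset.subset_iff (s₁ := P)]
  constructor
  · rintro ⟨h1, h2, h3⟩; exact ⟨fun t ht => ⟨h1 ht, h2 t ht⟩, h3⟩
  · rintro ⟨h1, h3⟩; exact ⟨fun t ht => (h1 t ht).1, fun t ht => (h1 t ht).2, h3⟩

/-- The sum over the pairings of `s` of the products of the weights of the pairs. -/
def pairSum {J : Type} [DecidableEq J] (φ : Finset J → ℝ) (s : Finset J) : ℝ :=
  ∑ P ∈ pairings s, ∏ t ∈ P, φ t

section
variable {J : Type} [DecidableEq J]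

lemma pairSum_empty (φ : Finset J → ℝ) : pairSum φ ∅ = 1 := by
  have : pairings (∅ : Finset J) = {∅} := by
    ext P
    rw [mem_pairings, Finset.mem_singleton]
    constructor
    · rintro ⟨h, -⟩
      by_contra hne
      obtain ⟨t, ht⟩ := Finset.nonempty_iff_ne_empty.2 hne
      obtain ⟨h1, h2⟩ := h t ht
      rw [Finset.subset_empty.1 h1] at h2
      simp at h2
    · rintro rfl; simp
  simp [pairSum, this]

/-- Recursion for the sum over pairings: choose the partner of one element. -/
lemma pairSum_insert (φ : Finset J → ℝ) {i : J} {s : Finset J} (hi : i ∉ s) :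
    pairSum φ (insert i s) = ∑ k ∈ s, φ {i, k} * pairSum φ (s.erase k) := by
  have hnot : ∀ k, ∀ P ∈ pairings (s.erase k), ({i, k} : Finset J) ∉ P := fun k P hP h => by
    have := ((mem_pairings.1 hP).1 _ h).1 (Finset.mem_insert_self i {k})
    exact hi (Finset.mem_of_mem_erase this)
  simp only [pairSum, Finset.mul_sum]
  rw [Finset.sum_sigma']
  symm
  refine Finset.sum_bij (fun x _ => insert {i, x.1} x.2) ?_ ?_ ?_ ?_
  · rintro ⟨k, P⟩ hx
    rw [Finset.mem_sigma] at hx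
    obtain ⟨hk, hP⟩ := hx
    have hki : i ≠ k := fun h => hi (h ▸ hk)
    obtain ⟨h1, h2⟩ := mem_pairings.1 hP
    rw [mem_pairings]
    refine ⟨fun t ht => ?_, fun x hx => ?_⟩
    · rcases Finset.mem_insert.1 ht with rfl | ht
      · refine ⟨?_, Finset.card_pair hki⟩
        intro y hy
        rcases Finset.mem_insert.1 hy with rfl | hy
        · simp
        · rw [Finset.mem_singleton] at hy; subst hy; exact Finset.mem_insert_of_mem hk
      · exact ⟨(h1 t ht).1.trans ((Finset.erase_subset _ _).trans (Finset.subset_insert _ _)),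
          (h1 t ht).2⟩
    · by_cases hxk : x = i ∨ x = k
      · refine ⟨{i, k}, ⟨Finset.mem_insert_self _ _, by simpa using hxk⟩, ?_⟩
        rintro t ⟨ht, hxt⟩
        rcases Finset.mem_insert.1 ht with rfl | ht
        · rfl
        · have := (h1 t ht).1 hxt
          rcases hxk with rfl | rfl
          · exact absurd (Finset.mem_of_mem_erase this) hi
          · simp at this
      · push Not at hxk
        have hxs : x ∈ s.erase k :=
          Finset.mem_erase.2 ⟨hxk.2, (Finset.mem_insert.1 hx).resolve_left hxk.1⟩
        obtain ⟨t, ⟨ht, hxt⟩, huniq⟩ := h2 x hxs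
        refine ⟨t, ⟨Finset.mem_insert_of_mem ht, hxt⟩, ?_⟩
        rintro t' ⟨ht', hxt'⟩
        rcases Finset.mem_insert.1 ht' with rfl | ht'
        · simp [hxk.1, hxk.2] at hxt'
        · exact huniq t' ⟨ht', hxt'⟩
  · rintro ⟨k, P⟩ hx ⟨k', P'⟩ hx' heq
    rw [Finset.mem_sigma] at hx hx'
    obtain ⟨hk, hP⟩ := hx
    obtain ⟨hk', hP'⟩ := hx'
    simp only at heq hk hk' hP hP'
    have hkk : k = k' := by
      have h : ({i, k} : Finset J) ∈ insert {i, k'} P' := heq ▸ Finset.mem_insert_self _ _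
      rcases Finset.mem_insert.1 h with h | h
      · have hkm : k ∈ ({i, k'} : Finset J) := h ▸ (by simp)
        rcases Finset.mem_insert.1 hkm with rfl | h
        · exact absurd hk hi
        · simpa using h
      · have := ((mem_pairings.1 hP').1 _ h).1 (Finset.mem_insert_self i {k})
        exact absurd (Finset.mem_of_mem_erase this) hi
    subst hkk
    have : P = P' := by
      rw [← Finset.erase_insert (hnot k P hP), heq, Finset.erase_insert (hnot k P' hP')]
    subst this; rfl
  · intro P hP
    obtain ⟨h1, h2⟩ := mem_pairings.1 hP
    obtain ⟨t, ⟨ht, hit⟩, huniq⟩ := h2 i (Finset.mem_insert_self _ _)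
    obtain ⟨hts, htc⟩ := h1 t ht
    obtain ⟨k, hk⟩ : ∃ k, t.erase i = {k} := by
      rw [← Finset.card_eq_one, Finset.card_erase_of_mem hit, htc]
    have htk : t = {i, k} := by rw [← Finset.insert_erase hit, hk]
    have hkt : k ∈ t.erase i := by rw [hk]; simp
    have hki : k ≠ i := (Finset.mem_erase.1 hkt).1
    have hks : k ∈ s := (Finset.mem_insert.1 (hts (Finset.mem_of_mem_erase hkt))).resolve_left hki
    refine ⟨⟨k, P.erase t⟩, ?_, by rw [← htk]; exact Finset.insert_erase ht⟩
    rw [Finset.mem_sigma, mem_pairings]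
    refine ⟨hks, fun t' ht' => ?_, fun x hx => ?_⟩
    · rw [Finset.mem_erase] at ht'
      refine ⟨fun y hy => ?_, (h1 t' ht'.2).2⟩
      have hyi : y ≠ i := by
        rintro rfl; exact ht'.1 (huniq t' ⟨ht'.2, hy⟩)
      have hyk : y ≠ k := by
        rintro rfl
        exact ht'.1 ((h2 y (Finset.mem_insert_of_mem hks)).unique ⟨ht'.2, hy⟩
          ⟨ht, Finset.mem_of_mem_erase hkt⟩)
      exact Finset.mem_erase.2 ⟨hyk, (Finset.mem_insert.1 ((h1 t' ht'.2).1 hy)).resolve_left hyi⟩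
    · rw [Finset.mem_erase] at hx
      obtain ⟨t', ⟨ht', hxt'⟩, hu⟩ := h2 x (Finset.mem_insert_of_mem hx.2)
      refine ⟨t', ⟨Finset.mem_erase.2 ⟨?_, ht'⟩, hxt'⟩, ?_⟩
      · rintro rfl
        rw [htk] at hxt'
        rcases Finset.mem_insert.1 hxt' with rfl | h
        · exact hi hx.2
        · exact hx.1 (by simpa using h)
      · rintro t'' ⟨ht'', hxt''⟩
        exact hu t'' ⟨Finset.mem_of_mem_erase ht'', hxt''⟩
  · rintro ⟨k, P⟩ hx
    rw [Finset.mem_sigma] at hx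
    rw [Finset.prod_insert (hnot k P hx.2)]

end

/-- The product of `V j j'` over the pairs `j < j'` of elements of `t`. -/
def pairWeight {l : ℕ} (V : Fin l → Fin l → ℝ) (t : Finset (Fin l)) : ℝ :=
  ∏ q ∈ (t ×ˢ t).filter (fun q => q.1 < q.2), V q.1 q.2

lemma pairWeight_pair {l : ℕ} {V : Fin l → Fin l → ℝ} (hV : ∀ i j, V i j = V j i) {i k : Fin l}
    (hik : i ≠ k) : pairWeight V {i, k} = V i k := by
  rcases lt_or_gt_of_ne hik with h | h
  · have : (({i, k} : Finset (Fin l)) ×ˢ {i, k}).filter (fun q => q.1 < q.2) = {(i, k)} := by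
      ext ⟨x, y⟩
      simp only [Finset.mem_filter, Finset.mem_product, Finset.mem_insert, Finset.mem_singleton,
        Prod.mk.injEq]
      constructor
      · rintro ⟨⟨rfl | rfl, rfl | rfl⟩, h'⟩ <;> simp_all [lt_asymm h]
      · rintro ⟨rfl, rfl⟩; simp [h]
    simp [pairWeight, this]
  · have : (({i, k} : Finset (Fin l)) ×ˢ {i, k}).filter (fun q => q.1 < q.2) = {(k, i)} := by
      ext ⟨x, y⟩
      simp only [Finset.mem_filter, Finset.mem_product, Finset.mem_insert, Finset.mem_singleton,
        Prod.mk.injEq]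
      constructor
      · rintro ⟨⟨rfl | rfl, rfl | rfl⟩, h'⟩ <;> simp_all [lt_asymm h]
      · rintro ⟨rfl, rfl⟩; simp [h]
    simp [pairWeight, this, hV k i]

/-- Plain sets of pairs, unlike partitions of the full index set, allow the ground set to shrink
along the recursion. -/
lemma wickSum_eq_pairSum {n m : ℕ} {p : ℝ} {l : ℕ} (i : Fin l → Fin n) :
    wickSum m p i = pairSum (pairWeight fun j k => covar m p (i j) (i k)) Finset.univ := by
  unfold wickSum pairSum
  refine Finset.sum_bij (fun P _ => P.parts) ?_ ?_ ?_ ?_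
  · intro P hP
    rw [pairPartitions, Finset.mem_filter] at hP
    rw [mem_pairings]
    exact ⟨fun t ht => ⟨Finset.subset_univ _, hP.2 t ht⟩, fun x hx => P.existsUnique_mem hx⟩
  · intro P _ P' _ h
    exact Finpartition.ext h
  · intro P hP
    obtain ⟨h1, h2⟩ := mem_pairings.1 hP
    refine ⟨Finpartition.ofExistsUnique P (fun t ht => (h1 t ht).1) h2 (fun h => ?_), ?_, rfl⟩
    · have := (h1 _ h).2
      simp at this
    · rw [pairPartitions, Finset.mem_filter]
      exact ⟨Finset.mem_univ _, fun t ht => (h1 t ht).2⟩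
  · intro P _
    rfl

/-- Wick's formula up to a small error, for linear forms in independent bits with small
coefficients. -/
theorem exists_abs_moment_sub_pairSum_le {q : ℝ} (h0 : 0 < q) (h1 : q < 1) (l : ℕ) {S : ℝ}
    (hS0 : 0 ≤ S) :
    ∃ C, 0 ≤ C ∧ ∀ {ι : Type} [Fintype ι] [DecidableEq ι] {δ : ℝ},
      0 ≤ δ → δ ≤ 1 → ∀ (x : Fin l → ι → ℝ), (∀ j, ∑ e, x j e ^ 2 ≤ S) →
      (∀ j e, |x j e| ≤ δ) → ∀ (V : Fin l → Fin l → ℝ), (∀ j k, V j k = V k j) →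
      (∀ j k, |(q⁻¹ - 1) * ∑ e, x j e * x k e - V j k| ≤ δ) →
      |bitExp q (fun g => ∏ j, linForm q (x j) g) - pairSum (pairWeight V) Finset.univ| ≤ C * δ := by
  obtain ⟨C, hC0, hC⟩ := exists_abs_moment_insert_sub_le h0 h1 l hS0
  have hq : 1 ≤ q⁻¹ := (one_le_inv₀ h0).2 h1.le
  -- The recursion removes two indices at a time, so the induction runs over all subsets with at
  -- most `N` elements, with a constant that may depend on `N`.
  suffices h : ∀ N : ℕ, ∃ C', 0 ≤ C' ∧ ∀ {ι : Type} [Fintype ι] [DecidableEq ι] {δ : ℝ},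
      0 ≤ δ → δ ≤ 1 → ∀ (x : Fin l → ι → ℝ), (∀ j, ∑ e, x j e ^ 2 ≤ S) →
      (∀ j e, |x j e| ≤ δ) → ∀ (V : Fin l → Fin l → ℝ), (∀ j k, V j k = V k j) →
      (∀ j k, |(q⁻¹ - 1) * ∑ e, x j e * x k e - V j k| ≤ δ) →
      ∀ s : Finset (Fin l), s.card ≤ N →
      |bitExp q (fun g => ∏ j ∈ s, linForm q (x j) g) - pairSum (pairWeight V) s| ≤ C' * δ by
    obtain ⟨C', hC'0, hC'⟩ := h l
    exact ⟨C', hC'0, fun hδ0 hδ1 x hS hx V hV hVx =>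
      hC' hδ0 hδ1 x hS hx V hV hVx Finset.univ (by simp)⟩
  intro N
  induction N with
  | zero =>
    refine ⟨0, le_rfl, fun hδ0 hδ1 x hS hx V hV hVx s hs => ?_⟩
    have : s = ∅ := Finset.card_eq_zero.1 (by omega)
    subst this
    simp [bitExp_const, pairSum_empty]
  | succ N ih =>
    obtain ⟨C', hC'0, hC'⟩ := ih
    -- `C` is the error of one recursion step; `q⁻¹ * S + 1` bounds the entries of `V`, which
    -- multiply the errors of the shorter moments.
    refine ⟨C + l * ((q⁻¹ * S + 1) * C'), by positivity,
      fun {ι} _ _ {δ} hδ0 hδ1 x hS hx V hV hVx s hs => ?_⟩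
    rcases s.eq_empty_or_nonempty with rfl | ⟨i, hi⟩
    · have : 0 ≤ (C + l * ((q⁻¹ * S + 1) * C')) * δ := by positivity
      simpa [bitExp_const, pairSum_empty] using this
    · obtain ⟨s', hs', rfl⟩ : ∃ s', i ∉ s' ∧ insert i s' = s :=
        ⟨s.erase i, by simp, Finset.insert_erase hi⟩
      rw [Finset.card_insert_of_notMem hs'] at hs
      have hl : s'.card ≤ l := by simpa using s'.card_le_univ
      have b1 := hC hδ0 hδ1 x hS hx V hVx i s' hs' hl
      rw [pairSum_insert _ hs']
      have hVb : ∀ k, |V i k| ≤ q⁻¹ * S + 1 := by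
        intro k
        have h2 : |(q⁻¹ - 1) * ∑ e, x i e * x k e| ≤ q⁻¹ * S := by
          rw [abs_mul, abs_of_nonneg (by linarith : 0 ≤ q⁻¹ - 1)]
          have h3 : |∑ e, x i e * x k e| ≤ S := by
            refine (Finset.abs_sum_le_sum_abs _ _).trans ?_
            simp only [abs_mul]
            exact sum_abs_mul_abs_le (hS i) (hS k)
          exact mul_le_mul (by linarith) h3 (abs_nonneg _) (by linarith)
        have h4 := hVx i k
        rw [abs_le] at h2 h4 ⊢
        constructor <;> linarith [h2.1, h2.2, h4.1, h4.2]
      have b2 : |∑ k ∈ s', V i k * bitExp q (fun g => ∏ j ∈ s'.erase k, linForm q (x j) g) -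
          ∑ k ∈ s', pairWeight V {i, k} * pairSum (pairWeight V) (s'.erase k)| ≤
          l * ((q⁻¹ * S + 1) * C') * δ := by
        rw [← Finset.sum_sub_distrib]
        refine (Finset.abs_sum_le_sum_abs _ _).trans ?_
        calc _ ≤ ∑ k ∈ s', (q⁻¹ * S + 1) * (C' * δ) := by
              refine Finset.sum_le_sum fun k hk => ?_
              have hik : i ≠ k := fun h => hs' (h ▸ hk)
              rw [pairWeight_pair hV hik, ← mul_sub, abs_mul]
              refine mul_le_mul (hVb k) (hC' hδ0 hδ1 x hS hx V hV hVx _ ?_) (abs_nonneg _)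
                (by positivity)
              exact (Finset.card_le_card (Finset.erase_subset _ _)).trans (by omega)
          _ = s'.card * ((q⁻¹ * S + 1) * (C' * δ)) := by simp
          _ ≤ l * ((q⁻¹ * S + 1) * (C' * δ)) := by
              have : (s'.card : ℝ) ≤ l := by exact_mod_cast hl
              gcongr
          _ = _ := by ring
      exact (abs_sub_le _ _ _).trans ((add_le_add b1 b2).trans (le_of_eq (by ring)))

/-! ### Uniformly random permutations -/

/-- Averaging over the images of the points outside `A`. -/
lemma expect_perm_mul_apply {α : Type*} [Fintype α] [DecidableEq α] {A : Finset α} {u : α}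
    (hu : u ∉ A) (f : Equiv.Perm α → ℝ) (hf : ∀ ρ, ∀ x ∉ A, f (ρ * Equiv.swap u x) = f ρ)
    (φ : α → ℝ) :
    𝔼 ρ : Equiv.Perm α, f ρ * φ (ρ u) =
      𝔼 ρ : Equiv.Perm α, f ρ * ((∑ x ∈ Aᶜ, φ (ρ x)) / (Aᶜ.card : ℝ)) := by
  have hne : (Aᶜ.card : ℝ) ≠ 0 := by
    have : 0 < Aᶜ.card := Finset.card_pos.2 ⟨u, by simpa using hu⟩
    exact_mod_cast this.ne'
  -- Right multiplication by `swap u x` preserves both the uniform law and `f`, and exchanges the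
  -- value at `u` with the value at `x`.
  have h : ∀ x ∈ Aᶜ, 𝔼 ρ : Equiv.Perm α, f ρ * φ (ρ u) = 𝔼 ρ : Equiv.Perm α, f ρ * φ (ρ x) := by
    intro x hx
    refine (Fintype.expect_equiv (Equiv.mulRight (Equiv.swap u x)) _ _ fun ρ => ?_).symm
    simp only [Equiv.coe_mulRight]
    rw [hf ρ x (by simpa using hx)]
    simp
  have h2 : ∑ x ∈ Aᶜ, 𝔼 ρ : Equiv.Perm α, f ρ * φ (ρ x) =
      Aᶜ.card * 𝔼 ρ : Equiv.Perm α, f ρ * φ (ρ u) := by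
    rw [← Finset.sum_congr rfl h]; simp
  have h3 : 𝔼 ρ : Equiv.Perm α, f ρ * ((∑ x ∈ Aᶜ, φ (ρ x)) / (Aᶜ.card : ℝ)) =
      (∑ x ∈ Aᶜ, 𝔼 ρ : Equiv.Perm α, f ρ * φ (ρ x)) / (Aᶜ.card : ℝ) := by
    rw [← Finset.expect_sum_comm, Finset.expect_div]
    refine Finset.expect_congr rfl fun ρ _ => ?_
    rw [← mul_div_assoc, Finset.mul_sum]
  rw [h3, h2]; field_simp

lemma expect_perm_apply_eq {α : Type*} [Fintype α] [DecidableEq α] (u v : α) :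
    𝔼 ρ : Equiv.Perm α, (if ρ u = v then (1 : ℝ) else 0) = 1 / Fintype.card α := by
  have h := expect_perm_mul_apply (A := ∅) (u := u) (by simp) (fun _ => (1 : ℝ)) (by simp)
    (fun x => if x = v then (1 : ℝ) else 0)
  simp only [one_mul, Finset.compl_empty, Finset.card_univ] at h
  rw [h]
  have : ∀ ρ : Equiv.Perm α, ∑ x, (if ρ x = v then (1 : ℝ) else 0) = 1 := fun ρ => by
    rw [Equiv.sum_comp ρ (fun x => if x = v then (1 : ℝ) else 0)]; simp
  simp only [this]
  exact Fintype.expect_const _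

lemma expect_perm_apply_eq_and_le {α : Type*} [Fintype α] [DecidableEq α] {u u' : α} (hu : u ≠ u')
    (v v' : α) :
    𝔼 ρ : Equiv.Perm α, (if ρ u = v ∧ ρ u' = v' then (1 : ℝ) else 0) ≤
      1 / ((Fintype.card α : ℝ) * ((Fintype.card α : ℝ) - 1)) := by
  have h := expect_perm_mul_apply (A := {u}) (u := u') (by simpa using hu.symm)
    (fun ρ => if ρ u = v then (1 : ℝ) else 0) (fun ρ x hx => by
      rw [Equiv.Perm.mul_apply, Equiv.swap_apply_of_ne_of_ne hu]
      exact fun h => hx (by simp [h]))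
    (fun x => if x = v' then (1 : ℝ) else 0)
  have hc : ((({u} : Finset α)ᶜ).card : ℝ) = (Fintype.card α : ℝ) - 1 := by
    rw [Finset.card_compl, Finset.card_singleton, Nat.cast_sub, Nat.cast_one]
    exact Fintype.card_pos_iff.2 ⟨u⟩
  rw [hc] at h
  have hc1 : (0 : ℝ) ≤ (Fintype.card α : ℝ) - 1 := by rw [← hc]; positivity
  have e : ∀ ρ : Equiv.Perm α, (if ρ u = v ∧ ρ u' = v' then (1 : ℝ) else 0) =
      (if ρ u = v then (1 : ℝ) else 0) * (if ρ u' = v' then (1 : ℝ) else 0) := fun ρ => by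
    split_ifs <;> simp_all
  simp only [e]
  rw [h]
  calc _ ≤ 𝔼 ρ : Equiv.Perm α, (if ρ u = v then (1 : ℝ) else 0) *
        (1 / ((Fintype.card α : ℝ) - 1)) := by
        refine Finset.expect_le_expect fun ρ _ => ?_
        refine mul_le_mul_of_nonneg_left ?_ (by split_ifs <;> simp)
        refine div_le_div_of_nonneg_right ?_ hc1
        calc ∑ x ∈ ({u} : Finset α)ᶜ, (if ρ x = v' then (1 : ℝ) else 0) ≤
            ∑ x, (if ρ x = v' then (1 : ℝ) else 0) :=
              Finset.sum_le_univ_sum_of_nonneg fun x => by split_ifs <;> simp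
          _ = 1 := by rw [Equiv.sum_comp ρ (fun x => if x = v' then (1 : ℝ) else 0)]; simp
    _ = _ := by
        rw [← Finset.expect_mul, expect_perm_apply_eq, one_div_mul_one_div]

/-- Exponential moment of the number of edges of `F` of the form `(u, ρ u)` with `u ∈ A`, for a
uniformly random permutation `ρ`. -/
lemma expect_perm_prod_le {α : Type*} [Fintype α] [DecidableEq α] {F : Finset (α × α)} {d : ℕ}
    (hF : ∀ u, (F.filter fun e => e.1 = u).card ≤ d) {b t : ℝ} (hb : 0 ≤ b)
    {N : ℕ} (hN : N < Fintype.card α) (ht : b * d ≤ t * ((Fintype.card α : ℝ) - N))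
    (A : Finset α) (hA : A.card ≤ N) :
    𝔼 ρ : Equiv.Perm α, ∏ u ∈ A, (1 + if (u, ρ u) ∈ F then b else 0) ≤ (1 + t) ^ A.card := by
  have hN' : (0 : ℝ) < (Fintype.card α : ℝ) - N := by
    rw [sub_pos]; exact_mod_cast hN
  have ht0 : 0 ≤ t := by
    by_contra hneg
    push Not at hneg
    have : t * ((Fintype.card α : ℝ) - N) < 0 := mul_neg_of_neg_of_pos hneg hN'
    have : 0 ≤ b * d := by positivity
    linarith
  induction A using Finset.induction_on with
  | empty => simp
  | insert u A hu ih =>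
    have hA' : A.card ≤ N := (Finset.card_le_card (Finset.subset_insert u A)).trans hA
    have hpos : ∀ ρ : Equiv.Perm α, 0 ≤ ∏ u ∈ A, (1 + if (u, ρ u) ∈ F then b else 0) := fun ρ =>
      Finset.prod_nonneg fun _ _ => by split_ifs <;> linarith
    -- The permutation is revealed one row at a time: given its values on `A`, the new value is
    -- uniform on at least `card α - N` points, of which at most `d` give an edge of `F`.
    have h := expect_perm_mul_apply hu
      (fun ρ => ∏ w ∈ A, (1 + if (w, ρ w) ∈ F then b else 0)) (fun ρ x hx =>
        Finset.prod_congr rfl fun w hw => by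
          rw [Equiv.Perm.mul_apply, Equiv.swap_apply_of_ne_of_ne (ne_of_mem_of_not_mem hw hu)
            (ne_of_mem_of_not_mem hw hx)])
      (fun x => 1 + if (u, x) ∈ F then b else 0)
    have e : ∀ ρ : Equiv.Perm α, ∏ w ∈ insert u A, (1 + if (w, ρ w) ∈ F then b else 0) =
        (∏ w ∈ A, (1 + if (w, ρ w) ∈ F then b else 0)) * (1 + if (u, ρ u) ∈ F then b else 0) :=
      fun ρ => by rw [Finset.prod_insert hu, mul_comm]
    simp only [e]
    rw [h, Finset.card_insert_of_notMem hu, pow_succ]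
    have hcard : (Fintype.card α : ℝ) - N ≤ (Aᶜ.card : ℝ) := by
      rw [Finset.card_compl, Nat.cast_sub (Finset.card_le_univ _)]
      have : (A.card : ℝ) ≤ N := by exact_mod_cast hA'
      linarith
    have hcpos : (0 : ℝ) < Aᶜ.card := hN'.trans_le hcard
    calc _ ≤ 𝔼 ρ : Equiv.Perm α, (∏ w ∈ A, (1 + if (w, ρ w) ∈ F then b else 0)) * (1 + t) := by
          refine Finset.expect_le_expect fun ρ _ => mul_le_mul_of_nonneg_left ?_ (hpos ρ)
          rw [div_le_iff₀ hcpos, Finset.sum_add_distrib, Finset.sum_const, nsmul_eq_mul, mul_one,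
            add_mul, one_mul]
          gcongr
          have h1 : ∑ x ∈ Aᶜ, (if (u, ρ x) ∈ F then b else 0) ≤
              ∑ x, (if (u, ρ x) ∈ F then b else 0) :=
            Finset.sum_le_univ_sum_of_nonneg fun x => by split_ifs <;> linarith
          have h2 : ∑ x, (if (u, ρ x) ∈ F then b else 0) =
              (Finset.univ.filter fun x => (u, x) ∈ F).card * b := by
            rw [Equiv.sum_comp ρ (fun x => if (u, x) ∈ F then b else 0), ← Finset.sum_filter]
            simp
          have h3 : (Finset.univ.filter fun x => (u, x) ∈ F).card ≤ d := by
            refine le_trans (Finset.card_le_card_of_injOn (fun x => (u, x)) ?_ ?_) (hF u)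
            · intro x hx; simpa using hx
            · intro x _ y _ hxy; simpa using hxy
          have h4 : ((Finset.univ.filter fun x => (u, x) ∈ F).card : ℝ) ≤ d := by exact_mod_cast h3
          have h5 : t * ((Fintype.card α : ℝ) - N) ≤ t * Aᶜ.card :=
            mul_le_mul_of_nonneg_left hcard ht0
          nlinarith [mul_le_mul_of_nonneg_right h4 hb]
      _ = (𝔼 ρ : Equiv.Perm α, ∏ w ∈ A, (1 + if (w, ρ w) ∈ F then b else 0)) * (1 + t) := by
          rw [Finset.expect_mul]
      _ ≤ _ := mul_le_mul_of_nonneg_right (ih hA') (by linarith)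

/-- The truncated exponential series. -/
def expSum (b : ℝ) (m : ℕ) : ℝ := ∑ k ∈ Finset.range (m + 1), b ^ k / (k.factorial : ℝ)

/-- Exponential moment of the number of fixed points of a random permutation. -/
lemma expect_perm_prod_fixed {α : Type*} [Fintype α] [DecidableEq α] (b : ℝ) :
    𝔼 π : Equiv.Perm α, ∏ u, (1 + if π u = u then b else 0) = expSum b (Fintype.card α) := by
  have h1 : ∀ π : Equiv.Perm α, ∏ u, (1 + if π u = u then b else 0) =
      ∑ S : Finset α, b ^ S.card * (if ∀ u ∈ S, π u = u then (1 : ℝ) else 0) := by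
    intro π
    rw [Finset.prod_one_add, Finset.powerset_univ]
    refine Finset.sum_congr rfl fun S _ => ?_
    rw [Finset.prod_ite_zero]
    split_ifs <;> simp
  -- Permutations fixing `S` pointwise are permutations of its complement. Multiplied by the number
  -- of sets of size `k`, this probability becomes `1 / k!`, whence the exponential series.
  have h2 : ∀ S : Finset α, 𝔼 π : Equiv.Perm α, (if ∀ u ∈ S, π u = u then (1 : ℝ) else 0) =
      ((Fintype.card α - S.card).factorial : ℝ) / ((Fintype.card α).factorial : ℝ) := by
    intro S
    rw [Fintype.expect_eq_sum_div_card, Fintype.card_perm, Finset.sum_boole]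
    congr 2
    rw [← Fintype.card_subtype]
    have := Fintype.card_congr (Equiv.Perm.subtypeEquivSubtypePerm (fun a => a ∉ S))
    simp only [not_not] at this
    rw [← this, Fintype.card_perm]
    simp
  simp only [h1]
  rw [Finset.expect_sum_comm]
  simp only [← Finset.mul_expect, h2]
  rw [← Finset.powerset_univ, Finset.sum_powerset_apply_card
    (fun k => b ^ k * (((Fintype.card α - k).factorial : ℝ) / ((Fintype.card α).factorial : ℝ)))]
  rw [expSum, Finset.card_univ]
  refine Finset.sum_congr rfl fun k hk => ?_
  have hk' : k ≤ Fintype.card α := by simpa [Nat.lt_succ_iff] using hk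
  have := Nat.choose_mul_factorial_mul_factorial hk'
  have hq : ((Fintype.card α).choose k : ℝ) * k.factorial * (Fintype.card α - k).factorial =
      (Fintype.card α).factorial := by exact_mod_cast this
  have hpos : ((Fintype.card α).factorial : ℝ) ≠ 0 := by positivity
  have hpos2 : (k.factorial : ℝ) ≠ 0 := by positivity
  rw [nsmul_eq_mul]
  field_simp
  rw [← hq]; ring

lemma expSum_nonneg {b : ℝ} (hb : 0 ≤ b) (m : ℕ) : 0 ≤ expSum b m :=
  Finset.sum_nonneg fun _ _ => by positivity

lemma expSum_le_exp {b : ℝ} (hb : 0 ≤ b) (m : ℕ) : expSum b m ≤ Real.exp b :=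
  Real.sum_le_exp_of_nonneg hb _

lemma tendsto_expSum (b : ℝ) :
    Filter.Tendsto (expSum b) Filter.atTop (nhds (Real.exp b)) := by
  have h := (NormedSpace.expSeries_div_hasSum_exp (𝔸 := ℝ) b).tendsto_sum_nat
  rw [← Real.exp_eq_exp_ℝ] at h
  exact h.comp (Filter.tendsto_add_atTop_nat 1)

/-! ### Random configurations: a row set and two matchings -/

section
variable {n : ℕ}

/-- The edges of the matching induced on `A` by a permutation. -/
def edges (A : Finset (Fin n)) (σ : Equiv.Perm (Fin n)) : Finset (Fin n × Fin n) :=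
  A.image fun u => (u, σ u)

lemma mem_edges {A : Finset (Fin n)} {σ : Equiv.Perm (Fin n)} {e : Fin n × Fin n} :
    e ∈ edges A σ ↔ e.1 ∈ A ∧ σ e.1 = e.2 := by
  rw [edges, Finset.mem_image]
  constructor
  · rintro ⟨u, hu, rfl⟩; exact ⟨hu, rfl⟩
  · rintro ⟨h1, h2⟩; exact ⟨e.1, h1, by rw [h2]⟩

lemma prod_edges (A : Finset (Fin n)) (σ : Equiv.Perm (Fin n)) (f : Fin n × Fin n → ℝ) :
    ∏ e ∈ edges A σ, f e = ∏ u ∈ A, f (u, σ u) :=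
  Finset.prod_image fun _ _ _ _ h => (Prod.mk.inj h).1

/-- In product form over the rows, exponential moments of an intersection size fall under the bounds
for random permutations. -/
lemma pow_card_edges_inter (A : Finset (Fin n)) (σ : Equiv.Perm (Fin n))
    (F : Finset (Fin n × Fin n)) (β : ℝ) :
    β ^ (edges A σ ∩ F).card = ∏ u ∈ A, (1 + if (u, σ u) ∈ F then β - 1 else 0) := by
  rw [← prod_edges A σ (fun e => 1 + if e ∈ F then β - 1 else 0), ← Finset.filter_mem_eq_inter]
  have : ∀ e, (1 + if e ∈ F then β - 1 else 0) = if e ∈ F then β else 1 := fun e => by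
    split_ifs <;> ring
  simp only [this]
  rw [Finset.prod_ite]; simp

lemma card_edges_filter_fst_le (A : Finset (Fin n)) (σ : Equiv.Perm (Fin n)) (u : Fin n) :
    ((edges A σ).filter fun e => e.1 = u).card ≤ 1 := by
  rw [Finset.card_le_one]
  intro e he e' he'
  simp only [Finset.mem_filter, mem_edges] at he he'
  exact Prod.ext (he.2.trans he'.2.symm) (by rw [← he.1.2, ← he'.1.2, he.2, he'.2])

lemma card_edges_filter_snd_le (A : Finset (Fin n)) (σ : Equiv.Perm (Fin n)) (v : Fin n) :
    ((edges A σ).filter fun e => e.2 = v).card ≤ 1 := by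
  rw [Finset.card_le_one]
  intro e he e' he'
  simp only [Finset.mem_filter, mem_edges] at he he'
  have h2 := he.2.trans he'.2.symm
  exact Prod.ext (σ.injective (by rw [he.1.2, he'.1.2, h2])) h2

lemma card_edges_filter_mem_le (A B : Finset (Fin n)) (σ : Equiv.Perm (Fin n)) :
    ((edges A σ).filter fun e => e.1 ∈ B).card ≤ (A ∩ B).card := by
  refine Finset.card_le_card_of_injOn Prod.fst ?_ ?_
  · intro e he
    simp only [Finset.coe_filter, Set.mem_ofPred_eq, mem_edges] at he
    simpa using ⟨he.1.1, he.2⟩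
  · intro e he e' he' h
    simp only [Finset.coe_filter, Set.mem_ofPred_eq, mem_edges] at he he'
    exact Prod.ext h (by rw [← he.1.2, ← he'.1.2, h])

/-- A set of rows together with two permutations. -/
abbrev Config (n : ℕ) : Type := Finset (Fin n) × Equiv.Perm (Fin n) × Equiv.Perm (Fin n)

/-- The edges of the first matching of a configuration. -/
def edgesL (c : Config n) : Finset (Fin n × Fin n) := edges c.1 c.2.1

/-- The edges of the second matching of a configuration. -/
def edgesR (c : Config n) : Finset (Fin n × Fin n) := edges c.1 c.2.2

/-- The average over two uniformly random permutations with the same image of `A`. -/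
def avPerm (A : Finset (Fin n)) (F : Equiv.Perm (Fin n) → Equiv.Perm (Fin n) → ℝ) : ℝ :=
  𝔼 ρ : Equiv.Perm (Fin n), 𝔼 π : Equiv.Perm A, F ρ (ρ * Equiv.Perm.ofSubtype π)

/-- The sets of size `m` that contain `i`. -/
def rootedSets (m : ℕ) (i : Fin n) : Finset (Finset (Fin n)) :=
  (Finset.powersetCard m (Finset.univ : Finset (Fin n))).filter (fun A => i ∈ A)

/-- The average over random configurations whose set of rows has size `m` and contains `i`. -/
def av (m : ℕ) (i : Fin n) (F : Config n → ℝ) : ℝ :=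
  𝔼 A ∈ rootedSets m i, avPerm A fun σ τ => F (A, σ, τ)

lemma mem_rootedSets {m : ℕ} {i : Fin n} {A : Finset (Fin n)} :
    A ∈ rootedSets m i ↔ A.card = m ∧ i ∈ A := by
  simp [rootedSets, Finset.mem_powersetCard]

lemma avPerm_const (A : Finset (Fin n)) (x : ℝ) : avPerm A (fun _ _ => x) = x := by
  simp only [avPerm, Fintype.expect_const]

lemma avPerm_mono {A : Finset (Fin n)} {F G : Equiv.Perm (Fin n) → Equiv.Perm (Fin n) → ℝ}
    (h : ∀ σ τ, F σ τ ≤ G σ τ) : avPerm A F ≤ avPerm A G :=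
  Finset.expect_le_expect fun _ _ => Finset.expect_le_expect fun _ _ => h _ _

lemma avPerm_const_mul (A : Finset (Fin n)) (x : ℝ)
    (F : Equiv.Perm (Fin n) → Equiv.Perm (Fin n) → ℝ) :
    avPerm A (fun σ τ => x * F σ τ) = x * avPerm A F := by
  simp only [avPerm, Finset.mul_expect]

lemma avPerm_add (A : Finset (Fin n)) (F G : Equiv.Perm (Fin n) → Equiv.Perm (Fin n) → ℝ) :
    avPerm A (fun σ τ => F σ τ + G σ τ) = avPerm A F + avPerm A G := by
  simp only [avPerm, Finset.expect_add_distrib]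

lemma avPerm_sum (A : Finset (Fin n)) {κ : Type*} (s : Finset κ)
    (F : κ → Equiv.Perm (Fin n) → Equiv.Perm (Fin n) → ℝ) :
    avPerm A (fun σ τ => ∑ k ∈ s, F k σ τ) = ∑ k ∈ s, avPerm A (F k) := by
  simp only [avPerm, Finset.expect_sum_comm]

/-- The substitution of `(ρ * π, π⁻¹)` for `(ρ, π)` preserves the uniform law and exchanges the two
matchings. -/
lemma avPerm_swap (A : Finset (Fin n)) (F : Equiv.Perm (Fin n) → Equiv.Perm (Fin n) → ℝ) :
    avPerm A (fun σ τ => F τ σ) = avPerm A F := by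
  unfold avPerm
  rw [Finset.expect_comm]
  conv_rhs => rw [Finset.expect_comm]
  refine Fintype.expect_equiv (Equiv.inv _) _ _ fun π => ?_
  refine Fintype.expect_equiv (Equiv.mulRight (Equiv.Perm.ofSubtype π)) _ _ fun ρ => ?_
  simp [mul_assoc]

variable {m : ℕ} {i : Fin n}

lemma av_add (F G : Config n → ℝ) : av m i (fun c => F c + G c) = av m i F + av m i G := by
  simp only [av, avPerm_add, Finset.expect_add_distrib]

lemma av_const_mul (x : ℝ) (F : Config n → ℝ) : av m i (fun c => x * F c) = x * av m i F := by
  simp only [av, avPerm_const_mul, Finset.mul_expect]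

lemma av_mul_const (x : ℝ) (F : Config n → ℝ) : av m i (fun c => F c * x) = av m i F * x := by
  simp only [mul_comm _ x, av_const_mul]

lemma av_sub (F G : Config n → ℝ) : av m i (fun c => F c - G c) = av m i F - av m i G := by
  have h := av_add (m := m) (i := i) F (fun c => (-1) * G c)
  rw [av_const_mul] at h
  simp only [neg_one_mul, ← sub_eq_add_neg] at h
  exact h

lemma av_sum {κ : Type*} (s : Finset κ) (F : κ → Config n → ℝ) :
    av m i (fun c => ∑ k ∈ s, F k c) = ∑ k ∈ s, av m i (F k) := by
  simp only [av, avPerm_sum, Finset.expect_sum_comm]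

lemma av_mono {F G : Config n → ℝ} (h : ∀ c, c.1.card = m → i ∈ c.1 → F c ≤ G c) :
    av m i F ≤ av m i G := by
  refine Finset.expect_le_expect fun A hA => avPerm_mono fun σ τ => ?_
  rw [mem_rootedSets] at hA
  exact h _ hA.1 hA.2

lemma abs_av_le (F : Config n → ℝ) : |av m i F| ≤ av m i (fun c => |F c|) := by
  rw [abs_le]
  constructor
  · have h := av_mono (m := m) (i := i) (F := fun c => (-1) * |F c|) (G := F)
      fun c _ _ => by linarith [neg_abs_le (F c)]
    rw [av_const_mul] at h; linarith
  · exact av_mono fun c _ _ => le_abs_self _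

lemma av_swap (F : Config n → ℝ) : av m i (fun c => F (c.1, c.2.2, c.2.1)) = av m i F :=
  Finset.expect_congr rfl fun A _ => avPerm_swap A fun σ τ => F (A, σ, τ)

lemma card_filter_subset_powersetCard {S : Finset (Fin n)} (hS : S.card ≤ m) :
    ((Finset.powersetCard m (Finset.univ : Finset (Fin n))).filter (S ⊆ ·)).card =
      (n - S.card).choose (m - S.card) := by
  rw [Finset.card_filter_powersetCard_subset]
  all_goals simp_all

lemma card_rootedSets (hm : 1 ≤ m) (i : Fin n) :
    (rootedSets m i).card = (n - 1).choose (m - 1) := by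
  have := card_filter_subset_powersetCard (n := n) (m := m) (S := {i}) (by simpa using hm)
  simpa [rootedSets] using this

lemma rootedSets_nonempty (hm : 1 ≤ m) (hmn : m ≤ n) (i : Fin n) : (rootedSets m i).Nonempty := by
  rw [← Finset.card_pos, card_rootedSets hm]
  exact Nat.choose_pos (by omega)

lemma av_const (hm : 1 ≤ m) (hmn : m ≤ n) (x : ℝ) : av m i (fun _ => x) = x := by
  simp only [av, avPerm_const]
  exact Finset.expect_const (rootedSets_nonempty hm hmn i) x

/-- The probability that a random row set containing `i` contains `r`. -/
def rowProb (m : ℕ) (i r : Fin n) : ℝ := 𝔼 A ∈ rootedSets m i, if r ∈ A then (1 : ℝ) else 0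

lemma rowProb_self (hm : 1 ≤ m) (hmn : m ≤ n) : rowProb m i i = 1 := by
  rw [rowProb, Finset.expect_congr rfl (g := fun _ => (1 : ℝ)) fun A hA => by
    rw [if_pos (mem_rootedSets.1 hA).2]]
  exact Finset.expect_const (rootedSets_nonempty hm hmn i) 1

lemma expect_rootedSets_boole (hm : 1 ≤ m) (S : Finset (Fin n)) (hS : (insert i S).card ≤ m) :
    𝔼 A ∈ rootedSets m i, (if S ⊆ A then (1 : ℝ) else 0) =
      ((n - (insert i S).card).choose (m - (insert i S).card) : ℝ) /
        ((n - 1).choose (m - 1) : ℝ) := by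
  rw [Finset.expect_eq_sum_div_card, card_rootedSets hm, Finset.sum_boole,
    ← card_filter_subset_powersetCard hS]
  congr 3
  rw [rootedSets, Finset.filter_filter]
  simp only [Finset.insert_subset_iff]

lemma choose_pred_mul (a b : ℕ) (ha : 1 ≤ a) (hb : 1 ≤ b) :
    (a : ℝ) * ((a - 1).choose (b - 1) : ℝ) = (a.choose b : ℝ) * b := by
  obtain ⟨a, rfl⟩ := Nat.exists_eq_add_of_le' ha
  obtain ⟨b, rfl⟩ := Nat.exists_eq_add_of_le' hb
  have := Nat.add_one_mul_choose_eq a b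
  simp only [Nat.add_sub_cancel]
  exact_mod_cast this

lemma rowProb_of_ne (hm : 2 ≤ m) (hmn : m ≤ n) {r : Fin n} (hr : r ≠ i) :
    rowProb m i r = ((m : ℝ) - 1) / ((n : ℝ) - 1) := by
  have h := expect_rootedSets_boole (i := i) (by omega : 1 ≤ m) {r}
    (by rw [Finset.card_pair hr.symm]; exact hm)
  simp only [Finset.singleton_subset_iff] at h
  rw [rowProb, h, Finset.card_pair hr.symm]
  have h1 := choose_pred_mul (n - 1) (m - 1) (by omega) (by omega)
  have hpos : (0 : ℝ) < ((n - 1).choose (m - 1) : ℝ) := by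
    exact_mod_cast Nat.choose_pos (by omega)
  rw [Nat.cast_sub (by omega), Nat.cast_sub (by omega), Nat.cast_one] at h1
  have hn1 : (n : ℝ) - 1 ≠ 0 := by
    have : (2 : ℝ) ≤ n := by exact_mod_cast hm.trans hmn
    intro h; linarith
  rw [div_eq_div_iff hpos.ne' hn1, mul_comm _ ((n : ℝ) - 1), mul_comm _ (((n - 1).choose (m - 1) : ℕ) : ℝ)]
  exact h1

lemma expect_rootedSets_pair (hm : 3 ≤ m) (hmn : m ≤ n) {r r' : Fin n} (hr : r ≠ i) (hr' : r' ≠ i)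
    (hrr : r ≠ r') :
    𝔼 A ∈ rootedSets m i, (if r ∈ A ∧ r' ∈ A then (1 : ℝ) else 0) =
      (((m : ℝ) - 1) / ((n : ℝ) - 1)) * (((m : ℝ) - 2) / ((n : ℝ) - 2)) := by
  have hc : (insert i ({r, r'} : Finset (Fin n))).card = 3 := by
    rw [Finset.card_insert_of_notMem (by simp [hr.symm, hr'.symm]), Finset.card_pair hrr]
  have h := expect_rootedSets_boole (i := i) (by omega : 1 ≤ m) {r, r'} (by rw [hc]; exact hm)
  simp only [Finset.insert_subset_iff, Finset.singleton_subset_iff] at h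
  rw [h, hc]
  have h1 := choose_pred_mul (n - 1) (m - 1) (by omega) (by omega)
  have h2 := choose_pred_mul (n - 2) (m - 2) (by omega) (by omega)
  have hpos : (0 : ℝ) < ((n - 1).choose (m - 1) : ℝ) := by
    exact_mod_cast Nat.choose_pos (by omega)
  rw [Nat.cast_sub (by omega), Nat.cast_sub (by omega), Nat.cast_one] at h1
  rw [Nat.cast_sub (by omega), Nat.cast_sub (by omega)] at h2
  simp only [Nat.sub_sub, Nat.reduceAdd, Nat.cast_ofNat] at h1 h2
  have hn3 : (3 : ℝ) ≤ n := by exact_mod_cast hm.trans hmn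
  have hn1 : (n : ℝ) - 1 ≠ 0 := by intro h; linarith
  have hn2 : (n : ℝ) - 2 ≠ 0 := by intro h; linarith
  field_simp
  linear_combination ((n : ℝ) - 1) * h2 + ((m : ℝ) - 2) * h1

/-- Second moment of the intersection of a random row set with a fixed set. -/
lemma expect_card_inter_sq_le (hm : 3 ≤ m) (hmn : m ≤ n) (F : Finset (Fin n)) :
    𝔼 A ∈ rootedSets m i, ((F ∩ A).card : ℝ) ^ 2 ≤
      2 + 2 * (F.card * (m / n) + (F.card * (m / n)) ^ 2) := by
  have hn3 : (3 : ℝ) ≤ n := by exact_mod_cast hm.trans hmn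
  have hm3 : (3 : ℝ) ≤ m := by exact_mod_cast hm
  have hmn' : (m : ℝ) ≤ n := by exact_mod_cast hmn
  have hμ1 : ((m : ℝ) - 1) / ((n : ℝ) - 1) ≤ m / n := by
    rw [div_le_div_iff₀ (by linarith) (by linarith)]; nlinarith
  have hμ2 : ((m : ℝ) - 2) / ((n : ℝ) - 2) ≤ m / n := by
    rw [div_le_div_iff₀ (by linarith) (by linarith)]; nlinarith
  -- The root `i` always belongs to the random row set. Removing it changes the intersection by at
  -- most one and leaves only rows with small inclusion probabilities.
  set F' := F.erase i with hF'
  have hF'c : (F'.card : ℝ) ≤ F.card := by exact_mod_cast Finset.card_le_card (Finset.erase_subset _ _)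
  have hcount : ∀ A : Finset (Fin n), ((F' ∩ A).card : ℝ) = ∑ r ∈ F', if r ∈ A then (1 : ℝ) else 0 := by
    intro A; rw [Finset.sum_boole, Finset.filter_mem_eq_inter]
  have hsq : ∀ A : Finset (Fin n), ((F' ∩ A).card : ℝ) ^ 2 =
      ∑ r ∈ F', ∑ r' ∈ F', if r ∈ A ∧ r' ∈ A then (1 : ℝ) else 0 := by
    intro A
    rw [hcount, sq, Finset.sum_mul_sum]
    refine Finset.sum_congr rfl fun r _ => Finset.sum_congr rfl fun r' _ => ?_
    split_ifs <;> simp_all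
  have hmain : 𝔼 A ∈ rootedSets m i, ((F' ∩ A).card : ℝ) ^ 2 ≤
      F.card * (m / n) + (F.card * (m / n)) ^ 2 := by
    simp only [hsq]
    rw [Finset.expect_sum_comm]
    simp only [Finset.expect_sum_comm]
    have hterm : ∀ r ∈ F', ∀ r' ∈ F',
        𝔼 A ∈ rootedSets m i, (if r ∈ A ∧ r' ∈ A then (1 : ℝ) else 0) ≤
          (if r = r' then (m : ℝ) / n else 0) + (m / n) ^ 2 := by
      intro r hr r' hr'
      have hri := (Finset.mem_erase.1 hr).1
      have hri' := (Finset.mem_erase.1 hr').1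
      by_cases h : r = r'
      · subst h
        rw [if_pos rfl]
        have h2 := rowProb_of_ne (by omega : 2 ≤ m) hmn hri
        simp only [and_self]
        rw [rowProb] at h2
        rw [h2]
        have : 0 ≤ ((m : ℝ) / n) ^ 2 := by positivity
        linarith
      · rw [if_neg h, zero_add, expect_rootedSets_pair hm hmn hri hri' h, sq]
        exact mul_le_mul hμ1 hμ2 (div_nonneg (by linarith) (by linarith)) (by positivity)
    refine (Finset.sum_le_sum fun r hr => Finset.sum_le_sum fun r' hr' => hterm r hr r' hr').trans ?_
    have : ∑ r ∈ F', ∑ r' ∈ F', ((if r = r' then (m : ℝ) / n else 0) + (m / n) ^ 2) =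
        F'.card * (m / n) + (F'.card * (m / n)) ^ 2 := by
      simp only [Finset.sum_add_distrib, Finset.sum_ite_eq, Finset.sum_const, nsmul_eq_mul]
      rw [Finset.sum_ite_mem, Finset.inter_self, Finset.sum_const, nsmul_eq_mul]
      ring
    rw [this]
    gcongr
  have hpt : ∀ A ∈ rootedSets m i, ((F ∩ A).card : ℝ) ^ 2 ≤ 2 + 2 * ((F' ∩ A).card : ℝ) ^ 2 := by
    intro A _
    have h1 : (F ∩ A).card ≤ 1 + (F' ∩ A).card := by
      have : F ∩ A ⊆ insert i (F' ∩ A) := by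
        intro x hx
        rw [Finset.mem_inter] at hx
        by_cases h : x = i
        · simp [h]
        · simp [hF', h, hx.1, hx.2]
      exact (Finset.card_le_card this).trans ((Finset.card_insert_le _ _).trans (by omega))
    have h2 : ((F ∩ A).card : ℝ) ≤ 1 + (F' ∩ A).card := by exact_mod_cast h1
    have h3 : (0 : ℝ) ≤ (F ∩ A).card := by positivity
    nlinarith [sq_nonneg (((F' ∩ A).card : ℝ) - 1)]
  refine (Finset.expect_le_expect hpt).trans ?_
  rw [Finset.expect_add_distrib, ← Finset.mul_expect,
    Finset.expect_const (rootedSets_nonempty (by omega) hmn i)]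
  linarith

/-- Exponential moment of the number of common edges with a graph of bounded row degrees. -/
lemma av_pow_card_edgesL_inter_le (hm : 1 ≤ m) (hmn : m < n) {F : Finset (Fin n × Fin n)} {d : ℕ}
    (hF : ∀ u, (F.filter fun e => e.1 = u).card ≤ d) {β t : ℝ} (hβ : 1 ≤ β)
    (ht : (β - 1) * d ≤ t * ((n : ℝ) - m)) :
    av m i (fun c => β ^ (edgesL c ∩ F).card) ≤ (1 + t) ^ m := by
  refine Finset.expect_le (rootedSets_nonempty hm hmn.le i) fun A hA => ?_
  have hAc := (mem_rootedSets.1 hA).1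
  simp only [avPerm, edgesL, Fintype.expect_const, pow_card_edges_inter]
  have := expect_perm_prod_le hF (sub_nonneg.2 hβ) (N := m) (by simpa using hmn)
    (by simpa using ht) A hAc.le
  rwa [hAc] at this

lemma av_pow_card_edgesR_inter_le (hm : 1 ≤ m) (hmn : m < n) {F : Finset (Fin n × Fin n)} {d : ℕ}
    (hF : ∀ u, (F.filter fun e => e.1 = u).card ≤ d) {β t : ℝ} (hβ : 1 ≤ β)
    (ht : (β - 1) * d ≤ t * ((n : ℝ) - m)) :
    av m i (fun c => β ^ (edgesR c ∩ F).card) ≤ (1 + t) ^ m := by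
  have h := av_swap (m := m) (i := i) (fun c => β ^ (edgesL c ∩ F).card)
  exact h.trans_le (av_pow_card_edgesL_inter_le hm hmn hF hβ ht)

/-- Given the first matching, the overlap of the two matchings is the number of fixed points of a
random permutation. -/
lemma expect_pow_card_overlap (A : Finset (Fin n)) (ρ : Equiv.Perm (Fin n)) (β : ℝ) :
    𝔼 π : Equiv.Perm A, β ^ (edges A ρ ∩ edges A (ρ * Equiv.Perm.ofSubtype π)).card =
      expSum (β - 1) A.card := by
  have h : ∀ π : Equiv.Perm A, β ^ (edges A ρ ∩ edges A (ρ * Equiv.Perm.ofSubtype π)).card =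
      ∏ u : A, (1 + if π u = u then β - 1 else 0) := by
    intro π
    rw [pow_card_edges_inter, ← Finset.prod_coe_sort]
    refine Finset.prod_congr rfl fun u _ => ?_
    congr 1
    refine if_congr ?_ rfl rfl
    rw [mem_edges]
    simp only [Finset.coe_mem, true_and, Equiv.Perm.mul_apply, EmbeddingLike.apply_eq_iff_eq]
    rw [Equiv.Perm.ofSubtype_apply_coe, Subtype.coe_inj]
  simp only [h]
  rw [expect_perm_prod_fixed, Fintype.card_coe]

lemma av_pow_card_overlap (hm : 1 ≤ m) (hmn : m ≤ n) (β : ℝ) :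
    av m i (fun c => β ^ (edgesL c ∩ edgesR c).card) = expSum (β - 1) m := by
  rw [av, Finset.expect_congr rfl (g := fun _ => expSum (β - 1) m) fun A hA => ?_]
  · exact Finset.expect_const (rootedSets_nonempty hm hmn i) _
  · simp only [avPerm, edgesL, edgesR, expect_pow_card_overlap, (mem_rootedSets.1 hA).1]
    exact Fintype.expect_const _

/-- Given the first matching, the exponential moment of the overlap is a constant, so it factors
out. What is left is the probability that the first matching contains `e`: the row is selected, then
its image is uniform. -/
lemma av_pow_card_overlap_mul_mem (e : Fin n × Fin n) (β : ℝ) :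
    av m i (fun c => β ^ (edgesL c ∩ edgesR c).card * if e ∈ edgesL c then 1 else 0) =
      expSum (β - 1) m * (rowProb m i e.1 / n) := by
  have h : ∀ A ∈ rootedSets m i, avPerm A (fun σ τ => β ^ (edges A σ ∩ edges A τ).card *
      if e ∈ edges A σ then 1 else 0) =
      (if e.1 ∈ A then (1 : ℝ) else 0) * (expSum (β - 1) m * (1 / n)) := by
    intro A hA
    simp only [avPerm, ← Finset.expect_mul, expect_pow_card_overlap, (mem_rootedSets.1 hA).1]
    rw [← Finset.mul_expect]
    by_cases hr : e.1 ∈ A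
    · simp only [mem_edges, hr, true_and, if_true, one_mul]
      rw [expect_perm_apply_eq, Fintype.card_fin]
    · simp [mem_edges, hr]
  refine (Finset.expect_congr rfl h).trans ?_
  rw [← Finset.expect_mul, ← rowProb]
  ring

/-- The joint probability of two edges in the same matching, given the rows. -/
lemma avPerm_mem_edges_and_le (A : Finset (Fin n)) {e f : Fin n × Fin n} (hef : e ≠ f) :
    avPerm A (fun σ _ => if e ∈ edges A σ ∧ f ∈ edges A σ then (1 : ℝ) else 0) ≤
      (if f.1 ∈ A ∧ e.1 ∈ A then (1 : ℝ) else 0) * (1 / ((n : ℝ) * ((n : ℝ) - 1))) := by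
  simp only [avPerm, Fintype.expect_const]
  by_cases hA : f.1 ∈ A ∧ e.1 ∈ A
  · simp only [mem_edges, hA, true_and, and_self, if_true, one_mul]
    by_cases hr : e.1 = f.1
    · have h2 : ∀ ρ : Equiv.Perm (Fin n), ¬ (ρ e.1 = e.2 ∧ ρ f.1 = f.2) := fun ρ h =>
        hef (Prod.ext hr (by rw [← h.1, ← h.2, hr]))
      rw [hr] at h2
      simp only [hr, h2, if_false, Finset.expect_const_zero]
      have hn : (1 : ℝ) ≤ n := by
        have := e.1.pos
        exact_mod_cast this
      exact div_nonneg zero_le_one (mul_nonneg (by linarith) (by linarith))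
    · have := expect_perm_apply_eq_and_le hr e.2 f.2
      simpa using this
  · have h2 : ∀ ρ : Equiv.Perm (Fin n), ¬ (e ∈ edges A ρ ∧ f ∈ edges A ρ) := fun ρ h =>
      hA ⟨(mem_edges.1 h.2).1, (mem_edges.1 h.1).1⟩
    simp [h2, hA]

/-- The joint probability of an edge in the first and one in the second matching, given the
rows. -/
lemma avPerm_mem_edges_mem_edges_le (A : Finset (Fin n)) (e f : Fin n × Fin n) :
    avPerm A (fun σ τ => if e ∈ edges A σ ∧ f ∈ edges A τ then (1 : ℝ) else 0) ≤
      (if f.1 ∈ A ∧ e.1 ∈ A then (1 : ℝ) else 0) * (1 / ((n : ℝ) * ((n : ℝ) - 1)) +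
        (if e.2 = f.2 then 1 / ((n : ℝ) * A.card) else 0)) := by
  have hn : (1 : ℝ) ≤ n := by
    have := e.1.pos
    exact_mod_cast this
  by_cases hA : f.1 ∈ A ∧ e.1 ∈ A
  · simp only [avPerm, mem_edges, hA, true_and, if_true, one_mul]
    rw [Finset.expect_comm]
    -- If `π` maps `f.1` to `e.1`, both conditions prescribe the same value of `ρ`, which forces a
    -- common column; this has probability `1 / A.card` in `π`. Otherwise the values at two distinct
    -- points are prescribed.
    have key : ∀ π : Equiv.Perm A, 𝔼 ρ : Equiv.Perm (Fin n),
        (if ρ e.1 = e.2 ∧ (ρ * Equiv.Perm.ofSubtype π) f.1 = f.2 then (1 : ℝ) else 0) ≤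
        1 / ((n : ℝ) * ((n : ℝ) - 1)) +
          (if π ⟨f.1, hA.1⟩ = ⟨e.1, hA.2⟩ then (1 : ℝ) else 0) *
            (if e.2 = f.2 then 1 / (n : ℝ) else 0) := by
      intro π
      have hpos : 0 ≤ 1 / ((n : ℝ) * ((n : ℝ) - 1)) :=
        div_nonneg zero_le_one (mul_nonneg (by linarith) (by linarith))
      simp only [Equiv.Perm.mul_apply, Equiv.Perm.ofSubtype_apply_of_mem π hA.1]
      by_cases hπ : π ⟨f.1, hA.1⟩ = ⟨e.1, hA.2⟩
      · rw [if_pos hπ, hπ, one_mul]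
        by_cases hc : e.2 = f.2
        · simp only [← hc, and_self, if_true]
          rw [expect_perm_apply_eq, Fintype.card_fin]
          linarith
        · have : ∀ ρ : Equiv.Perm (Fin n), ¬ (ρ e.1 = e.2 ∧ ρ e.1 = f.2) := fun ρ h =>
            hc (h.1.symm.trans h.2)
          simp only [this, hc, if_false, Finset.expect_const_zero, add_zero]
          exact hpos
      · rw [if_neg hπ, zero_mul, add_zero]
        have hne : e.1 ≠ (π ⟨f.1, hA.1⟩ : Fin n) := fun h => hπ (Subtype.ext h.symm)
        have := expect_perm_apply_eq_and_le hne e.2 f.2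
        simpa using this
    refine (Finset.expect_le_expect fun π _ => key π).trans ?_
    rw [Finset.expect_add_distrib, Fintype.expect_const, ← Finset.expect_mul, expect_perm_apply_eq,
      Fintype.card_coe]
    refine le_of_eq ?_
    congr 1
    split_ifs
    · rw [one_div_mul_one_div, mul_comm]
    · ring
  · have h2 : ∀ σ τ : Equiv.Perm (Fin n), ¬ (e ∈ edges A σ ∧ f ∈ edges A τ) := fun σ τ h =>
      hA ⟨(mem_edges.1 h.2).1, (mem_edges.1 h.1).1⟩
    simp [h2, hA, avPerm]

end

/-! ### The remainder is negligible -/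

/-- The sizes `m` and `K` are of order `√n`, where `n = s ^ 4`. -/
structure SquareRootScale (κ : ℝ) (n m K : ℕ) (s : ℝ) : Prop where
  one_le_s : 1 ≤ s
  s_pow : s ^ 4 = n
  one_le_κ : 1 ≤ κ
  m_le : (m : ℝ) ≤ κ * s ^ 2
  K_le : (K : ℝ) ≤ κ * s ^ 2
  le_m : s ^ 2 ≤ κ * m
  three_le_m : 3 ≤ m
  two_mul_m_le : 2 * m ≤ n

section
variable {n m K : ℕ} {i : Fin n}

/-- The union of the two matchings of a configuration. -/
def edgesUnion (c : Config n) : Finset (Fin n × Fin n) := edgesL c ∪ edgesR c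

/-- The common edges of the two matchings of a configuration. -/
def overlap (c : Config n) : Finset (Fin n × Fin n) := edgesL c ∩ edgesR c

/-- The number of common edges of the two matchings plus the number of edges in `P`. -/
def excess (P : Finset (Fin n × Fin n)) (c : Config n) : ℕ :=
  (overlap c).card + (edgesUnion c ∩ P).card

/-- The contribution of a configuration to the coefficient of the monomial `T` in the weight. -/
def coefTerm (a : ℝ) (P T : Finset (Fin n × Fin n)) (c : Config n) : ℝ :=
  (1 + a) ^ excess P c * if T ⊆ edgesUnion c \ P then 1 else 0

/-- The main part of the contribution of a configuration to the linear coefficients. -/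
def linTerm (a : ℝ) (P T : Finset (Fin n × Fin n)) (c : Config n) : ℝ :=
  if T.card = 1 ∧ Disjoint T P then
    (1 + a) ^ (overlap c).card *
      ((if T ⊆ edgesL c then 1 else 0) + if T ⊆ edgesR c then 1 else 0) else 0

/-- What the main linear part leaves of the contribution of a configuration. -/
def remTerm (a : ℝ) (P T : Finset (Fin n × Fin n)) (c : Config n) : ℝ :=
  if T = ∅ then 0 else coefTerm a P T c - linTerm a P T c

/-- The pairs of edges which make a configuration contribute to the remainder. -/
def pairCount (e f : Fin n × Fin n) (c : Config n) : ℝ :=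
  (if e ≠ f ∧ e ∈ edgesL c ∧ f ∈ edgesL c then 1 else 0) +
  (if e ≠ f ∧ e ∈ edgesR c ∧ f ∈ edgesR c then 1 else 0) +
  (if e ∈ edgesL c ∧ f ∈ edgesR c then 1 else 0) +
  (if f ∈ edgesL c ∧ e ∈ edgesR c then 1 else 0)

lemma pairCount_nonneg (e f : Fin n × Fin n) (c : Config n) : 0 ≤ pairCount e f c := by
  unfold pairCount
  have h : ∀ (q : Prop) [Decidable q], (0 : ℝ) ≤ if q then 1 else 0 := fun q _ => by
    split_ifs <;> norm_num
  exact add_nonneg (add_nonneg (add_nonneg (h _) (h _)) (h _)) (h _)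

lemma one_le_pairCount_of_ne {e f : Fin n × Fin n} {c : Config n} (hef : e ≠ f)
    (he : e ∈ edgesUnion c) (hf : f ∈ edgesUnion c) : 1 ≤ pairCount e f c := by
  unfold pairCount
  have h : ∀ (q : Prop) [Decidable q], (0 : ℝ) ≤ if q then 1 else 0 := fun q _ => by
    split_ifs <;> norm_num
  have a1 := h (e ≠ f ∧ e ∈ edgesL c ∧ f ∈ edgesL c)
  have a2 := h (e ≠ f ∧ e ∈ edgesR c ∧ f ∈ edgesR c)
  have a3 := h (e ∈ edgesL c ∧ f ∈ edgesR c)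
  have a4 := h (f ∈ edgesL c ∧ e ∈ edgesR c)
  rcases Finset.mem_union.1 he with he | he <;> rcases Finset.mem_union.1 hf with hf | hf
  · rw [if_pos ⟨hef, he, hf⟩] at a1 ⊢; linarith
  · rw [if_pos (⟨he, hf⟩ : e ∈ edgesL c ∧ f ∈ edgesR c)] at a3 ⊢; linarith
  · rw [if_pos (⟨hf, he⟩ : f ∈ edgesL c ∧ e ∈ edgesR c)] at a4 ⊢; linarith
  · rw [if_pos (⟨hef, he, hf⟩ : e ≠ f ∧ e ∈ edgesR c ∧ f ∈ edgesR c)] at a2 ⊢; linarith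

lemma one_le_pairCount_self {e : Fin n × Fin n} {c : Config n} (he : e ∈ overlap c) :
    1 ≤ pairCount e e c := by
  have h := Finset.mem_inter.1 he
  simp [pairCount, h.1, h.2]

/-- The number of bad pairs of edges with respect to a second configuration. -/
def badCount (P : Finset (Fin n × Fin n)) (c' c : Config n) : ℝ :=
  ∑ f ∈ edgesUnion c', ∑ e ∈ edgesUnion c' ∪ P, pairCount e f c

lemma badCount_nonneg (P : Finset (Fin n × Fin n)) (c' c : Config n) : 0 ≤ badCount P c' c :=
  Finset.sum_nonneg fun _ _ => Finset.sum_nonneg fun _ _ => pairCount_nonneg _ _ _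

lemma one_le_badCount {P : Finset (Fin n × Fin n)} {c' c : Config n} {e f : Fin n × Fin n}
    (hf : f ∈ edgesUnion c') (he : e ∈ edgesUnion c' ∪ P) (h : 1 ≤ pairCount e f c) :
    1 ≤ badCount P c' c := by
  refine h.trans ?_
  refine (Finset.single_le_sum (f := fun e => pairCount e f c)
    (fun _ _ => pairCount_nonneg _ _ _) he).trans ?_
  exact Finset.single_le_sum (f := fun f => ∑ e ∈ edgesUnion c' ∪ P, pairCount e f c)
    (fun _ _ => Finset.sum_nonneg fun _ _ => pairCount_nonneg _ _ _) hf

/-- Suppose `T` is one edge of the configuration, in exactly one of its matchings, and the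
configuration avoids `P`. Then the excess equals the overlap and the main linear term is exact. In
every other nonzero case both terms are nonnegative and at most twice the exponential weight. -/
lemma remTerm_cases {a : ℝ} (ha : 0 ≤ a) (P T : Finset (Fin n × Fin n)) (c : Config n) :
    remTerm a P T c = 0 ∨ (T.Nonempty ∧ T ⊆ edgesUnion c ∧ Disjoint T P ∧
      (2 ≤ T.card ∨ (edgesUnion c ∩ P).Nonempty ∨ T ⊆ overlap c) ∧
      |remTerm a P T c| ≤ 2 * (1 + a) ^ excess P c) := by
  have h1a : 1 ≤ 1 + a := by linarith
  rcases T.eq_empty_or_nonempty with rfl | hT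
  · left; simp [remTerm]
  have hTne : T ≠ ∅ := hT.ne_empty
  by_cases hTP : Disjoint T P
  swap
  · left
    have : ¬ T ⊆ edgesUnion c \ P := fun h => hTP (Finset.disjoint_of_subset_left h
      Finset.sdiff_disjoint)
    simp [remTerm, coefTerm, linTerm, this, hTP]
  by_cases hTc : T ⊆ edgesUnion c
  swap
  · left
    have h1 : ¬ T ⊆ edgesUnion c \ P := fun h => hTc (h.trans Finset.sdiff_subset)
    have h2 : ¬ T ⊆ edgesL c := fun h => hTc (h.trans Finset.subset_union_left)
    have h3 : ¬ T ⊆ edgesR c := fun h => hTc (h.trans Finset.subset_union_right)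
    simp [remTerm, coefTerm, linTerm, h1, h2, h3]
  have hTd : T ⊆ edgesUnion c \ P := fun e he =>
    Finset.mem_sdiff.2 ⟨hTc he, Finset.disjoint_left.1 hTP he⟩
  have hpow : (1 + a) ^ (overlap c).card ≤ (1 + a) ^ excess P c :=
    pow_le_pow_right₀ h1a (Nat.le_add_right _ _)
  have hpow0 : 0 ≤ (1 + a) ^ (overlap c).card := by positivity
  by_cases hgood : 2 ≤ T.card ∨ (edgesUnion c ∩ P).Nonempty ∨ T ⊆ overlap c
  · right
    refine ⟨hT, hTc, hTP, hgood, ?_⟩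
    rw [remTerm, if_neg hTne, coefTerm, if_pos hTd, mul_one]
    have hl0 : 0 ≤ linTerm a P T c := by
      unfold linTerm
      split_ifs <;> simp <;> positivity
    have hl1 : linTerm a P T c ≤ 2 * (1 + a) ^ (overlap c).card := by
      unfold linTerm
      split_ifs <;> linarith
    rw [abs_le]; constructor <;> linarith
  · left
    push Not at hgood
    obtain ⟨g1, g2, g3⟩ := hgood
    have hT1 : T.card = 1 := by have := Finset.card_pos.2 hT; omega
    obtain ⟨e, rfl⟩ := Finset.card_eq_one.1 hT1
    rw [remTerm, if_neg hTne, coefTerm, if_pos hTd, linTerm, if_pos ⟨hT1, hTP⟩, excess, g2,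
      Finset.card_empty, add_zero]
    simp only [Finset.singleton_subset_iff, overlap, Finset.mem_inter, edgesUnion,
      Finset.mem_union] at g3 hTc ⊢
    by_cases hL : e ∈ edgesL c
    · have hR : e ∉ edgesR c := fun h => g3 ⟨hL, h⟩
      simp [hL, hR]
    · have hR : e ∈ edgesR c := hTc.resolve_left hL
      simp [hL, hR]

/-- The exponential weight of a pair of configurations. -/
def pairFactor (a D : ℝ) (P : Finset (Fin n × Fin n)) (c' c : Config n) : ℝ :=
  (1 + a) ^ excess P c' * (1 + a) ^ excess P c * (1 + D) ^ (edgesUnion c' ∩ edgesUnion c).card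

/-- A set `T` that contributes for both configurations forces a bad pair, so `badCount` is at least
one; summing `D ^ T.card` over the sets of common edges then gives a multiple of `pairFactor`.
Truncation decouples the two quantities: a factor `w ≤ s` is at most `s * badCount`, and a larger
one is at most `w ^ 9 / s ^ 8`. Thus only a first moment of one and a ninth moment of the other are
needed. -/
lemma sum_abs_remTerm_mul_le {a D s : ℝ} (ha : 0 ≤ a) (hD : 0 ≤ D) (hs : 0 < s)
    (P : Finset (Fin n × Fin n)) (c' c : Config n) :
    ∑ T, D ^ T.card * (|remTerm a P T c'| * |remTerm a P T c|) ≤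
      4 * (s * badCount P c' c + pairFactor a D P c' c ^ 9 / s ^ 8) := by
  have h1a : 1 ≤ 1 + a := by linarith
  have hw0 : 0 ≤ pairFactor a D P c' c := by unfold pairFactor; positivity
  have hbad0 := badCount_nonneg P c' c
  by_cases hz : ∀ T, remTerm a P T c' = 0 ∨ remTerm a P T c = 0
  · have : ∑ T, D ^ T.card * (|remTerm a P T c'| * |remTerm a P T c|) = 0 :=
      Finset.sum_eq_zero fun T _ => by rcases hz T with h | h <;> simp [h]
    rw [this]; positivity
  push Not at hz
  obtain ⟨T, hT', hT⟩ := hz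
  obtain ⟨-, hsub', -⟩ := (remTerm_cases ha P T c').resolve_left hT'
  obtain ⟨hne, hsub, hdis, hgood, -⟩ := (remTerm_cases ha P T c).resolve_left hT
  have hbad : 1 ≤ badCount P c' c := by
    rcases hgood with h2 | ⟨e, he⟩ | hov
    · obtain ⟨e, he, f, hf, hef⟩ := Finset.one_lt_card.1 h2
      exact one_le_badCount (hsub' hf) (Finset.mem_union_left _ (hsub' he))
        (one_le_pairCount_of_ne hef (hsub he) (hsub hf))
    · obtain ⟨f, hf⟩ := hne
      rw [Finset.mem_inter] at he
      have hef : e ≠ f := fun h => Finset.disjoint_left.1 hdis hf (h ▸ he.2)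
      exact one_le_badCount (hsub' hf) (Finset.mem_union_right _ he.2)
        (one_le_pairCount_of_ne hef he.1 (hsub hf))
    · obtain ⟨f, hf⟩ := hne
      exact one_le_badCount (hsub' hf) (Finset.mem_union_left _ (hsub' hf))
        (one_le_pairCount_self (hov hf))
  have hsum : ∑ T, D ^ T.card * (|remTerm a P T c'| * |remTerm a P T c|) ≤
      4 * pairFactor a D P c' c := by
    have hterm : ∀ T, D ^ T.card * (|remTerm a P T c'| * |remTerm a P T c|) ≤
        if T ∈ (edgesUnion c' ∩ edgesUnion c).powerset then
          4 * ((1 + a) ^ excess P c' * (1 + a) ^ excess P c) * D ^ T.card else 0 := by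
      intro T
      by_cases h' : remTerm a P T c' = 0
      · rw [h']; simp only [abs_zero, zero_mul, mul_zero]; split_ifs <;> positivity
      by_cases h : remTerm a P T c = 0
      · rw [h]; simp only [abs_zero, mul_zero]; split_ifs <;> positivity
      obtain ⟨-, s', -, -, b'⟩ := (remTerm_cases ha P T c').resolve_left h'
      obtain ⟨-, s1, -, -, b⟩ := (remTerm_cases ha P T c).resolve_left h
      rw [if_pos (Finset.mem_powerset.2 (Finset.subset_inter s' s1))]
      calc _ ≤ D ^ T.card * ((2 * (1 + a) ^ excess P c') * (2 * (1 + a) ^ excess P c)) := by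
            gcongr
        _ = _ := by ring
    refine (Finset.sum_le_sum fun T _ => hterm T).trans (le_of_eq ?_)
    rw [Finset.sum_ite_mem, Finset.univ_inter, ← Finset.mul_sum]
    have h2 := Finset.prod_one_add (f := fun _ : Fin n × Fin n => D)
      (edgesUnion c' ∩ edgesUnion c)
    simp only [Finset.prod_const] at h2
    rw [← h2, pairFactor]; ring
  refine hsum.trans (mul_le_mul_of_nonneg_left ?_ (by norm_num))
  set w := pairFactor a D P c' c
  rcases le_total w s with hle | hle
  · have : s * 1 ≤ s * badCount P c' c := mul_le_mul_of_nonneg_left hbad hs.le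
    have : 0 ≤ w ^ 9 / s ^ 8 := by positivity
    linarith
  · have h8 : s ^ 8 ≤ w ^ 8 := pow_le_pow_left₀ hs.le hle 8
    have : w ≤ w ^ 9 / s ^ 8 := by
      rw [le_div_iff₀ (by positivity)]
      calc w * s ^ 8 ≤ w * w ^ 8 := mul_le_mul_of_nonneg_left h8 hw0
        _ = w ^ 9 := by ring
    have : 0 ≤ s * badCount P c' c := by positivity
    linarith

lemma avPerm_pairCount_le (A : Finset (Fin n)) (e f : Fin n × Fin n) :
    avPerm A (fun σ τ => pairCount e f (A, σ, τ)) ≤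
      (if f.1 ∈ A ∧ e.1 ∈ A then (1 : ℝ) else 0) * (4 / ((n : ℝ) * ((n : ℝ) - 1)) +
        (if e.2 = f.2 then 2 / ((n : ℝ) * A.card) else 0)) := by
  have hn : (1 : ℝ) ≤ n := by
    have := e.1.pos
    exact_mod_cast this
  have hpos : 0 ≤ 1 / ((n : ℝ) * ((n : ℝ) - 1)) :=
    div_nonneg zero_le_one (mul_nonneg (by linarith) (by linarith))
  simp only [pairCount, edgesL, edgesR, avPerm_add]
  have b1 : avPerm A (fun σ _ => if e ≠ f ∧ e ∈ edges A σ ∧ f ∈ edges A σ then (1 : ℝ) else 0) ≤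
      (if f.1 ∈ A ∧ e.1 ∈ A then (1 : ℝ) else 0) * (1 / ((n : ℝ) * ((n : ℝ) - 1))) := by
    by_cases h : e = f
    · simp only [h, ne_eq, not_true, false_and, if_false, avPerm_const]
      split_ifs
      · linarith
      · linarith
    · simpa [h] using avPerm_mem_edges_and_le A h
  have b2 : avPerm A (fun _ τ => if e ≠ f ∧ e ∈ edges A τ ∧ f ∈ edges A τ then (1 : ℝ) else 0) ≤
      (if f.1 ∈ A ∧ e.1 ∈ A then (1 : ℝ) else 0) * (1 / ((n : ℝ) * ((n : ℝ) - 1))) := by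
    have := avPerm_swap A
      (fun σ _ => if e ≠ f ∧ e ∈ edges A σ ∧ f ∈ edges A σ then (1 : ℝ) else 0)
    rw [this]; exact b1
  have b3 := avPerm_mem_edges_mem_edges_le A e f
  have b4 := avPerm_mem_edges_mem_edges_le A f e
  simp only [and_comm (a := e.1 ∈ A), eq_comm (a := f.2)] at b4
  refine (add_le_add (add_le_add (add_le_add b1 b2) b3) b4).trans (le_of_eq ?_)
  split_ifs <;> ring

lemma card_edgesUnion_filter_snd_le (c : Config n) (v : Fin n) :
    ((edgesUnion c).filter fun e => e.2 = v).card ≤ 2 := by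
  rw [edgesUnion, Finset.filter_union]
  exact (Finset.card_union_le _ _).trans (add_le_add (card_edges_filter_snd_le _ _ v)
    (card_edges_filter_snd_le _ _ v))

lemma card_edgesUnion_filter_mem_le (c : Config n) (A : Finset (Fin n)) :
    ((edgesUnion c).filter fun e => e.1 ∈ A).card ≤ 2 * (c.1 ∩ A).card := by
  rw [edgesUnion, Finset.filter_union, two_mul]
  exact (Finset.card_union_le _ _).trans (add_le_add (card_edges_filter_mem_le _ _ _)
    (card_edges_filter_mem_le _ _ _))

/-- For fixed `f`, the eligible `e` are counted in two ways. Inside the rows of `A` there are at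
most two per row of `c'` and `B₀.card` per planted row. In the column of `f` there are at most two
from `c'` and one for each planted row. -/
lemma sum_pair_bound_le (A₀ B₀ A : Finset (Fin n)) (c' : Config n) {X Y : ℝ} (hX : 0 ≤ X)
    (hY : 0 ≤ Y) :
    ∑ f ∈ edgesUnion c', ∑ e ∈ edgesUnion c' ∪ A₀ ×ˢ B₀,
      (if f.1 ∈ A ∧ e.1 ∈ A then (1 : ℝ) else 0) * (X + if e.2 = f.2 then Y else 0) ≤
      2 * (c'.1 ∩ A).card * (X * (2 * (c'.1 ∩ A).card + B₀.card * (A₀ ∩ A).card) +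
        Y * (2 + (A₀ ∩ A).card)) := by
  set F := edgesUnion c' ∪ A₀ ×ˢ B₀ with hF
  have hP : (A₀ ×ˢ B₀).filter (fun e => e.1 ∈ A) = (A₀ ∩ A) ×ˢ B₀ := by
    ext e; simp only [Finset.mem_filter, Finset.mem_product, Finset.mem_inter]; tauto
  have h1 : ((F.filter fun e => e.1 ∈ A).card : ℝ) ≤
      2 * (c'.1 ∩ A).card + B₀.card * (A₀ ∩ A).card := by
    have : (F.filter fun e => e.1 ∈ A).card ≤ 2 * (c'.1 ∩ A).card + B₀.card * (A₀ ∩ A).card := by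
      rw [hF, Finset.filter_union, hP]
      refine (Finset.card_union_le _ _).trans (add_le_add (card_edgesUnion_filter_mem_le _ _) ?_)
      rw [Finset.card_product, mul_comm]
    exact_mod_cast this
  have h2 : ∀ v, ((F.filter fun e => e.1 ∈ A ∧ e.2 = v).card : ℝ) ≤ 2 + (A₀ ∩ A).card := by
    intro v
    have : (F.filter fun e => e.1 ∈ A ∧ e.2 = v).card ≤ 2 + (A₀ ∩ A).card := by
      rw [hF, Finset.filter_union]
      refine (Finset.card_union_le _ _).trans (add_le_add ?_ ?_)
      · refine (Finset.card_le_card fun e he => ?_).trans (card_edgesUnion_filter_snd_le c' v)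
        simp only [Finset.mem_filter] at he ⊢
        exact ⟨he.1, he.2.2⟩
      · refine Finset.card_le_card_of_injOn Prod.fst ?_ ?_
        · intro e he
          simp only [Finset.coe_filter, Set.mem_ofPred_eq, Finset.mem_product] at he
          simpa using ⟨he.1.1, he.2.1⟩
        · intro e he e' he' h
          simp only [Finset.coe_filter, Set.mem_ofPred_eq] at he he'
          exact Prod.ext h (he.2.2.trans he'.2.2.symm)
    exact_mod_cast this
  have h3 : (((edgesUnion c').filter fun f => f.1 ∈ A).card : ℝ) ≤ 2 * (c'.1 ∩ A).card := by
    exact_mod_cast card_edgesUnion_filter_mem_le c' A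
  have hin : ∀ f ∈ edgesUnion c', ∑ e ∈ F,
      (if f.1 ∈ A ∧ e.1 ∈ A then (1 : ℝ) else 0) * (X + if e.2 = f.2 then Y else 0) ≤
      if f.1 ∈ A then X * (2 * (c'.1 ∩ A).card + B₀.card * (A₀ ∩ A).card) +
        Y * (2 + (A₀ ∩ A).card) else 0 := by
    intro f _
    by_cases hf : f.1 ∈ A
    · rw [if_pos hf]
      have : ∀ e : Fin n × Fin n, (if f.1 ∈ A ∧ e.1 ∈ A then (1 : ℝ) else 0) * (X + if e.2 = f.2 then Y else 0) =
          X * (if e.1 ∈ A then (1 : ℝ) else 0) +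
            Y * (if e.1 ∈ A ∧ e.2 = f.2 then (1 : ℝ) else 0) := by
        intro e; simp only [hf, true_and]
        split_ifs <;> simp_all
      simp only [this]
      rw [Finset.sum_add_distrib, ← Finset.mul_sum, ← Finset.mul_sum, Finset.sum_boole,
        Finset.sum_boole]
      exact add_le_add (mul_le_mul_of_nonneg_left h1 hX) (mul_le_mul_of_nonneg_left (h2 _) hY)
    · simp [hf]
  refine (Finset.sum_le_sum hin).trans ?_
  rw [← Finset.sum_filter, Finset.sum_const, nsmul_eq_mul]
  exact mul_le_mul_of_nonneg_right h3 (by positivity)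

/-- The probability that a random configuration is bad with respect to a fixed one. -/
lemma av_badCount_le {κ s : ℝ} (h : SquareRootScale κ n m K s) {A₀ B₀ : Finset (Fin n)}
    (hA₀ : A₀.card = K) (hB₀ : B₀.card = K) {c' : Config n} (hc' : c'.1.card = m) :
    av m i (badCount (A₀ ×ˢ B₀) c') ≤ 160 * κ * (2 + 2 * (κ ^ 2 + κ ^ 4)) / s ^ 6 := by
  obtain ⟨hs, hsn, hκ, hmκ, hKκ, hκm, hm3, hmn⟩ := h
  have hn6 : (6 : ℝ) ≤ n := by
    have : 6 ≤ n := by omega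
    exact_mod_cast this
  have hm3' : (3 : ℝ) ≤ m := by exact_mod_cast hm3
  have hs0 : 0 < s := by linarith
  set X := 4 / ((n : ℝ) * ((n : ℝ) - 1)) with hXdef
  set Y := 2 / ((n : ℝ) * m) with hYdef
  have hX : 0 ≤ X := div_nonneg (by norm_num) (mul_nonneg (by linarith) (by linarith))
  have hY : 0 ≤ Y := by positivity
  have hX2 : X ≤ 8 / s ^ 8 := by
    rw [hXdef, div_le_div_iff₀ (mul_pos (by linarith) (by linarith)) (by positivity)]
    have : s ^ 8 = n * n := by rw [← hsn]; ring
    rw [this]; nlinarith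
  have hY2 : Y ≤ 2 * κ / s ^ 6 := by
    rw [hYdef, div_le_div_iff₀ (by positivity) (by positivity)]
    have : s ^ 6 = n * s ^ 2 := by rw [← hsn]; ring
    rw [this]
    nlinarith [mul_le_mul_of_nonneg_left hκm (by linarith : (0 : ℝ) ≤ n)]
  have hpt : ∀ A ∈ rootedSets m i, avPerm A (fun σ τ => badCount (A₀ ×ˢ B₀) c' (A, σ, τ)) ≤
      (80 * κ / s ^ 6) * (((c'.1 ∩ A).card : ℝ) ^ 2 + ((A₀ ∩ A).card : ℝ) ^ 2) := by
    intro A hA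
    have hAm := (mem_rootedSets.1 hA).1
    simp only [badCount, avPerm_sum]
    have h1 : ∑ f ∈ edgesUnion c', ∑ e ∈ edgesUnion c' ∪ A₀ ×ˢ B₀,
        avPerm A (fun σ τ => pairCount e f (A, σ, τ)) ≤
        ∑ f ∈ edgesUnion c', ∑ e ∈ edgesUnion c' ∪ A₀ ×ˢ B₀,
        (if f.1 ∈ A ∧ e.1 ∈ A then (1 : ℝ) else 0) * (X + if e.2 = f.2 then Y else 0) := by
      refine Finset.sum_le_sum fun f _ => Finset.sum_le_sum fun e _ => ?_
      have := avPerm_pairCount_le A e f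
      rwa [hAm] at this
    refine (h1.trans (sum_pair_bound_le A₀ B₀ A c' hX hY)).trans ?_
    rw [hB₀]
    set x := ((c'.1 ∩ A).card : ℝ) with hx
    set y := ((A₀ ∩ A).card : ℝ) with hy
    have hx0 : 0 ≤ x := by positivity
    have hy0 : 0 ≤ y := by positivity
    have hxx : x ≤ x ^ 2 := by
      rw [hx]; exact_mod_cast Nat.le_self_pow two_ne_zero _
    have hxy : x * y ≤ x ^ 2 + y ^ 2 := by nlinarith [sq_nonneg (x - y)]
    -- The planted rectangle costs a factor `K` of order `s ^ 2`, which brings `X`, of order `s ^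
    -- (-8)`, to the same order as the column coincidences measured by `Y`.
    have hXK : X * K ≤ 8 * κ / s ^ 6 := by
      calc X * K ≤ (8 / s ^ 8) * (κ * s ^ 2) := by gcongr
        _ = 8 * κ / s ^ 6 := by field_simp
    have hXκ : X ≤ 8 * κ / s ^ 6 := by
      refine hX2.trans ?_
      rw [div_le_div_iff₀ (by positivity) (by positivity)]
      have : s ^ 6 ≤ s ^ 8 := pow_le_pow_right₀ hs (by norm_num)
      nlinarith [pow_pos hs0 8, pow_pos hs0 6]
    have hY3 : Y ≤ 8 * κ / s ^ 6 := hY2.trans (by gcongr; norm_num)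
    set q := 8 * κ / s ^ 6 with hq
    have hq0 : 0 ≤ q := by positivity
    have e1 : 80 * κ / s ^ 6 = 10 * q := by rw [hq]; ring
    rw [e1]
    have t1 : X * (2 * x) ≤ q * (2 * x) := by gcongr
    have t2 : X * (K * y) ≤ q * y := by rw [← mul_assoc]; gcongr
    have t3 : Y * (2 + y) ≤ q * (2 + y) := by gcongr
    calc 2 * x * (X * (2 * x + K * y) + Y * (2 + y))
        ≤ 2 * x * (q * (2 * x) + q * y + q * (2 + y)) := by
          refine mul_le_mul_of_nonneg_left ?_ (by positivity)
          rw [mul_add]; linarith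
      _ = q * (4 * x ^ 2 + 4 * (x * y) + 4 * x) := by ring
      _ ≤ q * (10 * (x ^ 2 + y ^ 2)) := by
          refine mul_le_mul_of_nonneg_left ?_ hq0
          nlinarith [sq_nonneg (x - y), sq_nonneg y]
      _ = _ := by ring
  refine (Finset.expect_le_expect hpt).trans ?_
  rw [← Finset.mul_expect, Finset.expect_add_distrib]
  have hE : ∀ F : Finset (Fin n), (F.card : ℝ) ≤ κ * s ^ 2 →
      𝔼 A ∈ rootedSets m i, ((F ∩ A).card : ℝ) ^ 2 ≤ 2 + 2 * (κ ^ 2 + κ ^ 4) := by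
    intro F hF
    refine (expect_card_inter_sq_le hm3 (by omega) F).trans ?_
    have hb : (F.card : ℝ) * (m / n) ≤ κ ^ 2 := by
      calc (F.card : ℝ) * (m / n) ≤ (κ * s ^ 2) * ((κ * s ^ 2) / n) := by gcongr
        _ = κ ^ 2 := by rw [← hsn]; field_simp
    have hb2 : ((F.card : ℝ) * (m / n)) ^ 2 ≤ (κ ^ 2) ^ 2 := pow_le_pow_left₀ (by positivity) hb 2
    nlinarith
  have hE1 := hE c'.1 (by rw [hc']; exact hmκ)
  have hE2 := hE A₀ (by rw [hA₀]; exact hKκ)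
  calc _ ≤ (80 * κ / s ^ 6) * ((2 + 2 * (κ ^ 2 + κ ^ 4)) + (2 + 2 * (κ ^ 2 + κ ^ 4))) := by
        gcongr
    _ = _ := by ring

end

/-- Bounding every exponent by the largest one turns a product of exponential weights into a sum, so
that joint moments of the exponents are never needed. -/
lemma pow_sum_le_sum_pow {J : Type*} {s : Finset J} (hs : s.Nonempty) {β : ℝ} (hβ : 1 ≤ β)
    (k : J → ℕ) : β ^ (∑ j ∈ s, k j) ≤ ∑ j ∈ s, (β ^ s.card) ^ k j := by
  obtain ⟨j, hj, hmax⟩ := Finset.exists_max_image s k hs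
  calc β ^ (∑ j ∈ s, k j) ≤ β ^ (s.card * k j) := by
        refine pow_le_pow_right₀ hβ ?_
        simpa using Finset.sum_le_card_nsmul s k (k j) hmax
    _ = (β ^ s.card) ^ k j := pow_mul _ _ _
    _ ≤ _ := Finset.single_le_sum (f := fun j => (β ^ s.card) ^ k j)
        (fun _ _ => by positivity) hj

section
variable {n m K : ℕ} {i : Fin n}

lemma excess_le (P : Finset (Fin n × Fin n)) (c : Config n) :
    excess P c ≤ (overlap c).card + (edgesL c ∩ P).card + (edgesR c ∩ P).card := by
  rw [excess, edgesUnion, Finset.union_inter_distrib_right, add_assoc]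
  exact Nat.add_le_add_left (Finset.card_union_le _ _) _

lemma card_edgesUnion_inter_le (c' c : Config n) :
    (edgesUnion c' ∩ edgesUnion c).card ≤
      (edgesL c ∩ edgesL c').card + (edgesL c ∩ edgesR c').card +
      ((edgesR c ∩ edgesL c').card + (edgesR c ∩ edgesR c').card) := by
  rw [Finset.inter_comm, edgesUnion, Finset.union_inter_distrib_right, edgesUnion,
    Finset.inter_union_distrib_left, Finset.inter_union_distrib_left]
  exact (Finset.card_union_le _ _).trans (add_le_add (Finset.card_union_le _ _)
    (Finset.card_union_le _ _))

/-- The exponents of the weight are dominated by ten elementary counts: three for each configuration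
alone and four between them. This accounts for the `10` in `γ`; the `9` is the moment needed after
truncation. -/
lemma pairFactor_pow_le {a D : ℝ} (ha : 0 ≤ a) (hD : 0 ≤ D) {β γ : ℝ} (hβa : 1 + a ≤ β)
    (hβD : 1 + D ≤ β) (hγ : γ = (β ^ 9) ^ 10)
    (P : Finset (Fin n × Fin n)) (c' c : Config n) :
    pairFactor a D P c' c ^ 9 ≤
      γ ^ (overlap c').card + γ ^ (edgesL c' ∩ P).card + γ ^ (edgesR c' ∩ P).card +
      γ ^ (overlap c).card + γ ^ (edgesL c ∩ P).card + γ ^ (edgesR c ∩ P).card +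
      γ ^ (edgesL c ∩ edgesL c').card + γ ^ (edgesL c ∩ edgesR c').card +
      γ ^ (edgesR c ∩ edgesL c').card + γ ^ (edgesR c ∩ edgesR c').card := by
  have hβ1 : 1 ≤ β := by linarith
  let k : Fin 10 → ℕ := ![(overlap c').card, (edgesL c' ∩ P).card, (edgesR c' ∩ P).card,
    (overlap c).card, (edgesL c ∩ P).card, (edgesR c ∩ P).card, (edgesL c ∩ edgesL c').card,
    (edgesL c ∩ edgesR c').card, (edgesR c ∩ edgesL c').card, (edgesR c ∩ edgesR c').card]
  have hk : ∑ j, k j = (overlap c').card + (edgesL c' ∩ P).card + (edgesR c' ∩ P).card +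
      (overlap c).card + (edgesL c ∩ P).card + (edgesR c ∩ P).card + (edgesL c ∩ edgesL c').card +
      (edgesL c ∩ edgesR c').card + (edgesR c ∩ edgesL c').card +
      (edgesR c ∩ edgesR c').card := by
    simp [Fin.sum_univ_succ, k]; ring
  have h1 : pairFactor a D P c' c ≤ β ^ (∑ j, k j) := by
    calc pairFactor a D P c' c ≤ β ^ excess P c' * β ^ excess P c *
          β ^ (edgesUnion c' ∩ edgesUnion c).card := by
          unfold pairFactor
          gcongr
      _ = β ^ (excess P c' + excess P c + (edgesUnion c' ∩ edgesUnion c).card) := by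
          rw [pow_add, pow_add]
      _ ≤ _ := by
          refine pow_le_pow_right₀ hβ1 ?_
          have := excess_le P c'
          have := excess_le P c
          have := card_edgesUnion_inter_le c' c
          omega
  have h0 : 0 ≤ pairFactor a D P c' c := by unfold pairFactor; positivity
  have h2 := pow_le_pow_left₀ h0 h1 9
  have h3 := pow_sum_le_sum_pow (s := (Finset.univ : Finset (Fin 10))) Finset.univ_nonempty
    (one_le_pow₀ hβ1 : 1 ≤ β ^ 9) k
  have e : (β ^ (∑ j, k j)) ^ 9 = (β ^ 9) ^ (∑ j, k j) := by rw [← pow_mul, ← pow_mul, mul_comm]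
  have e2 : (β ^ 9) ^ (Finset.univ : Finset (Fin 10)).card = γ := by
    rw [hγ, Finset.card_univ, Fintype.card_fin]
  rw [e2] at h3
  rw [e] at h2
  refine h2.trans (h3.trans (le_of_eq ?_))
  simp [Fin.sum_univ_succ, k]; ring

/-- Each of the `m` rows meets the graph with probability at most `d / (n - m)`. As `n - m ≥ n / 2`,
the expected number of hits is at most `2 * κ ^ 2`. -/
lemma one_add_pow_le_exp {κ s : ℝ} (h : SquareRootScale κ n m K s) {d : ℕ}
    (hd : (d : ℝ) * m ≤ κ ^ 2 * n) {γ : ℝ} (hγ : 1 ≤ γ) :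
    (1 + (γ - 1) * d / ((n : ℝ) - m)) ^ m ≤ Real.exp (2 * κ ^ 2 * (γ - 1)) := by
  have hmn : (2 * m : ℝ) ≤ n := by exact_mod_cast h.two_mul_m_le
  have hm : (3 : ℝ) ≤ m := by exact_mod_cast h.three_le_m
  have hpos : (0 : ℝ) < (n : ℝ) - m := by linarith
  set t := (γ - 1) * d / ((n : ℝ) - m) with ht
  have ht0 : 0 ≤ t := div_nonneg (mul_nonneg (by linarith) (by positivity)) hpos.le
  calc (1 + t) ^ m ≤ Real.exp t ^ m :=
        pow_le_pow_left₀ (by linarith) (by linarith [Real.add_one_le_exp t]) m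
    _ = Real.exp (m * t) := by rw [← Real.exp_nat_mul]
    _ ≤ _ := by
        refine Real.exp_le_exp.2 ?_
        rw [ht, ← mul_div_assoc, div_le_iff₀ hpos]
        have h1 : (d : ℝ) * m ≤ 2 * κ ^ 2 * ((n : ℝ) - m) := by
          have : 0 ≤ κ ^ 2 := sq_nonneg κ
          nlinarith
        have := mul_le_mul_of_nonneg_left h1 (by linarith : 0 ≤ γ - 1)
        linarith

lemma av_pow_card_inter_le_exp {κ s : ℝ} (h : SquareRootScale κ n m K s)
    {F : Finset (Fin n × Fin n)} {d : ℕ} (hF : ∀ u, (F.filter fun e => e.1 = u).card ≤ d)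
    (hd : (d : ℝ) * m ≤ κ ^ 2 * n) {γ : ℝ} (hγ : 1 ≤ γ) :
    av m i (fun c => γ ^ (edgesL c ∩ F).card) ≤ Real.exp (2 * κ ^ 2 * (γ - 1)) ∧
    av m i (fun c => γ ^ (edgesR c ∩ F).card) ≤ Real.exp (2 * κ ^ 2 * (γ - 1)) := by
  have h3 := h.three_le_m
  have h2 := h.two_mul_m_le
  have hmn : (m : ℝ) < n := by exact_mod_cast (by omega : m < n)
  have ht : (γ - 1) * d ≤ ((γ - 1) * d / ((n : ℝ) - m)) * ((n : ℝ) - m) := by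
    rw [div_mul_cancel₀ _ (by linarith)]
  exact ⟨(av_pow_card_edgesL_inter_le (by omega) (by omega) hF hγ ht).trans
    (one_add_pow_le_exp h hd hγ),
    (av_pow_card_edgesR_inter_le (by omega) (by omega) hF hγ ht).trans
    (one_add_pow_le_exp h hd hγ)⟩

/-- The exponential weights of pairs of configurations have bounded moments. -/
lemma av_av_pairFactor_pow_le {a D κ s : ℝ} (ha : 0 ≤ a) (hD : 0 ≤ D) {β γ : ℝ}
    (hβa : 1 + a ≤ β) (hβD : 1 + D ≤ β) (hγ : γ = (β ^ 9) ^ 10)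
    (h : SquareRootScale κ n m K s) {A₀ B₀ : Finset (Fin n)} (hB₀ : B₀.card = K) :
    av m i (fun c' => av m i (fun c => pairFactor a D (A₀ ×ˢ B₀) c' c ^ 9)) ≤
      10 * Real.exp (2 * κ ^ 2 * (γ - 1)) := by
  have hγ1 : 1 ≤ γ := by
    rw [hγ]; exact one_le_pow₀ (one_le_pow₀ (by linarith))
  set P := A₀ ×ˢ B₀ with hP
  set E := Real.exp (2 * κ ^ 2 * (γ - 1)) with hE
  have hm1 : 1 ≤ m := by have := h.three_le_m; omega
  have hmn : m ≤ n := by have := h.two_mul_m_le; omega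
  have hmn' : (m : ℝ) ≤ n := by exact_mod_cast hmn
  have hκ1 : 1 ≤ κ ^ 2 := one_le_pow₀ h.one_le_κ
  have hPdeg : ∀ u, (P.filter fun e => e.1 = u).card ≤ K := by
    intro u
    rw [← hB₀]
    refine Finset.card_le_card_of_injOn Prod.snd ?_ ?_
    · intro e he
      simp only [hP, Finset.coe_filter, Set.mem_ofPred_eq, Finset.mem_product] at he
      exact he.1.2
    · intro e he e' he' hee
      simp only [Finset.coe_filter, Set.mem_ofPred_eq] at he he'
      exact Prod.ext (he.2.trans he'.2.symm) hee
  -- The planted rectangle has row degrees at most `K`, and here the upper bounds of order `√n` on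
  -- both `m` and `K` enter.
  have hKd : (K : ℝ) * m ≤ κ ^ 2 * n := by
    calc (K : ℝ) * m ≤ (κ * s ^ 2) * (κ * s ^ 2) :=
          mul_le_mul h.K_le h.m_le (by positivity)
            (le_trans (by positivity) h.K_le)
      _ = κ ^ 2 * n := by rw [← h.s_pow]; ring
  have h1d : ((1 : ℕ) : ℝ) * m ≤ κ ^ 2 * n := by
    rw [Nat.cast_one, one_mul]; nlinarith [Nat.cast_nonneg (α := ℝ) n]
  have hov : av m i (fun c => γ ^ (overlap c).card) ≤ E := by
    rw [show av m i (fun c => γ ^ (overlap c).card) = expSum (γ - 1) m from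
      av_pow_card_overlap hm1 hmn γ]
    refine (expSum_le_exp (by linarith) m).trans (Real.exp_le_exp.2 ?_)
    nlinarith
  have hPP := av_pow_card_inter_le_exp (i := i) h hPdeg hKd hγ1
  have hin : ∀ c' : Config n, av m i (fun c => pairFactor a D P c' c ^ 9) ≤
      (γ ^ (overlap c').card + γ ^ (edgesL c' ∩ P).card + γ ^ (edgesR c' ∩ P).card) + 7 * E := by
    intro c'
    refine (av_mono fun c _ _ => pairFactor_pow_le ha hD hβa hβD hγ P c' c).trans ?_
    have hL := av_pow_card_inter_le_exp (i := i) h (card_edges_filter_fst_le c'.1 c'.2.1) h1d hγ1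
    have hR := av_pow_card_inter_le_exp (i := i) h (card_edges_filter_fst_le c'.1 c'.2.2) h1d hγ1
    change av m i (fun c => γ ^ (edgesL c ∩ edgesL c').card) ≤ E ∧
      av m i (fun c => γ ^ (edgesR c ∩ edgesL c').card) ≤ E at hL
    change av m i (fun c => γ ^ (edgesL c ∩ edgesR c').card) ≤ E ∧
      av m i (fun c => γ ^ (edgesR c ∩ edgesR c').card) ≤ E at hR
    simp only [av_add, av_const hm1 hmn]
    linarith [hPP.1, hPP.2, hL.1, hL.2, hR.1, hR.2]
  refine (av_mono fun c' _ _ => hin c').trans ?_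
  simp only [av_add, av_const hm1 hmn]
  linarith [hPP.1, hPP.2]

/-- The squared coefficients of the remainder are negligible, even with exponential weights in the
degree. -/
theorem exists_sum_sq_av_remTerm_le {a D κ : ℝ} (ha : 0 ≤ a) (hD : 0 ≤ D) :
    ∃ C, 0 ≤ C ∧ ∀ {n m K : ℕ} {s : ℝ}, SquareRootScale κ n m K s →
      ∀ {A₀ B₀ : Finset (Fin n)}, A₀.card = K → B₀.card = K → ∀ i : Fin n,
      n * ∑ T, D ^ T.card * av m i (remTerm a (A₀ ×ˢ B₀) T) ^ 2 ≤ C / s := by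
  set Cb := 160 * |κ| * (2 + 2 * (κ ^ 2 + κ ^ 4)) with hCb
  obtain ⟨β, hβ⟩ : ∃ β, β = 1 + a + D := ⟨_, rfl⟩
  obtain ⟨γ, hγ⟩ : ∃ γ, γ = (β ^ 9) ^ 10 := ⟨_, rfl⟩
  set Ce := 10 * Real.exp (2 * κ ^ 2 * (γ - 1)) with hCe
  have hCb0 : 0 ≤ Cb := by positivity
  have hCe0 : 0 ≤ Ce := by positivity
  refine ⟨4 * (Cb + Ce), by positivity, fun {n m K s} h {A₀ B₀} hA₀ hB₀ i => ?_⟩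
  set P := A₀ ×ˢ B₀ with hP
  have hs1 := h.one_le_s
  have hs0 : 0 < s := by linarith
  have hm1 : 1 ≤ m := by have := h.three_le_m; omega
  have hmn : m ≤ n := by have := h.two_mul_m_le; omega
  -- The square of an average is a double average over two independent configurations.
  have h1 : ∑ T, D ^ T.card * av m i (remTerm a P T) ^ 2 ≤
      av m i (fun c' => av m i (fun c =>
        ∑ T, D ^ T.card * (|remTerm a P T c'| * |remTerm a P T c|))) := by
    simp only [av_sum, av_const_mul]
    refine Finset.sum_le_sum fun T _ => mul_le_mul_of_nonneg_left ?_ (by positivity)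
    rw [av_mul_const, ← sq, ← sq_abs (av m i (remTerm a P T))]
    exact pow_le_pow_left₀ (abs_nonneg _) (abs_av_le _) 2
  have h2 : av m i (fun c' => av m i (fun c =>
        ∑ T, D ^ T.card * (|remTerm a P T c'| * |remTerm a P T c|))) ≤
      4 * (s * (Cb / s ^ 6) + Ce / s ^ 8) := by
    refine (av_mono fun c' _ _ => av_mono fun c _ _ =>
      sum_abs_remTerm_mul_le ha hD hs0 P c' c).trans ?_
    simp only [av_const_mul, av_add, div_eq_mul_inv, av_mul_const]
    have b1 : av m i (fun c' => av m i (badCount P c')) ≤ Cb * (s ^ 6)⁻¹ := by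
      have : av m i (fun c' => av m i (badCount P c')) ≤ av m i (fun _ => Cb * (s ^ 6)⁻¹) := by
        refine av_mono fun c' hc' _ => ?_
        have := av_badCount_le (i := i) h hA₀ hB₀ hc'
        rw [hCb, abs_of_nonneg (by linarith [h.one_le_κ])]
        simpa [div_eq_mul_inv] using this
      rwa [av_const hm1 hmn] at this
    have b2 := av_av_pairFactor_pow_le (i := i) (A₀ := A₀) ha hD (by linarith : 1 + a ≤ β)
      (by linarith) hγ h hB₀
    refine mul_le_mul_of_nonneg_left (add_le_add (mul_le_mul_of_nonneg_left b1 hs0.le)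
      (mul_le_mul_of_nonneg_right b2 (by positivity))) (by norm_num)
  -- The prefactor `n = s ^ 4` is beaten both by `s * s ^ (-6)` from the bad pairs and by `s ^ (-8)`
  -- from the truncation.
  calc (n : ℝ) * ∑ T, D ^ T.card * av m i (remTerm a P T) ^ 2
      ≤ s ^ 4 * (4 * (s * (Cb / s ^ 6) + Ce / s ^ 8)) := by
        rw [h.s_pow]
        exact mul_le_mul_of_nonneg_left (h1.trans h2) (by positivity)
    _ = 4 * (Cb / s + Ce / s ^ 4) := by field_simp
    _ ≤ 4 * (Cb / s + Ce / s) := by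
        gcongr
        exact le_self_pow₀ hs1 (by norm_num)
    _ = _ := by ring

end

/-! ### The weight as a polynomial in the bits -/

section
variable {n m : ℕ}

/-- The sum over all injections of `A` is governed by a uniformly random permutation. -/
lemma sum_injective_eq_card_mul_expect (A : Finset (Fin n)) (Φ : (A → Fin n) → ℝ) :
    ∑ j : A → Fin n with Function.Injective j, Φ j =
      ((Finset.univ.filter fun j : A → Fin n => Function.Injective j).card : ℝ) *
        𝔼 ρ : Equiv.Perm (Fin n), Φ fun u => ρ u := by
  have h1 : ∀ ρ : Equiv.Perm (Fin n), ∑ j : A → Fin n with Function.Injective j, Φ j =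
      ∑ j : A → Fin n with Function.Injective j, Φ fun u => ρ (j u) := by
    intro ρ
    refine (Finset.sum_nbij' (fun j u => ρ (j u)) (fun j u => ρ.symm (j u)) ?_ ?_ ?_ ?_ ?_).symm
    · intro j hj
      simp only [Finset.mem_filter, Finset.mem_univ, true_and] at hj ⊢
      exact ρ.injective.comp hj
    · intro j hj
      simp only [Finset.mem_filter, Finset.mem_univ, true_and] at hj ⊢
      exact ρ.symm.injective.comp hj
    · intro j _; simp
    · intro j _; simp
    · intro j _; rfl
  have h2 : ∀ j : A → Fin n, Function.Injective j →
      𝔼 ρ : Equiv.Perm (Fin n), Φ (fun u => ρ (j u)) =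
        𝔼 ρ : Equiv.Perm (Fin n), Φ fun u => ρ u := by
    intro j hj
    -- An injection of `A` extends to a permutation of `Fin n`, and right multiplication by that
    -- permutation preserves the uniform law.
    let e : {x // x ∈ A} ≃ {x // x ∈ Finset.univ.image j} :=
      Equiv.ofBijective (fun u => ⟨j u, Finset.mem_image_of_mem _ (Finset.mem_univ u)⟩)
        ⟨fun u v huv => hj (congrArg Subtype.val huv), fun ⟨x, hx⟩ => by
          obtain ⟨u, -, hu⟩ := Finset.mem_image.1 hx
          exact ⟨u, Subtype.ext hu⟩⟩
    refine Fintype.expect_equiv (Equiv.mulRight e.extendSubtype) _ _ fun ρ => ?_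
    congr 1; ext u
    simp only [Equiv.coe_mulRight, Equiv.Perm.mul_apply]
    rw [Equiv.extendSubtype_apply_of_mem e u u.2]
    rfl
  calc ∑ j : A → Fin n with Function.Injective j, Φ j
      = 𝔼 ρ : Equiv.Perm (Fin n), ∑ j : A → Fin n with Function.Injective j, Φ fun u => ρ (j u) := by
        rw [Finset.expect_congr rfl (g := fun _ => ∑ j : A → Fin n with Function.Injective j, Φ j)
          fun ρ _ => (h1 ρ).symm, Fintype.expect_const]
    _ = ∑ j : A → Fin n with Function.Injective j,
        𝔼 ρ : Equiv.Perm (Fin n), Φ fun u => ρ (j u) := Finset.expect_sum_comm _ _ _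
    _ = ∑ j : A → Fin n with Function.Injective j, 𝔼 ρ : Equiv.Perm (Fin n), Φ fun u => ρ u :=
        Finset.sum_congr rfl fun j hj => h2 j (Finset.mem_filter.1 hj).2
    _ = _ := by rw [Finset.sum_const, nsmul_eq_mul]

/-- Bijections onto the sets of size `|A|` are the same as injections. -/
lemma sum_sum_equiv_eq_sum_injective {A : Finset (Fin n)} (hA : A.card = m)
    (Φ : (A → Fin n) → ℝ) :
    ∑ B ∈ Finset.powersetCard m (Finset.univ : Finset (Fin n)), ∑ σ : A ≃ B,
      Φ (fun u => (σ u : Fin n)) = ∑ j : A → Fin n with Function.Injective j, Φ j := by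
  rw [Finset.sum_sigma']
  refine Finset.sum_bij (fun x _ u => (x.2 u : Fin n)) ?_ ?_ ?_ ?_
  · rintro ⟨B, σ⟩ _
    simp only [Finset.mem_filter, Finset.mem_univ, true_and]
    exact Subtype.coe_injective.comp σ.injective
  · rintro ⟨B, σ⟩ _ ⟨B', σ'⟩ _ h
    have hB : ∀ {B : Finset (Fin n)} (σ : A ≃ B), B = Finset.univ.image fun u => (σ u : Fin n) := by
      intro B σ
      ext x
      simp only [Finset.mem_image, Finset.mem_univ, true_and]
      constructor
      · intro hx; exact ⟨σ.symm ⟨x, hx⟩, by simp⟩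
      · rintro ⟨u, rfl⟩; exact (σ u).2
    have hBB : B = B' := by
      rw [hB σ, hB σ']
      exact congrArg (fun j : A → Fin n => Finset.univ.image j) h
    subst hBB
    have : σ = σ' := Equiv.ext fun u => Subtype.ext (congrFun h u)
    rw [this]
  · intro j hj
    have hj' : Function.Injective j := (Finset.mem_filter.1 hj).2
    let e : A ≃ ↥(Finset.univ.image j) :=
      Equiv.ofBijective (fun u => ⟨j u, Finset.mem_image_of_mem _ (Finset.mem_univ u)⟩)
        ⟨fun u v huv => hj' (congrArg Subtype.val huv), fun ⟨x, hx⟩ => by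
          obtain ⟨u, -, hu⟩ := Finset.mem_image.1 hx
          exact ⟨u, Subtype.ext hu⟩⟩
    refine ⟨⟨Finset.univ.image j, e⟩, Finset.mem_sigma.2 ⟨?_, Finset.mem_univ _⟩, rfl⟩
    simp [Finset.mem_powersetCard, Finset.card_image_of_injective _ hj', hA]
  · intro x _; rfl

lemma card_injective {A : Finset (Fin n)} (hA : A.card = m) :
    ((Finset.univ.filter fun j : A → Fin n => Function.Injective j).card : ℝ) =
      (n.choose m : ℝ) * (m.factorial : ℝ) := by
  have h := sum_sum_equiv_eq_sum_injective hA (fun _ => (1 : ℝ))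
  rw [Finset.sum_const, nsmul_eq_mul, mul_one] at h
  rw [← h]
  have : ∀ B ∈ Finset.powersetCard m (Finset.univ : Finset (Fin n)),
      ∑ _σ : A ≃ B, (1 : ℝ) = (m.factorial : ℝ) := by
    intro B hB
    have hBm : B.card = m := (Finset.mem_powersetCard.1 hB).2
    have e : A ≃ B := Fintype.equivOfCardEq (by simp [hA, hBm])
    rw [Finset.sum_const, Finset.card_univ, Fintype.card_equiv e, Fintype.card_coe, hA]
    simp
  rw [Finset.sum_congr rfl this, Finset.sum_const, Finset.card_powersetCard, nsmul_eq_mul]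
  simp

/-- The average over the images of `A` and over two matchings, in terms of random permutations. -/
lemma sum_sum_equiv_mul_eq_avPerm {A : Finset (Fin n)} (hA : A.card = m)
    (f : (A → Fin n) → ℝ) :
    ∑ B ∈ Finset.powersetCard m (Finset.univ : Finset (Fin n)),
      (∑ σ : A ≃ B, f fun u => (σ u : Fin n)) ^ 2 =
      (n.choose m : ℝ) * (m.factorial : ℝ) ^ 2 *
        avPerm A (fun σ τ => f (fun u => σ u) * f fun u => τ u) := by
  -- Two bijections onto the same `B` differ by a permutation of `A`; this produces the law
  -- underlying `avPerm`.
  have h1 : ∀ B : Finset (Fin n), (∑ σ : A ≃ B, f fun u => (σ u : Fin n)) ^ 2 =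
      ∑ π : Equiv.Perm A, ∑ σ : A ≃ B,
        f (fun u => (σ u : Fin n)) * f fun u => (σ (π u) : Fin n) := by
    intro B
    rw [sq, Finset.sum_mul_sum, Finset.sum_comm (γ := Equiv.Perm A)]
    refine Finset.sum_congr rfl fun σ _ => ?_
    symm
    refine Fintype.sum_bijective (fun π : Equiv.Perm A => π.trans σ) ?_ _ _ fun π => rfl
    constructor
    · intro π π' h
      refine Equiv.ext fun u => ?_
      simpa using congrArg (fun e : A ≃ B => σ.symm (e u)) h
    · intro τ
      exact ⟨τ.trans σ.symm, by ext u; simp⟩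
  simp only [h1]
  rw [Finset.sum_comm]
  have h2 : ∀ π : Equiv.Perm A,
      ∑ B ∈ Finset.powersetCard m (Finset.univ : Finset (Fin n)), ∑ σ : A ≃ B,
        f (fun u => (σ u : Fin n)) * f (fun u => (σ (π u) : Fin n)) =
      (n.choose m : ℝ) * (m.factorial : ℝ) * 𝔼 ρ : Equiv.Perm (Fin n),
        (f (fun u => ρ u) * f fun u => (ρ * Equiv.Perm.ofSubtype π) u) := by
    intro π
    have := sum_sum_equiv_eq_sum_injective hA (fun j => f j * f fun u => j (π u))
    rw [this, sum_injective_eq_card_mul_expect, card_injective hA]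
    congr 1
    refine Finset.expect_congr rfl fun ρ _ => ?_
    congr 2; ext u
    rw [Equiv.Perm.mul_apply, Equiv.Perm.ofSubtype_apply_coe]
  rw [Finset.sum_congr rfl fun π _ => h2 π, ← Finset.mul_sum]
  have hc : (Fintype.card (Equiv.Perm A) : ℝ) = (m.factorial : ℝ) := by
    rw [Fintype.card_perm, Fintype.card_coe, hA]
  have h3 : ∑ π : Equiv.Perm A, 𝔼 ρ : Equiv.Perm (Fin n),
        (f (fun u => ρ u) * f fun u => (ρ * Equiv.Perm.ofSubtype π) u) =
      (m.factorial : ℝ) * avPerm A (fun σ τ => f (fun u => σ u) * f fun u => τ u) := by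
    rw [avPerm, Finset.expect_comm, ← hc, Fintype.card_mul_expect]
  rw [h3]; ring

/-- The weight of a vertex as an average over random configurations. -/
lemma weight_eq_av {p : ℝ} (hm : 1 ≤ m) (hmn : m ≤ n) (i : Fin n) (ω : Outcome n) :
    weight m p i ω = av m i (fun c => (∏ u ∈ c.1, edge ω u (c.2.1 u) / p) *
      ∏ u ∈ c.1, edge ω u (c.2.2 u) / p) := by
  rw [weight, av, Finset.expect_eq_sum_div_card, card_rootedSets hm, Finset.mul_sum,
    Finset.sum_div]
  refine Finset.sum_congr rfl fun A hA => ?_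
  have hAm : A.card = m := (mem_rootedSets.1 hA).1
  have hM : ∀ B : Finset (Fin n), matchingCount m p ω A B =
      1 / (m.factorial : ℝ) * ∑ σ : A ≃ B, ∏ u : A, edge ω u (σ u) / p := by
    intro B
    rw [matchingCount, one_div_mul_eq_div, one_div_mul_eq_div]
    simp only [Finset.prod_div_distrib, Finset.prod_const, Finset.card_univ, Fintype.card_coe, hAm]
    rw [← Finset.sum_div, div_div]
  simp only [hM, mul_pow]
  rw [← Finset.mul_sum, sum_sum_equiv_mul_eq_avPerm hAm
    (fun j : A → Fin n => ∏ u : A, edge ω u (j u) / p)]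
  have e : ∀ σ : Equiv.Perm (Fin n), ∏ u : A, edge ω u (σ u) / p = ∏ u ∈ A, edge ω u (σ u) / p :=
    fun σ => Finset.prod_coe_sort A fun u => edge ω u (σ u) / p
  simp only [e]
  have h1 : ((n - 1).choose (m - 1) : ℝ) ≠ 0 := by
    exact_mod_cast (Nat.choose_pos (by omega)).ne'
  have h2 : (n.choose m : ℝ) ≠ 0 := by exact_mod_cast (Nat.choose_pos hmn).ne'
  have h3 : (m.factorial : ℝ) ≠ 0 := by positivity
  field_simp

/-- A normalized indicator satisfies `y ^ 2 = p⁻¹ * y`, so each common edge yields a factor `p⁻¹`,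
and so does each planted edge. The remaining factors are `1 + η`, and expanding their product gives
the monomials. -/
lemma prod_edge_mul_prod_edge {p : ℝ} (A₀ B₀ : Finset (Fin n))
    (g : Fin n × Fin n → Bool) (c : Config n) :
    (∏ u ∈ c.1, edge (A₀, B₀, g) u (c.2.1 u) / p) * ∏ u ∈ c.1, edge (A₀, B₀, g) u (c.2.2 u) / p =
      ∑ T, coefTerm (p⁻¹ - 1) (A₀ ×ˢ B₀) T c * monomial p T g := by
  set P := A₀ ×ˢ B₀ with hP
  let y : Fin n × Fin n → ℝ := fun e => edge (A₀, B₀, g) e.1 e.2 / p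
  have hy2 : ∀ e, y e * y e = p⁻¹ * y e := by
    intro e
    simp only [y, edge]
    split_ifs <;> simp [div_eq_mul_inv]
  have hyP : ∀ e ∈ P, y e = p⁻¹ := by
    intro e he
    rw [hP, Finset.mem_product] at he
    simp [y, edge, he]
  have hyN : ∀ e ∉ P, y e = 1 + bit p (g e) := by
    intro e he
    rw [hP, Finset.mem_product] at he
    simp only [y, edge, bit, he, false_or]
    split_ifs <;> simp [div_eq_mul_inv]
  have hL : ∏ u ∈ c.1, edge (A₀, B₀, g) u (c.2.1 u) / p = ∏ e ∈ edgesL c, y e :=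
    (prod_edges c.1 c.2.1 y).symm
  have hR : ∏ u ∈ c.1, edge (A₀, B₀, g) u (c.2.2 u) / p = ∏ e ∈ edgesR c, y e :=
    (prod_edges c.1 c.2.2 y).symm
  have h1 : (∏ e ∈ edgesL c, y e) * ∏ e ∈ edgesR c, y e =
      p⁻¹ ^ (overlap c).card * ∏ e ∈ edgesUnion c, y e := by
    have hsub : overlap c ⊆ edgesUnion c :=
      Finset.inter_subset_left.trans Finset.subset_union_left
    rw [← Finset.prod_union_inter]
    change (∏ e ∈ edgesUnion c, y e) * ∏ e ∈ overlap c, y e = _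
    rw [← Finset.prod_sdiff hsub, mul_assoc, ← Finset.prod_mul_distrib,
      Finset.prod_congr rfl fun e _ => hy2 e, Finset.prod_mul_distrib, Finset.prod_const]
    ring
  have h2 : ∏ e ∈ edgesUnion c, y e =
      p⁻¹ ^ (edgesUnion c ∩ P).card * ∏ e ∈ edgesUnion c \ P, (1 + bit p (g e)) := by
    rw [← Finset.prod_inter_mul_prod_sdiff (edgesUnion c) P,
      Finset.prod_congr rfl fun e he => hyP e (Finset.mem_inter.1 he).2, Finset.prod_const,
      Finset.prod_congr rfl fun e he => hyN e (Finset.mem_sdiff.1 he).2]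
  rw [hL, hR, h1, h2, ← mul_assoc, ← pow_add, Finset.prod_one_add, Finset.mul_sum]
  have h3 : ∀ T, coefTerm (p⁻¹ - 1) P T c * monomial p T g =
      if T ∈ (edgesUnion c \ P).powerset then
        p⁻¹ ^ ((overlap c).card + (edgesUnion c ∩ P).card) * ∏ e ∈ T, bit p (g e) else 0 := by
    intro T
    rw [coefTerm, excess, add_sub_cancel, monomial]
    simp only [Finset.mem_powerset]
    split_ifs <;> simp
  simp only [h3]
  rw [Finset.sum_ite_mem, Finset.univ_inter]

/-- The expansion of the weight of a vertex in the normalized bits. -/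
lemma weight_eq_sum_monomial {p : ℝ} (hm : 1 ≤ m) (hmn : m ≤ n) (i : Fin n)
    (A₀ B₀ : Finset (Fin n)) (g : Fin n × Fin n → Bool) :
    weight m p i (A₀, B₀, g) =
      ∑ T, av m i (coefTerm (p⁻¹ - 1) (A₀ ×ˢ B₀) T) * monomial p T g := by
  rw [weight_eq_av hm hmn]
  simp only [prod_edge_mul_prod_edge]
  rw [av_sum]
  simp only [av_mul_const]

lemma bitExp_monomial {p : ℝ} (hp : 0 < p) {ι : Type} [Fintype ι] [DecidableEq ι]
    (T : Finset ι) : bitExp p (monomial p T) = if T = ∅ then 1 else 0 := by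
  rcases T.eq_empty_or_nonempty with rfl | ⟨e, he⟩
  · have h1 : (monomial p ∅ : (ι → Bool) → ℝ) = fun _ => 1 := by ext; simp [monomial]
    rw [h1, bitExp_const, if_pos rfl]
  · rw [if_neg (Finset.ne_empty_of_mem he)]
    have h1 : monomial p T = fun g => bit p (g e) * monomial p (T.erase e) g := by
      ext g; rw [monomial, ← Finset.mul_prod_erase T _ he, monomial]
    rw [h1, bitExp_mul_of_update e (bit p) _ fun g b =>
      monomial_update_of_notMem p (by simp) g b, sum_bitWeight_mul_bit hp, zero_mul]

lemma bitExp_weight {p : ℝ} (hp : 0 < p) (hm : 1 ≤ m) (hmn : m ≤ n) (i : Fin n)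
    (A₀ B₀ : Finset (Fin n)) :
    bitExp p (fun g => weight m p i (A₀, B₀, g)) =
      av m i (coefTerm (p⁻¹ - 1) (A₀ ×ˢ B₀) ∅) := by
  simp only [weight_eq_sum_monomial hm hmn]
  rw [bitExp_sum]
  simp only [bitExp_const_mul, bitExp_monomial hp]
  simp

lemma avPerm_mul_left (A : Finset (Fin n)) (θ : Equiv.Perm (Fin n))
    (F : Equiv.Perm (Fin n) → Equiv.Perm (Fin n) → ℝ) :
    avPerm A (fun σ τ => F (θ * σ) (θ * τ)) = avPerm A F := by
  refine Fintype.expect_equiv (Equiv.mulLeft θ) _ _ fun ρ => ?_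
  simp [mul_assoc]

lemma edges_mul (A : Finset (Fin n)) (θ σ : Equiv.Perm (Fin n)) :
    edges A (θ * σ) = (edges A σ).map (Equiv.prodCongr (Equiv.refl _) θ).toEmbedding := by
  rw [edges, edges, Finset.map_eq_image, Finset.image_image]
  rfl

/-- One relabelling of the columns moves both matchings and the planted rectangle, so all
intersection sizes are preserved. -/
lemma excess_mul (A₀ B₀ A : Finset (Fin n)) (θ σ τ : Equiv.Perm (Fin n)) :
    excess (A₀ ×ˢ B₀.map θ.toEmbedding) (A, θ * σ, θ * τ) = excess (A₀ ×ˢ B₀) (A, σ, τ) := by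
  have hP : A₀ ×ˢ B₀.map θ.toEmbedding =
      (A₀ ×ˢ B₀).map (Equiv.prodCongr (Equiv.refl _) θ).toEmbedding := by
    ext ⟨x, y⟩
    simp only [Finset.mem_product, Finset.mem_map_equiv]
    rfl
  simp only [excess, overlap, edgesUnion, edgesL, edgesR, edges_mul, hP, ← Finset.map_union,
    ← Finset.map_inter, Finset.card_map]

/-- The mean weight of a vertex only depends on the size of the right planted set. -/
lemma av_coefTerm_empty_eq {a : ℝ} {i : Fin n} (A₀ : Finset (Fin n)) {B₀ B₁ : Finset (Fin n)}
    (h : B₀.card = B₁.card) :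
    av m i (coefTerm a (A₀ ×ˢ B₀) ∅) = av m i (coefTerm a (A₀ ×ˢ B₁) ∅) := by
  obtain ⟨θ, rfl⟩ : ∃ θ : Equiv.Perm (Fin n), B₁ = B₀.map θ.toEmbedding := by
    let e : {x // x ∈ B₀} ≃ {x // x ∈ B₁} := Fintype.equivOfCardEq (by simpa using h)
    refine ⟨e.extendSubtype, (Finset.eq_of_subset_of_card_le (fun y hy => ?_)
      (by rw [Finset.card_map, h])).symm⟩
    obtain ⟨x, hx, rfl⟩ := Finset.mem_map.1 hy
    exact Equiv.extendSubtype_mem e x hx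
  refine Finset.expect_congr rfl fun A _ => ?_
  rw [← avPerm_mul_left A θ (fun σ τ => coefTerm a (A₀ ×ˢ B₀.map θ.toEmbedding) ∅ (A, σ, τ))]
  congr 1; ext σ τ
  rw [coefTerm, coefTerm, excess_mul]
  simp

/-- The two matchings contribute equally by the exchange symmetry, whence the factor two. -/
lemma av_linTerm_singleton {a : ℝ} {i : Fin n} (P : Finset (Fin n × Fin n)) (e : Fin n × Fin n) :
    av m i (linTerm a P {e}) =
      if e ∈ P then 0 else 2 * expSum a m * (rowProb m i e.1 / n) := by
  by_cases he : e ∈ P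
  · have : linTerm a P {e} = fun _ : Config n => 0 := by
      ext c; simp [linTerm, he]
    rw [this, if_pos he]; simp [av, avPerm_const]
  · have h1 := av_pow_card_overlap_mul_mem (m := m) (i := i) e (1 + a)
    have h2 := av_swap (m := m) (i := i)
      (fun c => (1 + a) ^ (edgesL c ∩ edgesR c).card * if e ∈ edgesL c then 1 else 0)
    rw [h1] at h2
    have h3 : linTerm a P {e} = fun c : Config n =>
        ((1 + a) ^ (edgesL c ∩ edgesR c).card * if e ∈ edgesL c then 1 else 0) +
        (1 + a) ^ (edgesL (c.1, c.2.2, c.2.1) ∩ edgesR (c.1, c.2.2, c.2.1)).card *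
          if e ∈ edgesL (c.1, c.2.2, c.2.1) then 1 else 0 := by
      ext c
      have h4 : edgesL (c.1, c.2.2, c.2.1) = edgesR c := rfl
      have h5 : edgesR (c.1, c.2.2, c.2.1) = edgesL c := rfl
      rw [h4, h5, Finset.inter_comm (edgesR c)]
      simp [linTerm, he, overlap, mul_add]
    rw [h3, av_add, h1, h2, if_neg he, add_sub_cancel_left]
    ring

end

/-! ### Integration under the conditioned law -/

lemma uniformOn_card_singleton {n K : ℕ} (B : Finset (Fin n)) :
    uniformOn {A : Finset (Fin n) | A.card = K} {B} =
      if B.card = K then ((n.choose K : ℕ) : ENNReal)⁻¹ else 0 := by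
  have h1 : {A : Finset (Fin n) | A.card = K} =
      ((Finset.powersetCard K (Finset.univ : Finset (Fin n)) : Finset (Finset (Fin n))) :
        Set (Finset (Fin n))) := by
    ext A; simp [Finset.mem_powersetCard]
  have h2 : ({B} : Set (Finset (Fin n))) = (({B} : Finset (Finset (Fin n))) : Set _) := by simp
  rw [h1, h2, uniformOn_apply_finset, Finset.card_powersetCard, Finset.card_univ, Fintype.card_fin]
  by_cases h : B.card = K
  · rw [Finset.inter_singleton_of_mem (by simp [Finset.mem_powersetCard, h])]
    simp [h]
  · rw [Finset.inter_singleton_of_notMem (by simp [Finset.mem_powersetCard, h])]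
    simp [h]

lemma isProbabilityMeasure_uniformOn_card {n K : ℕ} (hK : K ≤ n) :
    IsProbabilityMeasure (uniformOn {A : Finset (Fin n) | A.card = K}) := by
  refine isProbabilityMeasure_uniformOn (Set.toFinite _) ?_
  obtain ⟨A, -, hA⟩ := Finset.exists_subset_card_eq (s := (Finset.univ : Finset (Fin n))) (n := K)
    (by simpa using hK)
  exact ⟨A, hA⟩

lemma bernoulliMeasure_singleton (p : unitInterval) (b : Bool) :
    (bernoulliMeasure true false p) {b} = ENNReal.ofReal (bitWeight p b) := by
  classical
  rw [bernoulliMeasure_apply p (measurableSet_singleton b)]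
  cases b
  · simp only [Set.mem_singleton_iff, bitWeight]
    simp [ENNReal.ofReal, Real.toNNReal, unitInterval.toNNReal, p.2.2]
    rfl
  · simp only [Set.mem_singleton_iff, bitWeight]
    simp [ENNReal.ofReal, Real.toNNReal, unitInterval.toNNReal, p.2.1]
    rfl

/-- The probability of the conditioning event cancels the mass of the left planted set, leaving the
product law of the right set and the bits. -/
lemma lawGiven_singleton {n K : ℕ} (hK : K ≤ n) (p : unitInterval) {A : Finset (Fin n)}
    (hA : A.card = K) (ω : Outcome n) :
    lawGiven n K p A {ω} = if ω.1 = A ∧ ω.2.1.card = K then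
      ((n.choose K : ℕ) : ENNReal)⁻¹ * ∏ e, ENNReal.ofReal (bitWeight p (ω.2.2 e)) else 0 := by
  have := isProbabilityMeasure_uniformOn_card hK
  obtain ⟨A', B, g⟩ := ω
  set μ := uniformOn {A : Finset (Fin n) | A.card = K} with hμ
  set ν := Measure.pi fun _ : Fin n × Fin n => bernoulliMeasure true false p with hν
  have hS : MeasurableSet {ω : Outcome n | ω.1 = A} := (Set.toFinite _).measurableSet
  have hμA : μ {A} = ((n.choose K : ℕ) : ENNReal)⁻¹ := by
    rw [hμ, uniformOn_card_singleton, if_pos hA]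
  have hch : (n.choose K : ENNReal) ≠ 0 := by
    exact_mod_cast (Nat.choose_pos hK).ne'
  have hlawS : law n K p {ω | ω.1 = A} = ((n.choose K : ℕ) : ENNReal)⁻¹ := by
    have : {ω : Outcome n | ω.1 = A} = {A} ×ˢ Set.univ := by ext; simp
    rw [this, law, Measure.prod_prod, hμA]; simp
  rw [lawGiven, cond_apply hS, hlawS, inv_inv]
  by_cases hA' : A' = A
  · subst hA'
    have h1 : {ω : Outcome n | ω.1 = A'} ∩ {(A', B, g)} = {A'} ×ˢ ({B} ×ˢ {g}) := by
      ext ⟨a, b, c⟩; simp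
    rw [h1, law, Measure.prod_prod, Measure.prod_prod, hμA, ← mul_assoc,
      ENNReal.mul_inv_cancel hch (ENNReal.natCast_ne_top _), one_mul, Measure.pi_singleton,
      uniformOn_card_singleton]
    simp only [bernoulliMeasure_singleton, true_and]
    split_ifs <;> simp
  · have h1 : {ω : Outcome n | ω.1 = A} ∩ {(A', B, g)} = ∅ := by
      ext ⟨a, b, c⟩; simp; rintro rfl rfl; exact absurd rfl hA'
    rw [h1]; simp [hA']

/-- Integration with respect to the conditioned law, as an average over the right planted set and
over independent bits. -/
lemma integral_lawGiven {n K : ℕ} (hK : K ≤ n) (p : unitInterval) {A : Finset (Fin n)}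
    (hA : A.card = K) (F : Outcome n → ℝ) :
    ∫ ω, F ω ∂(lawGiven n K p A) =
      𝔼 B ∈ Finset.powersetCard K (Finset.univ : Finset (Fin n)),
        bitExp (p : ℝ) fun g => F (A, B, g) := by
  have hw : ∀ b, 0 ≤ bitWeight (p : ℝ) b := fun b => by
    unfold bitWeight; split_ifs
    · exact p.2.1
    · linarith [p.2.2]
  have hfin : IsFiniteMeasure (lawGiven n K p A) := by
    unfold lawGiven; infer_instance
  rw [integral_fintype .of_finite]
  have hreal : ∀ ω : Outcome n, (lawGiven n K p A).real {ω} = if ω.1 = A ∧ ω.2.1.card = K then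
      ((n.choose K : ℕ) : ℝ)⁻¹ * ∏ e, bitWeight p (ω.2.2 e) else 0 := by
    intro ω
    rw [measureReal_def, lawGiven_singleton hK p hA]
    split_ifs
    · rw [ENNReal.toReal_mul, ENNReal.toReal_inv, ENNReal.toReal_natCast, ENNReal.toReal_prod]
      simp only [ENNReal.toReal_ofReal (hw _)]
    · simp
  simp only [hreal, smul_eq_mul]
  rw [Fintype.sum_prod_type, Finset.sum_eq_single A]
  · rw [Fintype.sum_prod_type, Finset.expect_eq_sum_div_card, Finset.card_powersetCard,
      Finset.card_univ, Fintype.card_fin, Finset.sum_div, ← Finset.sum_subset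
      (Finset.subset_univ (Finset.powersetCard K (Finset.univ : Finset (Fin n))))]
    · refine Finset.sum_congr rfl fun B hB => ?_
      rw [bitExp, Finset.sum_div]
      refine Finset.sum_congr rfl fun g _ => ?_
      rw [if_pos ⟨rfl, (Finset.mem_powersetCard.1 hB).2⟩]
      ring
    · intro B _ hB
      have : B.card ≠ K := fun h => hB (by simp [Finset.mem_powersetCard, h])
      simp [this]
  · intro A' _ hA'
    simp [hA']
  · simp

/-! ### Discarding the remainder, and covariances of the linear part -/

/-- Replacing factors by small perturbations hardly changes the mean of a product. -/
lemma abs_bitExp_prod_add_sub_le {q : ℝ} (h0 : 0 < q) (h1 : q < 1) {ι : Type} [Fintype ι]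
    [DecidableEq ι] {l : ℕ} (y r : Fin l → (ι → Bool) → ℝ) {δ C : ℝ} (hδ0 : 0 < δ) (hδ1 : δ ≤ 1)
    (hy : ∀ j, bitExp q (fun g => y j g ^ (2 * (l + 2))) ≤ C)
    (hr : ∀ j, bitExp q (fun g => r j g ^ (2 * (l + 2))) ≤ (δ ^ 2) ^ (l + 2)) :
    |bitExp q (fun g => ∏ j, (y j g + r j g)) - bitExp q (fun g => ∏ j, y j g)| ≤
      2 ^ l * (1 + l * (C + 1)) * δ := by
  set N := 2 * (l + 2) with hN
  let M : (ι → Bool) → ℝ := fun g => 1 + ∑ j, (y j g ^ N + (δ⁻¹ * r j g) ^ N)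
  have hev : ∀ x : ℝ, 0 ≤ x ^ N := fun x => (even_two_mul (l + 2)).pow_nonneg x
  have hM0 : ∀ g, 0 ≤ M g := fun g =>
    add_nonneg zero_le_one (Finset.sum_nonneg fun j _ => add_nonneg (hev _) (hev _))
  have hpt : ∀ g, |∏ j, (y j g + r j g) - ∏ j, y j g| ≤ 2 ^ l * δ * M g := by
    intro g
    have e1 : ∏ j, (y j g + r j g) = ∑ J ∈ (Finset.univ : Finset (Fin l)).powerset,
        (∏ j ∈ J, r j g) * ∏ j ∈ Finset.univ \ J, y j g := by
      rw [← Finset.prod_add]; exact Finset.prod_congr rfl fun j _ => add_comm _ _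
    rw [e1, ← Finset.add_sum_erase _ _ (Finset.empty_mem_powerset _)]
    simp only [Finset.prod_empty, Finset.sdiff_empty, one_mul, add_sub_cancel_left]
    refine (Finset.abs_sum_le_sum_abs _ _).trans ?_
    have hterm : ∀ J ∈ (Finset.univ : Finset (Fin l)).powerset.erase ∅,
        |(∏ j ∈ J, r j g) * ∏ j ∈ Finset.univ \ J, y j g| ≤ δ * M g := by
      intro J hJ
      have hJne : J.card ≠ 0 := by
        rw [Finset.card_ne_zero]; exact Finset.nonempty_iff_ne_empty.2 (Finset.mem_erase.1 hJ).1
      -- Rescaled by `δ⁻¹`, the perturbations have moments of order `2 * (l + 2)` at most one, and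
      -- each perturbed factor of a term releases one power of `δ`.
      let z : Fin l → ℝ := fun j => if j ∈ J then δ⁻¹ * r j g else y j g
      have e2 : |(∏ j ∈ J, r j g) * ∏ j ∈ Finset.univ \ J, y j g| = δ ^ J.card * ∏ j, |z j| := by
        rw [abs_mul, Finset.abs_prod, Finset.abs_prod,
          ← Finset.prod_sdiff (Finset.subset_univ J), ← mul_assoc, mul_comm (δ ^ J.card), mul_assoc,
          mul_comm]
        congr 1
        · refine Finset.prod_congr rfl fun j hj => ?_
          simp only [z, if_neg (Finset.mem_sdiff.1 hj).2]
        · rw [← Finset.prod_const, ← Finset.prod_mul_distrib]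
          refine Finset.prod_congr rfl fun j hj => ?_
          simp only [z, if_pos hj, abs_mul, abs_inv, abs_of_pos hδ0]
          field_simp
      rw [e2]
      have h2 : ∏ j, |z j| ≤ M g := by
        refine (prod_abs_le_one_add (k := l + 2) Finset.univ z (by simp; omega)).trans ?_
        refine add_le_add le_rfl (Finset.sum_le_sum fun j _ => ?_)
        have := hev (y j g)
        have := hev (δ⁻¹ * r j g)
        simp only [z]
        split_ifs <;> linarith
      refine mul_le_mul ?_ h2 (Finset.prod_nonneg fun _ _ => abs_nonneg _) hδ0.le
      exact pow_le_of_le_one hδ0.le hδ1 hJne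
    refine (Finset.sum_le_card_nsmul _ _ _ hterm).trans ?_
    rw [nsmul_eq_mul, mul_assoc]
    refine mul_le_mul_of_nonneg_right ?_ (mul_nonneg hδ0.le (hM0 g))
    have h2 : ((Finset.univ : Finset (Fin l)).powerset.erase ∅).card ≤ 2 ^ l := by
      refine (Finset.card_le_card (Finset.erase_subset _ _)).trans ?_
      rw [Finset.card_powerset, Finset.card_univ, Fintype.card_fin]
    exact_mod_cast h2
  rw [← bitExp_sub]
  refine (abs_bitExp_le h0 h1 _).trans ((bitExp_mono h0 h1 hpt).trans ?_)
  rw [bitExp_const_mul]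
  have hEM : bitExp q M ≤ 1 + l * (C + 1) := by
    simp only [M]
    rw [bitExp_add, bitExp_const, bitExp_sum]
    gcongr
    calc _ ≤ ∑ j : Fin l, (C + 1) := by
          refine Finset.sum_le_sum fun j _ => ?_
          rw [bitExp_add]
          refine add_le_add (hy j) ?_
          simp only [mul_pow]
          rw [bitExp_const_mul]
          calc δ⁻¹ ^ N * bitExp q (fun g => r j g ^ N) ≤ δ⁻¹ ^ N * (δ ^ 2) ^ (l + 2) :=
                mul_le_mul_of_nonneg_left (hr j) (by positivity)
            _ = 1 := by
                rw [hN, ← pow_mul, ← mul_pow, inv_mul_cancel₀ hδ0.ne', one_pow]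
      _ = l * (C + 1) := by
          rw [Finset.sum_const, Finset.card_univ, Fintype.card_fin, nsmul_eq_mul]
  calc 2 ^ l * δ * bitExp q M ≤ 2 ^ l * δ * (1 + l * (C + 1)) := by gcongr
    _ = _ := by ring

section
variable {n m K : ℕ}

/-- The centred weight splits into its linear part and a remainder. -/
lemma centeredWeight_eq (p : unitInterval) (hp : 0 < (p : ℝ)) (hm : 1 ≤ m) (hmn : m ≤ n)
    (hK : K ≤ n) {A B : Finset (Fin n)} (hA : A.card = K) (hB : B.card = K) (i : Fin n)
    (g : Fin n × Fin n → Bool) :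
    centeredWeight K m p A i (A, B, g) =
      linForm (p : ℝ) (fun e => av m i (linTerm ((p : ℝ)⁻¹ - 1) (A ×ˢ B) {e})) g +
      ∑ T, av m i (remTerm ((p : ℝ)⁻¹ - 1) (A ×ˢ B) T) * monomial (p : ℝ) T g := by
  set a := (p : ℝ)⁻¹ - 1 with ha
  -- The mean given the right planted set is the same for all sets of size `K`; hence subtracting
  -- the overall mean removes exactly the constant coefficient for this `B`.
  have hmean : ∫ ω', weight m p i ω' ∂(lawGiven n K p A) = av m i (coefTerm a (A ×ˢ B) ∅) := by
    rw [integral_lawGiven hK p hA]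
    have : ∀ B' ∈ Finset.powersetCard K (Finset.univ : Finset (Fin n)),
        bitExp (p : ℝ) (fun g => weight m p i (A, B', g)) = av m i (coefTerm a (A ×ˢ B) ∅) := by
      intro B' hB'
      rw [bitExp_weight hp hm hmn]
      exact av_coefTerm_empty_eq A ((Finset.mem_powersetCard.1 hB').2.trans hB.symm)
    rw [Finset.expect_congr rfl this]
    exact Finset.expect_const ⟨B, by simp [Finset.mem_powersetCard, hB]⟩ _
  have hlin : linForm (p : ℝ) (fun e => av m i (linTerm a (A ×ˢ B) {e})) g =
      ∑ T, av m i (linTerm a (A ×ˢ B) T) * monomial (p : ℝ) T g := by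
    have : ∀ T, av m i (linTerm a (A ×ˢ B) T) * monomial (p : ℝ) T g =
        if T.card = 1 then av m i (linTerm a (A ×ˢ B) T) * monomial (p : ℝ) T g else 0 := by
      intro T
      split_ifs with h
      · rfl
      · have : linTerm a (A ×ˢ B) T = fun _ : Config n => 0 := by ext c; simp [linTerm, h]
        rw [this, av_const hm hmn, zero_mul]
    rw [Finset.sum_congr rfl fun T _ => this T, sum_card_eq_one
      (fun T => av m i (linTerm a (A ×ˢ B) T) * monomial (p : ℝ) T g)]
    simp [linForm, monomial]
  rw [centeredWeight, hmean, hlin, ← Finset.sum_add_distrib, weight_eq_sum_monomial hm hmn,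
    ← Finset.add_sum_erase _ _ (Finset.mem_univ ∅),
    ← Finset.add_sum_erase _ (fun T => av m i (linTerm a (A ×ˢ B) T) * monomial (p : ℝ) T g +
      av m i (remTerm a (A ×ˢ B) T) * monomial (p : ℝ) T g) (Finset.mem_univ ∅)]
  have h0 : linTerm a (A ×ˢ B) ∅ = fun _ : Config n => 0 := by ext c; simp [linTerm]
  have h0' : remTerm a (A ×ˢ B) ∅ = fun _ : Config n => 0 := by ext c; simp [remTerm]
  have hmono : monomial (p : ℝ) ∅ g = 1 := by simp [monomial]
  rw [h0, h0', av_const hm hmn, hmono, ← ha]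
  have : ∀ T ∈ Finset.univ.erase ∅, av m i (coefTerm a (A ×ˢ B) T) * monomial (p : ℝ) T g =
      av m i (linTerm a (A ×ˢ B) T) * monomial (p : ℝ) T g +
      av m i (remTerm a (A ×ˢ B) T) * monomial (p : ℝ) T g := by
    intro T hT
    have h2 : remTerm a (A ×ˢ B) T = fun c : Config n =>
        coefTerm a (A ×ˢ B) T c - linTerm a (A ×ˢ B) T c := by
      ext c; rw [remTerm, if_neg (Finset.mem_erase.1 hT).1]
    rw [h2, av_sub]; ring
  rw [Finset.sum_congr rfl this]; ring

lemma rowProb_eq (hm : 2 ≤ m) (hmn : m ≤ n) (i r : Fin n) :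
    rowProb m i r = ((m : ℝ) - 1) / ((n : ℝ) - 1) +
      (1 - ((m : ℝ) - 1) / ((n : ℝ) - 1)) * if r = i then 1 else 0 := by
  by_cases h : r = i
  · subst h; rw [rowProb_self (by omega) hmn]; simp
  · rw [rowProb_of_ne hm hmn h]; simp [h]

lemma sum_rowProb_mul (hm : 2 ≤ m) (hmn : m ≤ n) (i i' : Fin n) {μ : ℝ}
    (hμ : μ = ((m : ℝ) - 1) / ((n : ℝ) - 1)) :
    ∑ r, rowProb m i r * rowProb m i' r =
      n * μ ^ 2 + 2 * μ * (1 - μ) + (1 - μ) ^ 2 * if i = i' then 1 else 0 := by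
  have e : ∀ r, rowProb m i r * rowProb m i' r = μ ^ 2 + μ * (1 - μ) * (if r = i then 1 else 0) +
      μ * (1 - μ) * (if r = i' then 1 else 0) +
      (1 - μ) ^ 2 * (if r = i then if i = i' then 1 else 0 else 0) := by
    intro r
    rw [rowProb_eq hm hmn, rowProb_eq hm hmn, ← hμ]
    by_cases h : r = i
    · subst h; by_cases h' : r = i' <;> simp [h'] <;> ring
    · by_cases h' : r = i'
      · have hne : i' ≠ i := fun hh => h (h'.trans hh)
        simp [h', hne]; ring
      · simp [h, h']; ring
  simp only [e, Finset.sum_add_distrib, ← Finset.mul_sum, Finset.sum_const, Finset.card_univ,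
    Fintype.card_fin, nsmul_eq_mul, Finset.sum_ite_eq', Finset.mem_univ, if_true]
  ring

/-- With `μ = (m - 1) / (n - 1)` and `ν = m / n`, the sum has an exact quadratic expression in `μ`.
All its deviations from the target are bounded by multiples of `ν`, because `n * (ν - μ) ≤ 1`, and
`ν` is of order `s ^ (-2)`. -/
lemma abs_sum_rowProb_mul_sub_le {κ s : ℝ} (h : SquareRootScale κ n m K s) (i i' : Fin n) :
    |∑ r, rowProb m i r * rowProb m i' r - ((if i = i' then 1 else 0) + (m : ℝ) ^ 2 / n)| ≤
      7 * κ / s ^ 2 := by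
  have hm3 : (3 : ℝ) ≤ m := by exact_mod_cast h.three_le_m
  have hmn : (2 * m : ℝ) ≤ n := by exact_mod_cast h.two_mul_m_le
  have hmn' : m ≤ n := by have := h.two_mul_m_le; omega
  have hm2 : 2 ≤ m := by have := h.three_le_m; omega
  have hs0 : 0 < s := by linarith [h.one_le_s]
  obtain ⟨μ, hμ⟩ : ∃ μ, μ = ((m : ℝ) - 1) / ((n : ℝ) - 1) := ⟨_, rfl⟩
  obtain ⟨ν, hν⟩ : ∃ ν, ν = (m : ℝ) / n := ⟨_, rfl⟩
  rw [sum_rowProb_mul hm2 hmn' i i' hμ]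
  have hn0 : (0 : ℝ) < n := by linarith
  have hn1 : (0 : ℝ) < (n : ℝ) - 1 := by linarith
  have hμ0 : 0 ≤ μ := by rw [hμ]; exact div_nonneg (by linarith) hn1.le
  have hμν : μ ≤ ν := by
    rw [hμ, hν, div_le_div_iff₀ hn1 hn0]; nlinarith
  have hν1 : ν ≤ 1 := by rw [hν, div_le_one hn0]; linarith
  have hνκ : ν ≤ κ / s ^ 2 := by
    rw [hν, div_le_div_iff₀ hn0 (by positivity), ← h.s_pow]
    have := mul_le_mul_of_nonneg_right h.m_le (by positivity : 0 ≤ s ^ 2)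
    nlinarith
  have e1 : μ * ((n : ℝ) - 1) = m - 1 := by rw [hμ]; field_simp
  have e2 : (m : ℝ) ^ 2 / n = m * ν := by rw [hν]; ring
  have e3 : ν * n = m := by rw [hν]; field_simp
  have hd : (n : ℝ) * (ν - μ) ≤ 1 := by
    have : (n : ℝ) * (ν - μ) = 1 - μ := by linear_combination e3 - e1
    linarith
  have hmd : (m : ℝ) * (ν - μ) ≤ ν := by
    have : (m : ℝ) * (ν - μ) = ν * (n * (ν - μ)) := by linear_combination (μ - ν) * e3
    rw [this]
    exact mul_le_of_le_one_right (hμ0.trans hμν) hd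
  have hmd0 : 0 ≤ (m : ℝ) * (ν - μ) := mul_nonneg (by linarith) (by linarith)
  rw [e2]
  have e4 : (n : ℝ) * μ ^ 2 = (m - 1) * μ + μ ^ 2 := by linear_combination μ * e1
  rw [e4]
  have hμsq : μ ^ 2 ≤ μ := by nlinarith
  have hfin : 7 * ν ≤ 7 * κ / s ^ 2 := by rw [mul_div_assoc]; linarith
  refine le_trans ?_ hfin
  rw [abs_le]
  split_ifs <;> constructor <;> nlinarith

lemma sum_rowProb_mul_le {κ s : ℝ} (h : SquareRootScale κ n m K s) (i i' : Fin n) :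
    ∑ r, rowProb m i r * rowProb m i' r ≤ 1 + κ ^ 2 + 7 * κ := by
  have hs1 := h.one_le_s
  have hs0 : 0 < s := by linarith
  have hb := (abs_le.1 (abs_sum_rowProb_mul_sub_le h i i')).2
  have h1 : (m : ℝ) ^ 2 / n ≤ κ ^ 2 := by
    rw [← h.s_pow, div_le_iff₀ (by positivity)]
    have := pow_le_pow_left₀ (Nat.cast_nonneg m) h.m_le 2
    nlinarith
  have h2 : 7 * κ / s ^ 2 ≤ 7 * κ := div_le_self (by linarith [h.one_le_κ]) (one_le_pow₀ hs1)
  have h3 : (if i = i' then (1 : ℝ) else 0) ≤ 1 := by split_ifs <;> norm_num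
  linarith

lemma rowProb_nonneg (i r : Fin n) : 0 ≤ rowProb m i r :=
  Finset.expect_nonneg fun _ _ => by split_ifs <;> norm_num

lemma rowProb_le_one (hm : 1 ≤ m) (hmn : m ≤ n) (i r : Fin n) : rowProb m i r ≤ 1 :=
  Finset.expect_le (rootedSets_nonempty hm hmn i) fun _ _ => by split_ifs <;> norm_num

/-- The coefficients of the linear part, scaled by `√n`. -/
def linCoef (a : ℝ) (m : ℕ) (P : Finset (Fin n × Fin n)) (i : Fin n) (e : Fin n × Fin n) : ℝ :=
  √(n : ℝ) * av m i (linTerm a P {e})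

lemma sqrt_eq_sq {κ s : ℝ} (h : SquareRootScale κ n m K s) : √(n : ℝ) = s ^ 2 := by
  rw [← h.s_pow, show s ^ 4 = (s ^ 2) ^ 2 by ring, Real.sqrt_sq (by positivity)]

lemma linCoef_eq {κ s a : ℝ} (h : SquareRootScale κ n m K s) (P : Finset (Fin n × Fin n))
    (i : Fin n) (e : Fin n × Fin n) :
    linCoef a m P i e = if e ∈ P then 0 else 2 * expSum a m / s ^ 2 * rowProb m i e.1 := by
  have hs0 : 0 < s := by linarith [h.one_le_s]
  rw [linCoef, av_linTerm_singleton, sqrt_eq_sq h, ← h.s_pow]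
  split_ifs
  · simp
  · field_simp

lemma abs_linCoef_le {κ s a : ℝ} (ha : 0 ≤ a) (h : SquareRootScale κ n m K s)
    (P : Finset (Fin n × Fin n)) (i : Fin n) (e : Fin n × Fin n) :
    |linCoef a m P i e| ≤ 2 * Real.exp a / s ^ 2 := by
  have hs0 : 0 < s := by linarith [h.one_le_s]
  have hm1 : 1 ≤ m := by have := h.three_le_m; omega
  have hmn : m ≤ n := by have := h.two_mul_m_le; omega
  have hg0 := expSum_nonneg ha m
  have hg := expSum_le_exp ha m
  have hr0 := rowProb_nonneg (m := m) i e.1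
  have hr := rowProb_le_one hm1 hmn i e.1
  rw [linCoef_eq h]
  split_ifs
  · rw [abs_zero]; positivity
  · rw [abs_of_nonneg (by positivity)]
    calc 2 * expSum a m / s ^ 2 * rowProb m i e.1 ≤ 2 * Real.exp a / s ^ 2 * 1 := by gcongr
      _ = _ := mul_one _

/-- Off the planted rectangle the coefficients depend on the row only, so the sum over columns
counts `n` for each row, less `K` for the rows of `A`. -/
lemma sum_linCoef_mul {κ s a : ℝ} (h : SquareRootScale κ n m K s) (A B : Finset (Fin n))
    (hB : B.card = K) (i i' : Fin n) :
    ∑ e, linCoef a m (A ×ˢ B) i e * linCoef a m (A ×ˢ B) i' e =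
      4 * expSum a m ^ 2 * (∑ r, rowProb m i r * rowProb m i' r -
        K / n * ∑ r ∈ A, rowProb m i r * rowProb m i' r) := by
  have hs0 : 0 < s := by linarith [h.one_le_s]
  have e1 : ∀ e : Fin n × Fin n, linCoef a m (A ×ˢ B) i e * linCoef a m (A ×ˢ B) i' e =
      4 * expSum a m ^ 2 / n * (rowProb m i e.1 * rowProb m i' e.1) -
      if e ∈ A ×ˢ B then 4 * expSum a m ^ 2 / n * (rowProb m i e.1 * rowProb m i' e.1) else 0 := by
    intro e
    rw [linCoef_eq h, linCoef_eq h, ← h.s_pow]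
    split_ifs
    · simp
    · field_simp; ring
  simp only [e1]
  rw [Finset.sum_sub_distrib, Finset.sum_ite_mem, Finset.univ_inter, ← Finset.mul_sum,
    ← Finset.mul_sum, Finset.sum_product, Fintype.sum_prod_type]
  simp only [Finset.sum_const, Finset.card_univ, Fintype.card_fin, nsmul_eq_mul, hB,
    ← Finset.mul_sum]
  have hn0 : (n : ℝ) ≠ 0 := by rw [← h.s_pow]; positivity
  field_simp

lemma sum_linCoef_sq_le {κ s a : ℝ} (ha : 0 ≤ a) (h : SquareRootScale κ n m K s)
    (A B : Finset (Fin n)) (hB : B.card = K) (i : Fin n) :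
    ∑ e, linCoef a m (A ×ˢ B) i e ^ 2 ≤ 4 * Real.exp a ^ 2 * (1 + κ ^ 2 + 7 * κ) := by
  simp only [sq (linCoef a m (A ×ˢ B) i _)]
  rw [sum_linCoef_mul h A B hB]
  have hg0 := expSum_nonneg ha m
  have hg := expSum_le_exp ha m
  have h1 := sum_rowProb_mul_le h i i
  have h2 : 0 ≤ (K : ℝ) / n * ∑ r ∈ A, rowProb m i r * rowProb m i r :=
    mul_nonneg (by positivity) (Finset.sum_nonneg fun r _ => mul_self_nonneg _)
  have h3 : 0 ≤ 1 + κ ^ 2 + 7 * κ := by nlinarith [h.one_le_κ]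
  calc _ ≤ 4 * expSum a m ^ 2 * (1 + κ ^ 2 + 7 * κ) := by gcongr; linarith
    _ ≤ _ := by gcongr

/-- There are three sources of error: the approximate row overlaps, the deleted planted rectangle,
and the truncation of the exponential series. -/
lemma abs_sum_linCoef_mul_sub_covar_le {κ s p : ℝ} (hp : 0 < p) (hp1 : p < 1)
    (h : SquareRootScale κ n m K s) (A B : Finset (Fin n)) (hB : B.card = K) (i i' : Fin n) :
    |(p⁻¹ - 1) * ∑ e, linCoef (p⁻¹ - 1) m (A ×ˢ B) i e * linCoef (p⁻¹ - 1) m (A ×ˢ B) i' e -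
      covar m p i i'| ≤
      4 * (p⁻¹ - 1) * (Real.exp (p⁻¹ - 1) ^ 2 * (7 * κ + κ * (1 + κ ^ 2 + 7 * κ)) / s ^ 2 +
        2 * Real.exp (p⁻¹ - 1) * (1 + κ ^ 2) * (Real.exp (p⁻¹ - 1) - expSum (p⁻¹ - 1) m)) := by
  have ha : 0 ≤ p⁻¹ - 1 := by linarith [(one_le_inv₀ hp).2 hp1.le]
  rw [sum_linCoef_mul h A B hB, covar]
  set a := p⁻¹ - 1
  have hs1 := h.one_le_s
  have hs0 : 0 < s := by linarith
  have hκ0 : 0 ≤ κ := by linarith [h.one_le_κ]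
  have hg0 := expSum_nonneg ha m
  have hg := expSum_le_exp ha m
  have hexp : Real.exp (2 * a) = Real.exp a ^ 2 := by rw [← Real.exp_nat_mul]; norm_num
  rw [hexp]
  set E := Real.exp a
  set γ := expSum a m
  set Tot := ∑ r, rowProb m i r * rowProb m i' r with hT
  set Q := ∑ r ∈ A, rowProb m i r * rowProb m i' r with hQ
  set V := (if i = i' then (1 : ℝ) else 0) + (m : ℝ) ^ 2 / n with hV
  have hnn : ∀ r, 0 ≤ rowProb m i r * rowProb m i' r := fun r =>
    mul_nonneg (rowProb_nonneg _ _) (rowProb_nonneg _ _)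
  have hQ0 : 0 ≤ Q := Finset.sum_nonneg fun r _ => hnn r
  have hQT : Q ≤ Tot := Finset.sum_le_univ_sum_of_nonneg hnn
  have hTb : Tot ≤ 1 + κ ^ 2 + 7 * κ := sum_rowProb_mul_le h i i'
  have hTV : |Tot - V| ≤ 7 * κ / s ^ 2 := abs_sum_rowProb_mul_sub_le h i i'
  have hKn : (K : ℝ) / n ≤ κ / s ^ 2 := by
    rw [← h.s_pow, div_le_div_iff₀ (by positivity) (by positivity)]
    have := mul_le_mul_of_nonneg_right h.K_le (by positivity : 0 ≤ s ^ 2)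
    nlinarith
  have hV0 : 0 ≤ V := by rw [hV]; split_ifs <;> positivity
  have hVb : V ≤ 1 + κ ^ 2 := by
    have h1 : (m : ℝ) ^ 2 / n ≤ κ ^ 2 := by
      rw [← h.s_pow, div_le_iff₀ (by positivity)]
      have := pow_le_pow_left₀ (Nat.cast_nonneg m) h.m_le 2
      nlinarith
    rw [hV]; split_ifs <;> linarith
  have hE0 : 0 ≤ E := (Real.exp_pos a).le
  have hsplit : a * (4 * γ ^ 2 * (Tot - K / n * Q)) - 4 * a * E ^ 2 * V =
      4 * a * (γ ^ 2 * (Tot - V) - γ ^ 2 * (K / n * Q) - (E ^ 2 - γ ^ 2) * V) := by ring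
  rw [hsplit, abs_mul, abs_of_nonneg (by positivity : 0 ≤ 4 * a)]
  refine mul_le_mul_of_nonneg_left ?_ (by positivity)
  have t1 : |γ ^ 2 * (Tot - V)| ≤ E ^ 2 * (7 * κ / s ^ 2) := by
    rw [abs_mul, abs_of_nonneg (by positivity : 0 ≤ γ ^ 2)]
    gcongr
  have t2 : |γ ^ 2 * (K / n * Q)| ≤ E ^ 2 * (κ / s ^ 2 * (1 + κ ^ 2 + 7 * κ)) := by
    rw [abs_of_nonneg (by positivity)]
    gcongr
    exact hQT.trans hTb
  have t3 : |(E ^ 2 - γ ^ 2) * V| ≤ 2 * E * (E - γ) * (1 + κ ^ 2) := by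
    have e1 : E ^ 2 - γ ^ 2 = (E + γ) * (E - γ) := by ring
    have e2 : 0 ≤ E - γ := by linarith
    rw [e1, abs_of_nonneg (by positivity)]
    gcongr
    linarith
  calc _ ≤ |γ ^ 2 * (Tot - V)| + |γ ^ 2 * (K / n * Q)| + |(E ^ 2 - γ ^ 2) * V| :=
        (abs_sub _ _).trans (add_le_add (abs_sub _ _) le_rfl)
    _ ≤ _ := add_le_add (add_le_add t1 t2) t3
    _ = _ := by ring

end

/-! ### Assembly and passage to the limit -/

/-- Quantitative form of the limit theorem: at scale `√n = s ^ 2` the scaled joint moments agree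
with Wick's sum up to `O(s ^ (-1 / 2))` and the error in the exponential series. -/
theorem exists_abs_jointMoment_sub_wickSum_le (p : unitInterval) (hp0 : 0 < (p : ℝ))
    (hp1 : (p : ℝ) < 1) (l : ℕ) {κ : ℝ} (hκ : 0 ≤ κ) :
    ∃ C₁ C₂ : ℝ, 0 ≤ C₁ ∧ 0 ≤ C₂ ∧ ∀ {n m K : ℕ} {s t : ℝ}, SquareRootScale κ n m K s → 0 ≤ t →
      C₁ * t ≤ 1 → 1 / s ≤ t ^ 2 →
      Real.exp ((p : ℝ)⁻¹ - 1) - expSum ((p : ℝ)⁻¹ - 1) m ≤ t →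
      ∀ A : Finset (Fin n), A.card = K → ∀ i : Fin l → Fin n,
        |jointMoment K m p A i - wickSum m (p : ℝ) i| ≤ C₂ * t := by
  set q : ℝ := (p : ℝ)
  have ha : 0 ≤ q⁻¹ - 1 := by linarith [(one_le_inv₀ hp0).2 hp1.le]
  obtain ⟨a, haq⟩ : ∃ a, a = q⁻¹ - 1 := ⟨_, rfl⟩
  rw [← haq] at ha ⊢
  set D := hyperConst q⁻¹ l
  have hD0 : 0 ≤ D := hyperConst_nonneg _ _
  obtain ⟨Cr, hCr0, hCr⟩ := exists_sum_sq_av_remTerm_le (κ := κ) ha hD0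
  set E := Real.exp a
  have hE0 : 0 ≤ E := (Real.exp_pos a).le
  set S := 4 * E ^ 2 * (1 + κ ^ 2 + 7 * κ)
  have hS0 : 0 ≤ S := by positivity
  obtain ⟨Cl, hCl0, hCl⟩ := exists_abs_moment_sub_pairSum_le hp0 hp1 l hS0
  set X := 4 * a * (E ^ 2 * (7 * κ + κ * (1 + κ ^ 2 + 7 * κ)) + 2 * E * (1 + κ ^ 2))
  have hX0 : 0 ≤ X := by positivity
  -- A single `δ = C₁ * t` has to dominate the size of the remainder (`Cr`), the largest linear
  -- coefficient (`2 * E`) and the covariance error (`X`). The summand `1` ensures `Cr ≤ C₁ ^ 2` and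
  -- `t ≤ δ`.
  obtain ⟨C₁, hC₁⟩ : ∃ C₁, C₁ = 1 + Cr + 2 * E + X := ⟨_, rfl⟩
  have hC₁1 : 1 ≤ C₁ := by rw [hC₁]; linarith
  set Cp := 2 ^ l * (1 + l * ((D * S) ^ (l + 2) + 1))
  refine ⟨C₁, (Cp + Cl) * C₁, by linarith, by positivity,
    fun {n m K s t} h ht0 ht1 hst hexp A hA i => ?_⟩
  have hs1 := h.one_le_s
  have hs0 : 0 < s := by linarith
  have ht2 : 0 < t ^ 2 := lt_of_lt_of_le (by positivity) hst
  have ht : 0 < t := by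
    rcases ht0.eq_or_lt with h0 | h0
    · rw [← h0] at ht2; norm_num at ht2
    · exact h0
  have htle : t ≤ 1 := (le_mul_of_one_le_left ht0 hC₁1).trans ht1
  have hs2 : 1 / s ^ 2 ≤ t := by
    calc 1 / s ^ 2 ≤ 1 / s :=
          one_div_le_one_div_of_le hs0 (le_self_pow₀ hs1 two_ne_zero)
      _ ≤ t ^ 2 := hst
      _ ≤ t := pow_le_of_le_one ht0 htle two_ne_zero
  obtain ⟨δ, hδ⟩ : ∃ δ, δ = C₁ * t := ⟨_, rfl⟩
  have hδ0 : 0 < δ := by rw [hδ]; positivity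
  have hδ1 : δ ≤ 1 := hδ ▸ ht1
  have hm1 : 1 ≤ m := by have := h.three_le_m; omega
  have hmn : m ≤ n := by have := h.two_mul_m_le; omega
  have hKn : K ≤ n := by rw [← hA]; simpa using A.card_le_univ
  -- Wick's sum does not involve the right planted set, so a bound uniform in `B` survives averaging
  -- over it.
  have hB : ∀ B ∈ Finset.powersetCard K (Finset.univ : Finset (Fin n)),
      |bitExp q (fun g => ∏ j, (√(n : ℝ) * centeredWeight K m p A (i j) (A, B, g))) -
        wickSum m q i| ≤ (Cp + Cl) * C₁ * t := by
    intro B hBm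
    have hBK : B.card = K := (Finset.mem_powersetCard.1 hBm).2
    let x : Fin l → Fin n × Fin n → ℝ := fun j => linCoef a m (A ×ˢ B) (i j)
    let r : Fin l → (Fin n × Fin n → Bool) → ℝ := fun j g =>
      ∑ T, (√(n : ℝ) * av m (i j) (remTerm a (A ×ˢ B) T)) * monomial q T g
    have hsplit : ∀ j g, √(n : ℝ) * centeredWeight K m p A (i j) (A, B, g) =
        linForm q (x j) g + r j g := by
      intro j g
      rw [centeredWeight_eq p hp0 hm1 hmn hKn hA hBK, mul_add, Finset.mul_sum, show (p : ℝ)⁻¹ - 1 = a from haq.symm]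
      congr 1
      · simp only [linForm, x, linCoef, Finset.mul_sum, mul_assoc]
        rfl
      · simp only [r, mul_assoc]
        rfl
    have hxS : ∀ j, ∑ e, x j e ^ 2 ≤ S := fun j => sum_linCoef_sq_le ha h A B hBK (i j)
    have hr : ∀ j, bitExp q (fun g => r j g ^ (2 * (l + 2))) ≤ (δ ^ 2) ^ (l + 2) := by
      intro j
      refine (bitExp_pow_le hp0 hp1 l _).trans ?_
      refine pow_le_pow_left₀ (Finset.sum_nonneg fun T _ => by positivity) ?_ _
      have e1 : ∀ T : Finset (Fin n × Fin n),
          D ^ T.card * (√(n : ℝ) * av m (i j) (remTerm a (A ×ˢ B) T)) ^ 2 =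
          n * (D ^ T.card * av m (i j) (remTerm a (A ×ˢ B) T) ^ 2) := by
        intro T
        rw [mul_pow, Real.sq_sqrt (Nat.cast_nonneg n)]; ring
      rw [Finset.sum_congr rfl fun T _ => e1 T, ← Finset.mul_sum]
      calc _ ≤ Cr / s := hCr h hA hBK (i j)
        _ = Cr * (1 / s) := by ring
        _ ≤ Cr * t ^ 2 := by gcongr
        _ ≤ C₁ ^ 2 * t ^ 2 := by
            have : Cr ≤ C₁ := by rw [hC₁]; linarith
            gcongr
            nlinarith
        _ = δ ^ 2 := by rw [hδ]; ring
    have hL : ∀ j, bitExp q (fun g => linForm q (x j) g ^ (2 * (l + 2))) ≤ (D * S) ^ (l + 2) := by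
      intro j
      refine (bitExp_linForm_pow_le hp0 hp1 l _).trans ?_
      refine pow_le_pow_left₀ (mul_nonneg hD0 (Finset.sum_nonneg fun e _ => sq_nonneg _)) ?_ _
      exact mul_le_mul_of_nonneg_left (hxS j) hD0
    have hxδ : ∀ j e, |x j e| ≤ δ := by
      intro j e
      calc |x j e| ≤ 2 * E / s ^ 2 := abs_linCoef_le ha h _ _ _
        _ = 2 * E * (1 / s ^ 2) := by ring
        _ ≤ 2 * E * t := by gcongr
        _ ≤ C₁ * t := by
            gcongr
            rw [hC₁]; linarith
        _ = δ := hδ.symm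
    have hcov : ∀ j k, |(q⁻¹ - 1) * ∑ e, x j e * x k e - covar m q (i j) (i k)| ≤ δ := by
      intro j k
      have hb := abs_sum_linCoef_mul_sub_covar_le hp0 hp1 h A B hBK (i j) (i k)
      rw [← haq] at hb
      rw [← haq]
      refine hb.trans ?_
      calc 4 * a * (E ^ 2 * (7 * κ + κ * (1 + κ ^ 2 + 7 * κ)) / s ^ 2 +
            2 * E * (1 + κ ^ 2) * (E - expSum a m))
          = 4 * a * (E ^ 2 * (7 * κ + κ * (1 + κ ^ 2 + 7 * κ)) * (1 / s ^ 2) +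
            2 * E * (1 + κ ^ 2) * (E - expSum a m)) := by ring
        _ ≤ 4 * a * (E ^ 2 * (7 * κ + κ * (1 + κ ^ 2 + 7 * κ)) * t +
            2 * E * (1 + κ ^ 2) * t) := by gcongr
        _ = X * t := by ring
        _ ≤ C₁ * t := by
            gcongr
            rw [hC₁]; linarith
        _ = δ := hδ.symm
    have hsymm : ∀ j k, covar m q (i j) (i k) = covar m q (i k) (i j) := fun j k => by
      simp only [covar, eq_comm]
    have h1 := abs_bitExp_prod_add_sub_le hp0 hp1 (fun j => linForm q (x j)) r hδ0 hδ1 hL hr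
    have h2 := hCl hδ0.le hδ1 x hxS hxδ (fun j k => covar m q (i j) (i k)) hsymm hcov
    rw [← wickSum_eq_pairSum] at h2
    simp only [hsplit]
    calc _ ≤ Cp * δ + Cl * δ := (abs_sub_le _ _ _).trans (add_le_add h1 h2)
      _ = _ := by rw [hδ]; ring
  have hne : (Finset.powersetCard K (Finset.univ : Finset (Fin n))).Nonempty :=
    ⟨A, by simp [Finset.mem_powersetCard, hA]⟩
  rw [jointMoment, integral_lawGiven hKn p hA, ← Finset.expect_const hne (wickSum m q i),
    ← Finset.expect_sub_distrib]
  exact (Finset.abs_expect_le _ _).trans (Finset.expect_le hne hB)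

/-- Sizes of order `√n` are eventually on a common scale. -/
lemma exists_eventually_squareRootScale {m K : ℕ → ℕ}
    (hm : Asymptotics.IsTheta Filter.atTop (fun n => (m n : ℝ)) (fun n => √(n : ℝ)))
    (hK : Asymptotics.IsTheta Filter.atTop (fun n => (K n : ℝ)) (fun n => √(n : ℝ))) :
    ∃ κ, 0 ≤ κ ∧ ∀ᶠ n : ℕ in Filter.atTop, SquareRootScale κ n (m n) (K n) √√(n : ℝ) := by
  obtain ⟨c₁, h₁⟩ := hm.1.bound
  obtain ⟨c₂, h₂⟩ := hm.2.bound
  obtain ⟨c₃, h₃⟩ := hK.1.bound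
  obtain ⟨κ, hκ⟩ : ∃ κ, κ = 1 + |c₁| + |c₂| + |c₃| := ⟨_, rfl⟩
  have a₁ := abs_nonneg c₁
  have a₂ := abs_nonneg c₂
  have a₃ := abs_nonneg c₃
  have hκ1 : 1 ≤ κ := by rw [hκ]; linarith
  have k₁ : c₁ ≤ κ := by have := le_abs_self c₁; rw [hκ]; linarith
  have k₂ : c₂ ≤ κ := by have := le_abs_self c₂; rw [hκ]; linarith
  have k₃ : c₃ ≤ κ := by have := le_abs_self c₃; rw [hκ]; linarith
  have hlim : Filter.Tendsto (fun n : ℕ => √(n : ℝ)) Filter.atTop Filter.atTop :=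
    Real.tendsto_sqrt_atTop.comp tendsto_natCast_atTop_atTop
  refine ⟨κ, by linarith, ?_⟩
  -- The threshold `3 * κ` yields `3 ≤ m` through the lower bound on `m`, and `2 * m ≤ n` through
  -- the upper one.
  filter_upwards [h₁, h₂, h₃, hlim.eventually_ge_atTop (3 * κ)] with n b₁ b₂ b₃ hn
  simp only [Real.norm_eq_abs, Nat.abs_cast, abs_of_nonneg (Real.sqrt_nonneg _)] at b₁ b₂ b₃
  have hr0 := Real.sqrt_nonneg (n : ℝ)
  have hm' : (m n : ℝ) ≤ κ * √(n : ℝ) := b₁.trans (mul_le_mul_of_nonneg_right k₁ hr0)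
  have hl' : √(n : ℝ) ≤ κ * m n := b₂.trans (mul_le_mul_of_nonneg_right k₂ (Nat.cast_nonneg _))
  have hK' : (K n : ℝ) ≤ κ * √(n : ℝ) := b₃.trans (mul_le_mul_of_nonneg_right k₃ hr0)
  have hsq : √√(n : ℝ) ^ 2 = √(n : ℝ) := Real.sq_sqrt hr0
  have hnn : √(n : ℝ) ^ 2 = n := Real.sq_sqrt (Nat.cast_nonneg n)
  refine ⟨Real.one_le_sqrt.2 (by linarith), ?_, hκ1, by rwa [hsq], by rwa [hsq], by rwa [hsq], ?_, ?_⟩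
  · rw [show √√(n : ℝ) ^ 4 = (√√(n : ℝ) ^ 2) ^ 2 by ring, hsq, hnn]
  · have : (3 : ℝ) ≤ m n := le_of_mul_le_mul_left (by linarith) (by linarith : 0 < κ)
    exact_mod_cast this
  · have : (2 * m n : ℝ) ≤ n := by rw [← hnn]; nlinarith
    exact_mod_cast this

lemma tendsto_natCast_of_isTheta_sqrt {m : ℕ → ℕ}
    (hm : Asymptotics.IsTheta Filter.atTop (fun n => (m n : ℝ)) (fun n => √(n : ℝ))) :
    Filter.Tendsto m Filter.atTop Filter.atTop := by
  have hlim : Filter.Tendsto (fun n : ℕ => √(n : ℝ)) Filter.atTop Filter.atTop :=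
    Real.tendsto_sqrt_atTop.comp tendsto_natCast_atTop_atTop
  have h := hm.tendsto_norm_atTop_iff.2 (Filter.tendsto_abs_atTop_atTop.comp hlim)
  rw [← tendsto_natCast_atTop_iff (R := ℝ)]
  exact h.congr fun n => by simp

end PlantedBiclique

end

theorem theorem1 (p : unitInterval) (hp0 : 0 < (p : ℝ)) (hp1 : (p : ℝ) < 1) (m K : ℕ → ℕ)
    (hm : Asymptotics.IsTheta Filter.atTop (fun n => (m n : ℝ)) (fun n => √(n : ℝ)))
    (hK : Asymptotics.IsTheta Filter.atTop (fun n => (K n : ℝ)) (fun n => √(n : ℝ)))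
    (l : ℕ) (ε : ℝ) (hε : 0 < ε) :
    ∀ᶠ n : ℕ in Filter.atTop, ∀ A : Finset (Fin n), A.card = K n → ∀ i : Fin l → Fin n,
      |PlantedBiclique.jointMoment (K n) (m n) p A i
        - PlantedBiclique.wickSum (m n) (p : ℝ) i| ≤ ε := by
  obtain ⟨κ, hκ0, hκ⟩ := PlantedBiclique.exists_eventually_squareRootScale hm hK
  obtain ⟨C₁, C₂, -, -, hC⟩ :=
    PlantedBiclique.exists_abs_jointMoment_sub_wickSum_le p hp0 hp1 l hκ0
  set a := (p : ℝ)⁻¹ - 1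
  have ha : 0 ≤ a := by linarith [(one_le_inv₀ hp0).2 hp1.le]
  -- The first summand is `s ^ (-1/2)`, as needed for `1 / s ≤ t ^ 2`; the second is the tail of the
  -- exponential series.
  let t : ℕ → ℝ := fun n =>
    √(1 / √√(n : ℝ)) + (Real.exp a - PlantedBiclique.expSum a (m n))
  have hroot : Filter.Tendsto (fun n : ℕ => √√(n : ℝ)) Filter.atTop Filter.atTop :=
    Real.tendsto_sqrt_atTop.comp (Real.tendsto_sqrt_atTop.comp tendsto_natCast_atTop_atTop)
  have ht : Filter.Tendsto t Filter.atTop (nhds 0) := by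
    have h1 : Filter.Tendsto (fun n : ℕ => √(1 / √√(n : ℝ))) Filter.atTop (nhds 0) := by
      have := (Real.continuous_sqrt.tendsto 0).comp hroot.inv_tendsto_atTop
      rw [Real.sqrt_zero] at this
      exact this.congr fun n => by simp
    have h2 := ((PlantedBiclique.tendsto_expSum a).comp
      (PlantedBiclique.tendsto_natCast_of_isTheta_sqrt hm)).const_sub (Real.exp a)
    rw [sub_self] at h2
    have h3 := h1.add h2
    rwa [add_zero] at h3
  have ht₁ : ∀ᶠ n in Filter.atTop, C₁ * t n ≤ 1 :=
    (ht.const_mul C₁).eventually_le_const (by simp)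
  have ht₂ : ∀ᶠ n in Filter.atTop, C₂ * t n ≤ ε :=
    (ht.const_mul C₂).eventually_le_const (by simpa using hε)
  filter_upwards [hκ, ht₁, ht₂] with n hn h1 h2 A hA i
  have hsum := PlantedBiclique.expSum_le_exp ha (m n)
  have hr := Real.sqrt_nonneg (1 / √√(n : ℝ))
  have hroot_le : √(1 / √√(n : ℝ)) ≤ t n := by simp only [t]; linarith
  refine (hC hn (hr.trans hroot_le) h1 ?_ ?_ A hA i).trans h2
  · calc 1 / √√(n : ℝ) = √(1 / √√(n : ℝ)) ^ 2 := (Real.sq_sqrt (by positivity)).symm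
      _ ≤ t n ^ 2 := pow_le_pow_left₀ hr hroot_le 2
  · simp only [t]; linarith
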